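/- All categories are small. A *promonoidal category* is a category $\mathbb V$ with profunctors $\mathbb V(\bullet;\bullet\otimes\bullet):\mathbb V^{op}\times\mathbb V\times\mathbb V\to\mathbf{Set}$ and $\mathbb V(\bullet;I):\mathbb V^{op}\to\mathbf{Set}$ and with natural isomorphisms (associator, left and right unitor) $$\mathbb V(\bullet;(A\otimes B)\otimes C)\cong\mathbb V(\bullet;A\otimes(B\otimes C)),\qquad \mathbb V(\bullet;I\otimes A)\cong\mathbb V(\bullet;A)\cong\mathbb V(\bullet;A\otimes I)$$ satisfying the pentagon and triangle equations; nested expressions denote composites of profunctors (coends). A *produoidal category* has two promonoidal structures $(\otimes,I)$ and $(\triangleleft,N)$ together with natural laxators $$\psi_2:\mathbb V(\bullet;(X\triangleleft Y)\otimes(Z\triangleleft W))\to\mathbb V(\bullet;(X\otimes Z)\triangleleft(Y\otimes W)),\quad \psi_0:\mathbb V(\bullet;I)\to\mathbb V(\bullet;I\triangleleft I),$$ $$\varphi_2:\mathbb V(\bullet;N\otimes N)\to\mathbb V(\bullet;N),\quad \varphi_0:\mathbb V(\bullet;I)\to\mathbb V(\bullet;N)$$ satisfying the coherence equations of a duoidal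 category. It is *symmetric* if it is endowed with a natural isomorphism $\sigma:\mathbb V(\bullet;A\otimes B)\cong\mathbb V(\bullet;B\otimes A)$ that satisfies the symmetry and hexagon equations and is compatible with the laxators: $\psi_2\circ\sigma=(\sigma\triangleleft\sigma)\circ\psi_2$ and $\varphi_2\circ\sigma=\varphi_2$. It is *normal* if $\varphi_0$ is an isomorphism. A *symmetric produoidal functor* is a functor $F$ with natural transformations $F_\otimes:\mathbb V(A;B\otimes C)\to\mathbb W(FA;FB\otimes FC)$, $F_I:\mathbb V(A;I)\to\mathbb W(FA;I)$, $F_\triangleleft:\mathbb V(A;B\triangleleft C)\to\mathbb W(FA;FB\triangleleft FC)$ and $F_N:\mathbb V(A;N)\to\mathbb W(FA;N)$ that preserve associators, unitors, laxators and symmetries. Let $\mathbf{SymProduo}$ be the category of symmetric produoidal categories and symmetric produoidal functors, and $\mathbf{nSymProduo}$ its full subcategory of normal ones. **Theorem.** The inclusion $\mathcal U:\mathbf{nSymProduo}\to\mathbf{SymProduo}$ has a left adjoint, given by symmetric normalization $\mathcal N_\sigma$. For every symmetric produoidal category $\mathbb V$, the category $\mathcal N_\sigma\mathbb V$ has the objects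 of $\mathbb V$ and is the Kleisli category of the promonad $\mathbb V(\bullet;N\otimes\bullet)$, and, canonically, $$\mathcal N_\sigma\mathbb V(A;B)=\mathbb V(A;N\otimes B),\qquad \mathcal N_\sigma\mathbb V(A;B\otimes C)=\mathbb V(A;N\otimes B\otimes C),$$ $$\mathcal N_\sigma\mathbb V(A;B\triangleleft C)=\mathbb V(A;(N\otimes B)\triangleleft(N\otimes C)),\qquad \mathcal N_\sigma\mathbb V(A;I)=\mathcal N_\sigma\mathbb V(A;N)=\mathbb V(A;N),$$ with the symmetry of $\mathcal N_\sigma\mathbb V$ induced by that of $\mathbb V$. Moreover $\mathcal N_\sigma\mathbb V$ is the free normal symmetric produoidal category on $\mathbb V$: every symmetric produoidal functor from $\mathbb V$ to a normal symmetric produoidal category factors uniquely through the unit $\eta:\mathbb V\to\mathcal N_\sigma\mathbb V$. -/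

import Mathlib

open CategoryTheory Opposite

universe u

namespace Produoidal

/-- Presheaves of sets on a small category. -/
abbrev Psh (C : Type u) [SmallCategory C] := Cᵒᵖ ⥤ Type u

/-- A profunctor `V(•; • ⊗ •)`, covariant in two variables and contravariant in one: the set
`V(A; X ⊗ Y)` is `((P.obj X).obj Y).obj (op A)`. -/
abbrev Split (C : Type u) [SmallCategory C] := C ⥤ C ⥤ Psh C

/-- The representable presheaf `V(•; A)`. -/
abbrev yo {C : Type u} [SmallCategory C] (A : C) : Psh C := yoneda.obj A

/-- The morphism of presheaves `V(•; A) ⟶ F` named by an element of `F A`. -/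
def elt {C : Type u} [SmallCategory C] {F : Psh C} {A : C} (x : F.obj (op A)) : yo A ⟶ F where
  app B := ↾fun f => F.map f.op x
  naturality B B' g := by ext f; simp

section Conv

variable {C : Type u} [SmallCategory C]

/-- Elements of the coproduct `∑ X Y, V(A; X ⊗ Y) × F X × G Y`. -/
structure ConvPre (P : Split C) (F G : Psh C) (A : Cᵒᵖ) : Type u where
  X : C
  Y : C
  s : ((P.obj X).obj Y).obj A
  x : F.obj (op X)
  y : G.obj (op Y)

/-- One step of dinatural equivalence. -/
inductive ConvRel (P : Split C) (F G : Psh C) (A : Cᵒᵖ) :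
    ConvPre P F G A → ConvPre P F G A → Prop
  | mk {X X' Y Y' : C} (f : X ⟶ X') (g : Y ⟶ Y') (s : ((P.obj X).obj Y).obj A)
      (x : F.obj (op X')) (y : G.obj (op Y')) :
      ConvRel P F G A
        ⟨X', Y', ((P.obj X').map g).app A (((P.map f).app Y).app A s), x, y⟩
        ⟨X, Y, s, F.map f.op x, G.map g.op y⟩

/-- The presheaf `V(•; F ⊗ G) = ∫^{X,Y} V(•; X ⊗ Y) × F X × G Y`. -/
def conv (P : Split C) (F G : Psh C) : Psh C where
  obj A := Quot (ConvRel P F G A)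
  map {A B} h := ↾Quot.map (fun e => ⟨e.X, e.Y, ((P.obj e.X).obj e.Y).map h e.s, e.x, e.y⟩) (by
    rintro _ _ ⟨f, g, s, x, y⟩
    have := ConvRel.mk f g (((P.obj _).obj _).map h s) x y
    simpa [NatTrans.naturality_apply] using this)
  map_id A := by ext ⟨e⟩; simp [Quot.map]
  map_comp h k := by ext ⟨e⟩; simp [Quot.map]

/-- The class of a triple `(s, x, y)` in the coend. -/
def cmk {P : Split C} {F G : Psh C} {A : Cᵒᵖ} {X Y : C} (s : ((P.obj X).obj Y).obj A)
    (x : F.obj (op X)) (y : G.obj (op Y)) : (conv P F G).obj A :=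
  Quot.mk _ ⟨X, Y, s, x, y⟩

lemma cmk_din {P : Split C} {F G : Psh C} {A : Cᵒᵖ} {X X' Y Y' : C} (f : X ⟶ X') (g : Y ⟶ Y')
    (s : ((P.obj X).obj Y).obj A) (x : F.obj (op X')) (y : G.obj (op Y')) :
    (cmk (((P.obj X').map g).app A (((P.map f).app Y).app A s)) x y : (conv P F G).obj A) =
      cmk s (F.map f.op x) (G.map g.op y) :=
  Quot.sound (ConvRel.mk f g s x y)

@[simp] lemma conv_map_cmk {P : Split C} {F G : Psh C} {A B : Cᵒᵖ} (h : A ⟶ B) {X Y : C}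
    (s : ((P.obj X).obj Y).obj A) (x : F.obj (op X)) (y : G.obj (op Y)) :
    (conv P F G).map h (cmk s x y) = cmk (((P.obj X).obj Y).map h s) x y := rfl

lemma conv_ind {P : Split C} {F G : Psh C} {A : Cᵒᵖ} {p : (conv P F G).obj A → Prop}
    (h : ∀ (X Y : C) (s : ((P.obj X).obj Y).obj A) (x : F.obj (op X)) (y : G.obj (op Y)),
      p (cmk s x y)) (e : (conv P F G).obj A) : p e := by
  obtain ⟨e⟩ := e
  exact h _ _ _ _ _

/-- A morphism of presheaves out of `V(•; F ⊗ G)` is a dinatural family of morphisms of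
presheaves out of `V(•; X ⊗ Y)`. -/
def convDesc {P : Split C} {F G Z : Psh C}
    (t : ∀ (X Y : C), F.obj (op X) → G.obj (op Y) → ((P.obj X).obj Y ⟶ Z))
    (ht : ∀ {X X' Y Y' : C} (f : X ⟶ X') (g : Y ⟶ Y') (x : F.obj (op X')) (y : G.obj (op Y')),
      (P.map f).app Y ≫ (P.obj X').map g ≫ t X' Y' x y = t X Y (F.map f.op x) (G.map g.op y)) :
    conv P F G ⟶ Z where
  app A := ↾Quot.lift (fun e => (t e.X e.Y e.x e.y).app A e.s) (by
    rintro _ _ ⟨f, g, s, x, y⟩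
    dsimp only
    rw [← ht f g x y]
    rfl)
  naturality A B h := by
    ext e
    induction e using conv_ind with | h X Y s x y =>
    exact NatTrans.naturality_apply (t X Y x y) h s

@[simp] lemma convDesc_cmk {P : Split C} {F G Z : Psh C}
    (t : ∀ (X Y : C), F.obj (op X) → G.obj (op Y) → ((P.obj X).obj Y ⟶ Z))
    (ht : ∀ {X X' Y Y' : C} (f : X ⟶ X') (g : Y ⟶ Y') (x : F.obj (op X')) (y : G.obj (op Y')),
      (P.map f).app Y ≫ (P.obj X').map g ≫ t X' Y' x y = t X Y (F.map f.op x) (G.map g.op y))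
    {A : Cᵒᵖ} {X Y : C} (s : ((P.obj X).obj Y).obj A) (x : F.obj (op X)) (y : G.obj (op Y)) :
    (convDesc t ht).app A (cmk s x y) = (t X Y x y).app A s := rfl

/-- The inclusion `s ↦ [s; x, y]` of `V(•; X ⊗ Y)` into `V(•; F ⊗ G)`. -/
def ins (P : Split C) {F G : Psh C} {X Y : C} (x : F.obj (op X)) (y : G.obj (op Y)) :
    (P.obj X).obj Y ⟶ conv P F G where
  app A := ↾fun s => cmk s x y

@[simp] lemma ins_app (P : Split C) {F G : Psh C} {X Y : C} (x : F.obj (op X)) (y : G.obj (op Y))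
    {A : Cᵒᵖ} (s : ((P.obj X).obj Y).obj A) : (ins P x y).app A s = cmk s x y := rfl

lemma ins_din (P : Split C) {F G : Psh C} {X X' Y Y' : C} (f : X ⟶ X') (g : Y ⟶ Y')
    (x : F.obj (op X')) (y : G.obj (op Y')) :
    (P.map f).app Y ≫ (P.obj X').map g ≫ ins P x y = ins P (F.map f.op x) (G.map g.op y) := by
  ext A s
  exact cmk_din f g s x y

@[ext] lemma conv_ext {P : Split C} {F G Z : Psh C} {t t' : conv P F G ⟶ Z}
    (h : ∀ (X Y : C) (x : F.obj (op X)) (y : G.obj (op Y)), ins P x y ≫ t = ins P x y ≫ t') :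
    t = t' := by
  apply NatTrans.ext
  funext A
  ext e
  induction e using conv_ind with | h X Y s x y =>
  exact congrArg (fun k => k.app A s) (h X Y x y)

/-- Functoriality of `V(•; F ⊗ G)` in `F` and `G`. -/
def convMap (P : Split C) {F F' G G' : Psh C} (f : F ⟶ F') (g : G ⟶ G') :
    conv P F G ⟶ conv P F' G' :=
  convDesc (fun X Y x y => ins P (f.app _ x) (g.app _ y)) (by
    intro X X' Y Y' h k x y
    rw [ins_din, NatTrans.naturality_apply, NatTrans.naturality_apply])

@[simp] lemma convMap_cmk (P : Split C) {F F' G G' : Psh C} (f : F ⟶ F') (g : G ⟶ G')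
    {A : Cᵒᵖ} {X Y : C} (s : ((P.obj X).obj Y).obj A) (x : F.obj (op X)) (y : G.obj (op Y)) :
    (convMap P f g).app A (cmk s x y) = cmk s (f.app _ x) (g.app _ y) := rfl

/-- Yoneda reduction `V(•; A ⊗ B) ≅ ∫^{X,Y} V(•; X ⊗ Y) × V(X; A) × V(Y; B)`, from right to
left. -/
def convYo (P : Split C) (A B : C) : conv P (yo A) (yo B) ⟶ (P.obj A).obj B :=
  convDesc (fun X Y f g => (P.map f).app Y ≫ (P.obj A).map g) (by
    intro X X' Y Y' f g x y
    simp)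

end Conv

section Ext

variable {C : Type u} [SmallCategory C]

lemma yo_map_elt {F : Psh C} {A B : C} (f : A ⟶ B) (x : F.obj (op B)) :
    yoneda.map f ≫ elt x = elt (F.map f.op x) := by
  ext D g
  simp [elt]

@[simp] lemma elt_id {A B : C} (f : A ⟶ B) : (elt (F := yo B) (A := A) f) = yoneda.map f := by
  ext D g
  simp [elt]

@[simp] lemma elt_app_id {F : Psh C} {A : C} (x : F.obj (op A)) :
    (elt x).app (op A) (𝟙 A) = x := by
  simp [elt]

lemma cmk_id_din {Q : Split C} {A : Cᵒᵖ} {X X' Y Y' : C} (f : X ⟶ X') (g : Y ⟶ Y')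
    (s : ((Q.obj X).obj Y).obj A) :
    (cmk (((Q.obj X').map g).app A (((Q.map f).app Y).app A s)) (𝟙 X') (𝟙 Y') :
      (conv Q (yo X') (yo Y')).obj A) = cmk s f g := by
  have := cmk_din (F := yo X') (G := yo Y') f g s (𝟙 X') (𝟙 Y')
  simpa using this

lemma ins_convMap (P : Split C) {F F' G G' : Psh C} {X Y : C} (x : F.obj (op X))
    (y : G.obj (op Y)) (f : F ⟶ F') (g : G ⟶ G') :
    ins P x y ≫ convMap P f g = ins P (f.app _ x) (g.app _ y) := rfl

lemma convMap_comp (P : Split C) {F F' F'' G G' G'' : Psh C} (f : F ⟶ F') (f' : F' ⟶ F'')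
    (g : G ⟶ G') (g' : G' ⟶ G'') :
    convMap P (f ≫ f') (g ≫ g') = convMap P f g ≫ convMap P f' g' := by
  ext X Y x y : 1
  rfl

/-- A morphism of presheaves out of `V(•; (F ⊗' G) ⊗ H)` is determined by its restrictions along
all `A ⟶ F`, `B ⟶ G`, `D ⟶ H` with `A`, `B`, `D` representable. -/
def extL {P Q : Split C} {F G H Z : Psh C}
    (t : ∀ A B D : C, F.obj (op A) → G.obj (op B) → H.obj (op D) →
      (conv P (conv Q (yo A) (yo B)) (yo D) ⟶ Z))
    (ht : ∀ {A A' B B' D D' : C} (f : A ⟶ A') (g : B ⟶ B') (h : D ⟶ D')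
      (x : F.obj (op A')) (y : G.obj (op B')) (z : H.obj (op D')),
      convMap P (convMap Q (yoneda.map f) (yoneda.map g)) (yoneda.map h) ≫ t A' B' D' x y z =
        t A B D (F.map f.op x) (G.map g.op y) (H.map h.op z)) :
    conv P (conv Q F G) H ⟶ Z :=
  convDesc
    (fun X Y q z => Quot.lift (r := ConvRel Q F G (op X))
      (fun e => ins P (cmk e.s (𝟙 e.X) (𝟙 e.Y) : (conv Q (yo e.X) (yo e.Y)).obj (op X))
        (𝟙 Y : (yo Y).obj (op Y)) ≫ t e.X e.Y Y e.x e.y z) (by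
        rintro _ _ ⟨f, g, s, x, y⟩
        dsimp only
        have h := ht f g (𝟙 Y) x y z
        simp only [op_id, Functor.map_id_apply] at h
        rw [← h, ← Category.assoc, ins_convMap, cmk_id_din]
        simp) q) (by
    intro X X' Y Y' f g q z
    induction q using conv_ind with | h U V s x y =>
    have h := ht (𝟙 U) (𝟙 V) g x y z
    simp only [op_id, Functor.map_id_apply] at h
    change (P.map f).app Y ≫ (P.obj X').map g ≫ ins P _ _ ≫ _ = ins P _ _ ≫ _
    rw [← h, ← Category.assoc ((P.obj X').map g), ← Category.assoc ((P.map f).app Y), ins_din,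
      ← Category.assoc, ins_convMap]
    simp)

/-- A morphism of presheaves out of `V(•; F ⊗ (G ⊗' H))` is determined by its restrictions along
all `A ⟶ F`, `B ⟶ G`, `D ⟶ H` with `A`, `B`, `D` representable. -/
def extR {P Q : Split C} {F G H Z : Psh C}
    (t : ∀ A B D : C, F.obj (op A) → G.obj (op B) → H.obj (op D) →
      (conv P (yo A) (conv Q (yo B) (yo D)) ⟶ Z))
    (ht : ∀ {A A' B B' D D' : C} (f : A ⟶ A') (g : B ⟶ B') (h : D ⟶ D')
      (x : F.obj (op A')) (y : G.obj (op B')) (z : H.obj (op D')),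
      convMap P (yoneda.map f) (convMap Q (yoneda.map g) (yoneda.map h)) ≫ t A' B' D' x y z =
        t A B D (F.map f.op x) (G.map g.op y) (H.map h.op z)) :
    conv P F (conv Q G H) ⟶ Z :=
  convDesc
    (fun X Y x q => Quot.lift (r := ConvRel Q G H (op Y))
      (fun e => ins P (𝟙 X : (yo X).obj (op X))
        (cmk e.s (𝟙 e.X) (𝟙 e.Y) : (conv Q (yo e.X) (yo e.Y)).obj (op Y)) ≫
          t X e.X e.Y x e.x e.y) (by
        rintro _ _ ⟨f, g, s, y, z⟩
        dsimp only
        have h := ht (𝟙 X) f g x y z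
        simp only [op_id, Functor.map_id_apply] at h
        rw [← h, ← Category.assoc, ins_convMap, cmk_id_din]
        simp) q) (by
    intro X X' Y Y' f g x q
    induction q using conv_ind with | h U V s y z =>
    have h := ht f (𝟙 U) (𝟙 V) x y z
    simp only [op_id, Functor.map_id_apply] at h
    change (P.map f).app Y ≫ (P.obj X').map g ≫ ins P _ _ ≫ _ = ins P _ _ ≫ _
    rw [← h, ← Category.assoc ((P.obj X').map g), ← Category.assoc ((P.map f).app Y), ins_din,
      ← Category.assoc, ins_convMap]
    simp)

/-- A morphism of presheaves out of `V(•; (F ⊗' G) ⊗ (H ⊗' K))` is determined by its restrictions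
along all `A ⟶ F`, `B ⟶ G`, `D ⟶ H`, `E ⟶ K` with `A`, `B`, `D`, `E` representable. -/
def extLR {P Q : Split C} {F G H K Z : Psh C}
    (t : ∀ A B D E : C, F.obj (op A) → G.obj (op B) → H.obj (op D) → K.obj (op E) →
      (conv P (conv Q (yo A) (yo B)) (conv Q (yo D) (yo E)) ⟶ Z))
    (ht : ∀ {A A' B B' D D' E E' : C} (f : A ⟶ A') (g : B ⟶ B') (h : D ⟶ D') (k : E ⟶ E')
      (x : F.obj (op A')) (y : G.obj (op B')) (z : H.obj (op D')) (w : K.obj (op E')),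
      convMap P (convMap Q (yoneda.map f) (yoneda.map g))
          (convMap Q (yoneda.map h) (yoneda.map k)) ≫ t A' B' D' E' x y z w =
        t A B D E (F.map f.op x) (G.map g.op y) (H.map h.op z) (K.map k.op w)) :
    conv P (conv Q F G) (conv Q H K) ⟶ Z :=
  convDesc
    (fun X Y q r => Quot.lift (r := ConvRel Q F G (op X))
      (fun e => Quot.lift (r := ConvRel Q H K (op Y))
        (fun e' => ins P (cmk e.s (𝟙 e.X) (𝟙 e.Y) : (conv Q (yo e.X) (yo e.Y)).obj (op X))
          (cmk e'.s (𝟙 e'.X) (𝟙 e'.Y) : (conv Q (yo e'.X) (yo e'.Y)).obj (op Y)) ≫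
            t e.X e.Y e'.X e'.Y e.x e.y e'.x e'.y) (by
          rintro _ _ ⟨h, k, s, z, w⟩
          dsimp only
          have hh := ht (𝟙 e.X) (𝟙 e.Y) h k e.x e.y z w
          simp only [op_id, Functor.map_id_apply] at hh
          rw [← hh, ← Category.assoc, ins_convMap, cmk_id_din]
          simp) r) (by
        rintro _ _ ⟨f, g, s, x, y⟩
        induction r using conv_ind with | h U V s' z w =>
        change ins P _ _ ≫ _ = ins P _ _ ≫ _
        have hh := ht f g (𝟙 U) (𝟙 V) x y z w
        simp only [op_id, Functor.map_id_apply] at hh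
        rw [← hh, ← Category.assoc, ins_convMap, cmk_id_din]
        simp) q) (by
    intro X X' Y Y' f g q r
    induction q using conv_ind with | h U V s x y =>
    induction r using conv_ind with | h U' V' s' z w =>
    change (P.map f).app Y ≫ (P.obj X').map g ≫ ins P _ _ ≫ _ = ins P _ _ ≫ _
    rw [← Category.assoc ((P.obj X').map g), ← Category.assoc ((P.map f).app Y), ins_din]
    simp)

end Ext

section Structures

/-- The data of a promonoidal category: the profunctors `V(•; • ⊗ •)` and `V(•; I)`, and natural
associators and unitors. A nested expression such as `V(•; (A ⊗ B) ⊗ D)` is the composite of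
profunctors, written as a convolution of representables (by Yoneda reduction, `V(•; A ⊗ B)` is
`conv tensor (yo A) (yo B)`). -/
structure PromonoidalData (C : Type u) [SmallCategory C] where
  tensor : Split C
  unit : Psh C
  assoc : ∀ A B D : C, conv tensor (conv tensor (yo A) (yo B)) (yo D) ≅
    conv tensor (yo A) (conv tensor (yo B) (yo D))
  assoc_natural : ∀ {A A' B B' D D' : C} (f : A ⟶ A') (g : B ⟶ B') (h : D ⟶ D'),
    convMap tensor (convMap tensor (yoneda.map f) (yoneda.map g)) (yoneda.map h) ≫
        (assoc A' B' D').hom =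
      (assoc A B D).hom ≫
        convMap tensor (yoneda.map f) (convMap tensor (yoneda.map g) (yoneda.map h))
  leftUnitor : ∀ A : C, conv tensor unit (yo A) ≅ yo A
  leftUnitor_natural : ∀ {A A' : C} (f : A ⟶ A'),
    convMap tensor (𝟙 unit) (yoneda.map f) ≫ (leftUnitor A').hom =
      (leftUnitor A).hom ≫ yoneda.map f
  rightUnitor : ∀ A : C, conv tensor (yo A) unit ≅ yo A
  rightUnitor_natural : ∀ {A A' : C} (f : A ⟶ A'),
    convMap tensor (yoneda.map f) (𝟙 unit) ≫ (rightUnitor A').hom =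
      (rightUnitor A).hom ≫ yoneda.map f

namespace PromonoidalData

variable {C : Type u} [SmallCategory C] (M : PromonoidalData C)

/-- The associator at virtual objects: `V(•; (F ⊗ G) ⊗ H) ⟶ V(•; F ⊗ (G ⊗ H))`. -/
def assocExt (F G H : Psh C) :
    conv M.tensor (conv M.tensor F G) H ⟶ conv M.tensor F (conv M.tensor G H) :=
  extL (fun A B D x y z => (M.assoc A B D).hom ≫
      convMap M.tensor (elt x) (convMap M.tensor (elt y) (elt z))) (by
    intro A A' B B' D D' f g h x y z
    rw [← Category.assoc, M.assoc_natural, Category.assoc, ← convMap_comp, ← convMap_comp,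
      yo_map_elt, yo_map_elt, yo_map_elt])

/-- The inverse associator at virtual objects. -/
def assocInvExt (F G H : Psh C) :
    conv M.tensor F (conv M.tensor G H) ⟶ conv M.tensor (conv M.tensor F G) H :=
  extR (fun A B D x y z => (M.assoc A B D).inv ≫
      convMap M.tensor (convMap M.tensor (elt x) (elt y)) (elt z)) (by
    intro A A' B B' D D' f g h x y z
    have : convMap M.tensor (yoneda.map f) (convMap M.tensor (yoneda.map g) (yoneda.map h)) ≫
        (M.assoc A' B' D').inv = (M.assoc A B D).inv ≫
        convMap M.tensor (convMap M.tensor (yoneda.map f) (yoneda.map g)) (yoneda.map h) := by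
      rw [Iso.comp_inv_eq, Category.assoc, M.assoc_natural, Iso.inv_hom_id_assoc]
    rw [← Category.assoc, this, Category.assoc, ← convMap_comp, ← convMap_comp,
      yo_map_elt, yo_map_elt, yo_map_elt])

/-- The left unitor at a virtual object: `V(•; I ⊗ F) ⟶ F`. -/
def leftExt (F : Psh C) : conv M.tensor M.unit F ⟶ F :=
  convDesc (fun X Y i x => ins M.tensor i (𝟙 Y : (yo Y).obj (op Y)) ≫
      (M.leftUnitor Y).hom ≫ elt x) (by
    intro X X' Y Y' f g i x
    rw [← yo_map_elt, ← Category.assoc (M.leftUnitor Y).hom, ← M.leftUnitor_natural,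
      ← Category.assoc ((M.tensor.obj X').map g), ← Category.assoc ((M.tensor.map f).app Y),
      ins_din, Category.assoc, ← Category.assoc (ins M.tensor _ _) (convMap _ _ _), ins_convMap]
    simp)

/-- The right unitor at a virtual object: `V(•; F ⊗ I) ⟶ F`. -/
def rightExt (F : Psh C) : conv M.tensor F M.unit ⟶ F :=
  convDesc (fun X Y x i => ins M.tensor (𝟙 X : (yo X).obj (op X)) i ≫
      (M.rightUnitor X).hom ≫ elt x) (by
    intro X X' Y Y' f g x i
    rw [← yo_map_elt, ← Category.assoc (M.rightUnitor X).hom, ← M.rightUnitor_natural,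
      ← Category.assoc ((M.tensor.obj X').map g), ← Category.assoc ((M.tensor.map f).app Y),
      ins_din, Category.assoc, ← Category.assoc (ins M.tensor _ _) (convMap _ _ _), ins_convMap]
    simp)

end PromonoidalData

/-- A promonoidal category: the associators and unitors satisfy the pentagon and the triangle. -/
structure Promonoidal (C : Type u) [SmallCategory C] extends PromonoidalData C where
  pentagon : ∀ A B D E : C,
    toPromonoidalData.assocExt (conv tensor (yo A) (yo B)) (yo D) (yo E) ≫
        toPromonoidalData.assocExt (yo A) (yo B) (conv tensor (yo D) (yo E)) =
      convMap tensor (assoc A B D).hom (𝟙 (yo E)) ≫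
        toPromonoidalData.assocExt (yo A) (conv tensor (yo B) (yo D)) (yo E) ≫
          convMap tensor (𝟙 (yo A)) (assoc B D E).hom
  triangle : ∀ A B : C,
    toPromonoidalData.assocExt (yo A) unit (yo B) ≫
        convMap tensor (𝟙 (yo A)) (leftUnitor B).hom =
      convMap tensor (rightUnitor A).hom (𝟙 (yo B))

/-- The data of a produoidal category: two promonoidal structures, `par` (that is, `⊗`, `I`) and
`seq` (that is, `◁`, `N`), and natural laxators. -/
structure DuoData (C : Type u) [SmallCategory C] where
  par : Promonoidal C
  seq : Promonoidal C
  psi2 : ∀ X Y Z W : C,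
    conv par.tensor (conv seq.tensor (yo X) (yo Y)) (conv seq.tensor (yo Z) (yo W)) ⟶
      conv seq.tensor (conv par.tensor (yo X) (yo Z)) (conv par.tensor (yo Y) (yo W))
  psi2_natural : ∀ {X X' Y Y' Z Z' W W' : C} (f : X ⟶ X') (g : Y ⟶ Y') (h : Z ⟶ Z') (k : W ⟶ W'),
    convMap par.tensor (convMap seq.tensor (yoneda.map f) (yoneda.map g))
        (convMap seq.tensor (yoneda.map h) (yoneda.map k)) ≫ psi2 X' Y' Z' W' =
      psi2 X Y Z W ≫ convMap seq.tensor (convMap par.tensor (yoneda.map f) (yoneda.map h))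
        (convMap par.tensor (yoneda.map g) (yoneda.map k))
  psi0 : par.unit ⟶ conv seq.tensor par.unit par.unit
  phi2 : conv par.tensor seq.unit seq.unit ⟶ seq.unit
  phi0 : par.unit ⟶ seq.unit

/-- The laxator `ψ₂` at virtual objects:
`V(•; (F ◁ G) ⊗ (H ◁ K)) ⟶ V(•; (F ⊗ H) ◁ (G ⊗ K))`. -/
def DuoData.psi2Ext {C : Type u} [SmallCategory C] (V : DuoData C) (F G H K : Psh C) :
    conv V.par.tensor (conv V.seq.tensor F G) (conv V.seq.tensor H K) ⟶
      conv V.seq.tensor (conv V.par.tensor F H) (conv V.par.tensor G K) :=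
  extLR (fun A B D E x y z w => V.psi2 A B D E ≫
      convMap V.seq.tensor (convMap V.par.tensor (elt x) (elt z))
        (convMap V.par.tensor (elt y) (elt w))) (by
    intro A A' B B' D D' E E' f g h k x y z w
    rw [← Category.assoc, V.psi2_natural, Category.assoc, ← convMap_comp, ← convMap_comp,
      ← convMap_comp, yo_map_elt, yo_map_elt, yo_map_elt, yo_map_elt])

/-- A produoidal category: the laxators satisfy the coherence conditions of a duoidal category. -/
structure ProduoidalCat (C : Type u) [SmallCategory C] extends DuoData C where
  psi2_par_assoc : ∀ A B D E F G : C,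
    par.assocExt (conv seq.tensor (yo A) (yo B)) (conv seq.tensor (yo D) (yo E))
        (conv seq.tensor (yo F) (yo G)) ≫
      convMap par.tensor (𝟙 _) (psi2 D E F G) ≫
        toDuoData.psi2Ext (yo A) (yo B) (conv par.tensor (yo D) (yo F))
          (conv par.tensor (yo E) (yo G)) =
    convMap par.tensor (psi2 A B D E) (𝟙 _) ≫
      toDuoData.psi2Ext (conv par.tensor (yo A) (yo D)) (conv par.tensor (yo B) (yo E))
          (yo F) (yo G) ≫
        convMap seq.tensor (par.assoc A D F).hom (par.assoc B E G).hom
  psi2_seq_assoc : ∀ A B D E F G : C,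
    convMap par.tensor (seq.assoc A B D).hom (seq.assoc E F G).hom ≫
      toDuoData.psi2Ext (yo A) (conv seq.tensor (yo B) (yo D)) (yo E)
          (conv seq.tensor (yo F) (yo G)) ≫
        convMap seq.tensor (𝟙 _) (psi2 B D F G) =
    toDuoData.psi2Ext (conv seq.tensor (yo A) (yo B)) (yo D) (conv seq.tensor (yo E) (yo F))
        (yo G) ≫
      convMap seq.tensor (psi2 A B E F) (𝟙 _) ≫
        seq.assocExt (conv par.tensor (yo A) (yo E)) (conv par.tensor (yo B) (yo F))
          (conv par.tensor (yo D) (yo G))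
  psi2_par_left : ∀ A B : C,
    convMap par.tensor psi0 (𝟙 (conv seq.tensor (yo A) (yo B))) ≫
      toDuoData.psi2Ext par.unit par.unit (yo A) (yo B) ≫
        convMap seq.tensor (par.leftUnitor A).hom (par.leftUnitor B).hom =
    par.leftExt (conv seq.tensor (yo A) (yo B))
  psi2_par_right : ∀ A B : C,
    convMap par.tensor (𝟙 (conv seq.tensor (yo A) (yo B))) psi0 ≫
      toDuoData.psi2Ext (yo A) (yo B) par.unit par.unit ≫
        convMap seq.tensor (par.rightUnitor A).hom (par.rightUnitor B).hom =
    par.rightExt (conv seq.tensor (yo A) (yo B))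
  psi2_seq_left : ∀ A B : C,
    toDuoData.psi2Ext seq.unit (yo A) seq.unit (yo B) ≫
      convMap seq.tensor phi2 (𝟙 (conv par.tensor (yo A) (yo B))) ≫
        seq.leftExt (conv par.tensor (yo A) (yo B)) =
    convMap par.tensor (seq.leftUnitor A).hom (seq.leftUnitor B).hom
  psi2_seq_right : ∀ A B : C,
    toDuoData.psi2Ext (yo A) seq.unit (yo B) seq.unit ≫
      convMap seq.tensor (𝟙 (conv par.tensor (yo A) (yo B))) phi2 ≫
        seq.rightExt (conv par.tensor (yo A) (yo B)) =
    convMap par.tensor (seq.rightUnitor A).hom (seq.rightUnitor B).hom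
  phi2_assoc :
    par.assocExt seq.unit seq.unit seq.unit ≫ convMap par.tensor (𝟙 seq.unit) phi2 ≫ phi2 =
      convMap par.tensor phi2 (𝟙 seq.unit) ≫ phi2
  psi0_coassoc :
    psi0 ≫ convMap seq.tensor psi0 (𝟙 par.unit) ≫ seq.assocExt par.unit par.unit par.unit =
      psi0 ≫ convMap seq.tensor (𝟙 par.unit) psi0
  phi2_right : convMap par.tensor (𝟙 seq.unit) phi0 ≫ phi2 = par.rightExt seq.unit
  phi2_left : convMap par.tensor phi0 (𝟙 seq.unit) ≫ phi2 = par.leftExt seq.unit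
  psi0_right : psi0 ≫ convMap seq.tensor (𝟙 par.unit) phi0 ≫ seq.rightExt par.unit = 𝟙 par.unit
  psi0_left : psi0 ≫ convMap seq.tensor phi0 (𝟙 par.unit) ≫ seq.leftExt par.unit = 𝟙 par.unit

/-- A natural symmetry `σ : V(•; A ⊗ B) ⟶ V(•; B ⊗ A)`, inverse to itself. -/
structure Symmetry {C : Type u} [SmallCategory C] (P : Split C) where
  app : ∀ A B : C, (P.obj A).obj B ⟶ (P.obj B).obj A
  natural : ∀ {A A' B B' : C} (f : A ⟶ A') (g : B ⟶ B'),
    (P.map f).app B ≫ (P.obj A').map g ≫ app A' B' = app A B ≫ (P.map g).app A ≫ (P.obj B').map f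
  symmetry : ∀ A B : C, app A B ≫ app B A = 𝟙 _

/-- The symmetry at virtual objects: `V(•; F ⊗ G) ⟶ V(•; G ⊗ F)`. -/
def Symmetry.ext {C : Type u} [SmallCategory C] {P : Split C} (S : Symmetry P) (F G : Psh C) :
    conv P F G ⟶ conv P G F :=
  convDesc (fun X Y x y => S.app X Y ≫ ins P y x) (by
    intro X X' Y Y' f g x y
    rw [← ins_din, ← Category.assoc ((P.obj X').map g), ← Category.assoc ((P.map f).app Y),
      S.natural]
    simp only [Category.assoc])

/-- A symmetric produoidal category: `⊗` carries a symmetry satisfying the hexagon equation and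
compatible with the laxators `ψ₂` and `φ₂`. -/
structure SymProduoidalCat (C : Type u) [SmallCategory C] extends ProduoidalCat C where
  sym : Symmetry par.tensor
  hexagon : ∀ A B D : C,
    (par.assoc A B D).hom ≫ sym.ext (yo A) (conv par.tensor (yo B) (yo D)) ≫
        (par.assoc B D A).hom =
      convMap par.tensor (sym.ext (yo A) (yo B)) (𝟙 (yo D)) ≫ (par.assoc B A D).hom ≫
        convMap par.tensor (𝟙 (yo B)) (sym.ext (yo A) (yo D))
  psi2_sym : ∀ X Y Z W : C,
    sym.ext (conv seq.tensor (yo X) (yo Y)) (conv seq.tensor (yo Z) (yo W)) ≫ psi2 Z W X Y =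
      psi2 X Y Z W ≫ convMap seq.tensor (sym.ext (yo X) (yo Z)) (sym.ext (yo Y) (yo W))
  phi2_sym : sym.ext seq.unit seq.unit ≫ phi2 = phi2

end Structures

section Functors

variable {C D E : Type u} [SmallCategory C] [SmallCategory D] [SmallCategory E]

lemma psh_hom_ext {F G : Psh C} {f g : F ⟶ G}
    (h : ∀ (A : Cᵒᵖ) (x : F.obj A), f.app A x = g.app A x) : f = g := by
  apply NatTrans.ext
  funext A
  ext x
  exact h A x

/-- A natural transformation `V(A; X ⊗ Y) ⟶ W(F A; F X ⊗ F Y)` over a functor `F`. -/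
@[ext] structure SplitMap (F : C ⥤ D) (P : Split C) (Q : Split D) where
  app : ∀ X Y : C, (P.obj X).obj Y ⟶ F.op ⋙ (Q.obj (F.obj X)).obj (F.obj Y)
  natural : ∀ {X X' Y Y' : C} (f : X ⟶ X') (g : Y ⟶ Y'),
    (P.map f).app Y ≫ (P.obj X').map g ≫ app X' Y' =
      app X Y ≫ Functor.whiskerLeft F.op
        ((Q.map (F.map f)).app (F.obj Y) ≫ (Q.obj (F.obj X')).map (F.map g))

/-- The identity transformation. -/
def SplitMap.id (P : Split C) : SplitMap (𝟭 C) P P where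
  app X Y := 𝟙 ((P.obj X).obj Y)
  natural _ _ := rfl

/-- Composition of transformations over functors. -/
def SplitMap.comp {F : C ⥤ D} {G : D ⥤ E} {P : Split C} {Q : Split D} {R : Split E}
    (s : SplitMap F P Q) (t : SplitMap G Q R) : SplitMap (F ⋙ G) P R where
  app X Y := s.app X Y ≫ Functor.whiskerLeft F.op (t.app (F.obj X) (F.obj Y))
  natural {X X' Y Y'} f g := by
    have h1 := s.natural f g
    have h2 := t.natural (F.map f) (F.map g)
    ext A x
    have h1' := congrArg (fun k => (k.app A) x) h1
    have h2' := congrArg (fun k => (k.app (F.op.obj A)) ((s.app X Y).app A x)) h2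
    simp at h1' h2' ⊢
    rw [h1', h2']

/-- The map `V(•; G ⊗ H) ⟶ W(F •; G' ⊗ H')` induced on coends by a transformation of splits and
by `G ⟶ F.op ⋙ G'`, `H ⟶ F.op ⋙ H'`. -/
def convOver {F : C ⥤ D} {P : Split C} {Q : Split D} (s : SplitMap F P Q) {G H : Psh C}
    {G' H' : Psh D} (a : G ⟶ F.op ⋙ G') (b : H ⟶ F.op ⋙ H') :
    conv P G H ⟶ F.op ⋙ conv Q G' H' :=
  convDesc (fun X Y x y => s.app X Y ≫ Functor.whiskerLeft F.op
      (ins Q (F := G') (G := H') (X := F.obj X) (Y := F.obj Y) (a.app (op X) x)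
        (b.app (op Y) y))) (by
    intro X X' Y Y' f g x y
    have h1 := s.natural f g
    rw [← Category.assoc ((P.obj X').map g), ← Category.assoc ((P.map f).app Y), h1,
      Category.assoc, ← Functor.whiskerLeft_comp, Category.assoc, ins_din,
      NatTrans.naturality_apply, NatTrans.naturality_apply]
    rfl)

lemma convOver_id_apply {P : Split C} {G H : Psh C} (a : G ⟶ (𝟭 C).op ⋙ G)
    (b : H ⟶ (𝟭 C).op ⋙ H) (ha : ∀ (X : Cᵒᵖ) (x : G.obj X), a.app X x = x)
    (hb : ∀ (X : Cᵒᵖ) (y : H.obj X), b.app X y = y) (A : Cᵒᵖ) (z : (conv P G H).obj A) :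
    (convOver (SplitMap.id P) (G' := G) (H' := H) a b).app A z = z := by
  induction z using conv_ind with | h X Y s x y =>
  change (cmk s (a.app (op X) x) (b.app (op Y) y) : (conv P G H).obj A) = _
  rw [ha, hb]

lemma convOver_comp_apply {F : C ⥤ D} {K : D ⥤ E} {P : Split C} {Q : Split D} {R : Split E}
    (s : SplitMap F P Q) (t : SplitMap K Q R) {G H : Psh C} {G' H' : Psh D} {G'' H'' : Psh E}
    {a : G ⟶ F.op ⋙ G'} {b : H ⟶ F.op ⋙ H'} {a' : G' ⟶ K.op ⋙ G''} {b' : H' ⟶ K.op ⋙ H''}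
    {a'' : G ⟶ (F ⋙ K).op ⋙ G''} {b'' : H ⟶ (F ⋙ K).op ⋙ H''}
    (ha : ∀ (X : Cᵒᵖ) (x : G.obj X), a''.app X x = a'.app (F.op.obj X) (a.app X x))
    (hb : ∀ (X : Cᵒᵖ) (y : H.obj X), b''.app X y = b'.app (F.op.obj X) (b.app X y))
    (A : Cᵒᵖ) (z : (conv P G H).obj A) :
    (convOver (s.comp t) a'' b'').app A z =
      (convOver t a' b').app (F.op.obj A) ((convOver s a b).app A z) := by
  induction z using conv_ind with | h X Y r x y =>
  change (cmk ((t.app (F.obj X) (F.obj Y)).app (F.op.obj A) ((s.app X Y).app A r))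
    (a''.app (op X) x) (b''.app (op Y) y) : (conv R G'' H'').obj (K.op.obj (F.op.obj A))) = _
  rw [ha, hb]
  rfl

/-- The part of a promonoidal functor over a functor `F`: transformations `F_⊗` and `F_I` that
preserve associators and unitors. -/
@[ext] structure PromonoidalMap (F : C ⥤ D) (M : Promonoidal C) (M' : Promonoidal D) where
  split : SplitMap F M.tensor M'.tensor
  unit : M.unit ⟶ F.op ⋙ M'.unit
  map_assoc : ∀ A B K : C,
    convOver split (convOver split (yonedaMap F A) (yonedaMap F B)) (yonedaMap F K) ≫
        Functor.whiskerLeft F.op (M'.assoc (F.obj A) (F.obj B) (F.obj K)).hom =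
      (M.assoc A B K).hom ≫
        convOver split (yonedaMap F A) (convOver split (yonedaMap F B) (yonedaMap F K))
  map_left : ∀ A : C,
    convOver split unit (yonedaMap F A) ≫
        Functor.whiskerLeft F.op (M'.leftUnitor (F.obj A)).hom =
      (M.leftUnitor A).hom ≫ yonedaMap F A
  map_right : ∀ A : C,
    convOver split (yonedaMap F A) unit ≫
        Functor.whiskerLeft F.op (M'.rightUnitor (F.obj A)).hom =
      (M.rightUnitor A).hom ≫ yonedaMap F A

/-- The identity promonoidal functor. -/
def PromonoidalMap.id (M : Promonoidal C) : PromonoidalMap (𝟭 C) M M where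
  split := SplitMap.id M.tensor
  unit := 𝟙 M.unit
  map_assoc A B K := by
    refine psh_hom_ext fun X z => ?_
    have h1 := convOver_id_apply (P := M.tensor) (yonedaMap (𝟭 C) A) (yonedaMap (𝟭 C) B)
      (fun _ _ => rfl) (fun _ _ => rfl)
    have h2 := convOver_id_apply (P := M.tensor) (yonedaMap (𝟭 C) B) (yonedaMap (𝟭 C) K)
      (fun _ _ => rfl) (fun _ _ => rfl)
    have h3 := convOver_id_apply _ (yonedaMap (𝟭 C) K) h1 (fun _ _ => rfl) X z
    have h4 := convOver_id_apply (yonedaMap (𝟭 C) A) _ (fun _ _ => rfl) h2 X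
      ((M.assoc A B K).hom.app X z)
    exact (congrArg (fun w => (M.assoc A B K).hom.app X w) h3).trans h4.symm
  map_left A := by
    refine psh_hom_ext fun X z => ?_
    have h := convOver_id_apply (P := M.tensor) (𝟙 M.unit) (yonedaMap (𝟭 C) A)
      (fun _ _ => rfl) (fun _ _ => rfl) X z
    exact congrArg (fun w => (M.leftUnitor A).hom.app X w) h
  map_right A := by
    refine psh_hom_ext fun X z => ?_
    have h := convOver_id_apply (P := M.tensor) (yonedaMap (𝟭 C) A) (𝟙 M.unit)
      (fun _ _ => rfl) (fun _ _ => rfl) X z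
    exact congrArg (fun w => (M.rightUnitor A).hom.app X w) h

/-- Composition of promonoidal functors. -/
def PromonoidalMap.comp {F : C ⥤ D} {K : D ⥤ E} {M : Promonoidal C} {M' : Promonoidal D}
    {M'' : Promonoidal E} (s : PromonoidalMap F M M') (t : PromonoidalMap K M' M'') :
    PromonoidalMap (F ⋙ K) M M'' where
  split := s.split.comp t.split
  unit := s.unit ≫ Functor.whiskerLeft F.op t.unit
  map_assoc A B L := by
    refine psh_hom_ext fun X z => ?_
    have e1 := convOver_comp_apply s.split t.split (a := yonedaMap F A) (b := yonedaMap F B)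
      (a' := yonedaMap K _) (b' := yonedaMap K _) (a'' := yonedaMap (F ⋙ K) A)
      (b'' := yonedaMap (F ⋙ K) B) (fun _ _ => rfl) (fun _ _ => rfl)
    have e2 := convOver_comp_apply s.split t.split (a := yonedaMap F B) (b := yonedaMap F L)
      (a' := yonedaMap K _) (b' := yonedaMap K _) (a'' := yonedaMap (F ⋙ K) B)
      (b'' := yonedaMap (F ⋙ K) L) (fun _ _ => rfl) (fun _ _ => rfl)
    have e3 := convOver_comp_apply s.split t.split (b := yonedaMap F L)
      (b' := yonedaMap K _) (b'' := yonedaMap (F ⋙ K) L) e1 (fun _ _ => rfl) X z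
    have e4 := convOver_comp_apply s.split t.split (a := yonedaMap F A)
      (a' := yonedaMap K _) (a'' := yonedaMap (F ⋙ K) A) (fun _ _ => rfl) e2 X
      ((M.assoc A B L).hom.app X z)
    have h1 := congrArg (fun k => k.app X z) (s.map_assoc A B L)
    have h2 := congrArg (fun k => k.app (F.op.obj X) ((convOver s.split
      (convOver s.split (yonedaMap F A) (yonedaMap F B)) (yonedaMap F L)).app X z))
      (t.map_assoc (F.obj A) (F.obj B) (F.obj L))
    refine (congrArg (fun w => (M''.assoc (K.obj (F.obj A)) (K.obj (F.obj B))
      (K.obj (F.obj L))).hom.app ((F ⋙ K).op.obj X) w) e3).trans (h2.trans ?_)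
    refine Eq.trans ?_ e4.symm
    exact congrArg (fun w => (convOver t.split (yonedaMap K (F.obj A)) (convOver t.split
      (yonedaMap K (F.obj B)) (yonedaMap K (F.obj L)))).app (F.op.obj X) w) h1
  map_left A := by
    refine psh_hom_ext fun X z => ?_
    have e := convOver_comp_apply s.split t.split (a := s.unit) (b := yonedaMap F A)
      (a' := t.unit) (b' := yonedaMap K _) (a'' := s.unit ≫ Functor.whiskerLeft F.op t.unit)
      (b'' := yonedaMap (F ⋙ K) A) (fun _ _ => rfl) (fun _ _ => rfl) X z
    have h1 := congrArg (fun k => k.app X z) (s.map_left A)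
    have h2 := congrArg (fun k => k.app (F.op.obj X) ((convOver s.split s.unit
      (yonedaMap F A)).app X z)) (t.map_left (F.obj A))
    refine (congrArg (fun w => (M''.leftUnitor (K.obj (F.obj A))).hom.app
      ((F ⋙ K).op.obj X) w) e).trans (h2.trans ?_)
    exact congrArg (fun w => (yonedaMap K (F.obj A)).app (F.op.obj X) w) h1
  map_right A := by
    refine psh_hom_ext fun X z => ?_
    have e := convOver_comp_apply s.split t.split (a := yonedaMap F A) (b := s.unit)
      (a' := yonedaMap K _) (b' := t.unit) (a'' := yonedaMap (F ⋙ K) A)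
      (b'' := s.unit ≫ Functor.whiskerLeft F.op t.unit) (fun _ _ => rfl) (fun _ _ => rfl) X z
    have h1 := congrArg (fun k => k.app X z) (s.map_right A)
    have h2 := congrArg (fun k => k.app (F.op.obj X) ((convOver s.split
      (yonedaMap F A) s.unit).app X z)) (t.map_right (F.obj A))
    refine (congrArg (fun w => (M''.rightUnitor (K.obj (F.obj A))).hom.app
      ((F ⋙ K).op.obj X) w) e).trans (h2.trans ?_)
    exact congrArg (fun w => (yonedaMap K (F.obj A)).app (F.op.obj X) w) h1

end Functors

section SymFunctors

variable {C D E : Type u} [SmallCategory C] [SmallCategory D] [SmallCategory E]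

/-- A symmetric produoidal functor: a functor with transformations `F_⊗`, `F_I`, `F_◁`, `F_N`
preserving associators, unitors, laxators and the symmetry. -/
@[ext] structure SymProduoidalFunctor (V : SymProduoidalCat C) (W : SymProduoidalCat D) where
  functor : C ⥤ D
  par : PromonoidalMap functor V.par W.par
  seq : PromonoidalMap functor V.seq W.seq
  map_psi2 : ∀ A B K L : C,
    convOver par.split (convOver seq.split (yonedaMap functor A) (yonedaMap functor B))
          (convOver seq.split (yonedaMap functor K) (yonedaMap functor L)) ≫
        Functor.whiskerLeft functor.op
          (W.psi2 (functor.obj A) (functor.obj B) (functor.obj K) (functor.obj L)) =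
      V.psi2 A B K L ≫
        convOver seq.split (convOver par.split (yonedaMap functor A) (yonedaMap functor K))
          (convOver par.split (yonedaMap functor B) (yonedaMap functor L))
  map_psi0 : par.unit ≫ Functor.whiskerLeft functor.op W.psi0 =
    V.psi0 ≫ convOver seq.split par.unit par.unit
  map_phi2 : convOver par.split seq.unit seq.unit ≫ Functor.whiskerLeft functor.op W.phi2 =
    V.phi2 ≫ seq.unit
  map_phi0 : par.unit ≫ Functor.whiskerLeft functor.op W.phi0 = V.phi0 ≫ seq.unit
  map_sym : ∀ A B : C,
    par.split.app A B ≫ Functor.whiskerLeft functor.op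
        (W.sym.app (functor.obj A) (functor.obj B)) =
      V.sym.app A B ≫ par.split.app B A

/-- The identity symmetric produoidal functor. -/
def SymProduoidalFunctor.id (V : SymProduoidalCat C) : SymProduoidalFunctor V V where
  functor := 𝟭 C
  par := PromonoidalMap.id V.par
  seq := PromonoidalMap.id V.seq
  map_psi2 A B K L := by
    refine psh_hom_ext fun X z => ?_
    have hp := fun A B => convOver_id_apply (P := V.par.tensor) (yonedaMap (𝟭 C) A)
      (yonedaMap (𝟭 C) B) (fun _ _ => rfl) (fun _ _ => rfl)
    have hs := fun A B => convOver_id_apply (P := V.seq.tensor) (yonedaMap (𝟭 C) A)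
      (yonedaMap (𝟭 C) B) (fun _ _ => rfl) (fun _ _ => rfl)
    have h1 := convOver_id_apply (P := V.par.tensor) _ _ (hs A B) (hs K L) X z
    have h2 := convOver_id_apply (P := V.seq.tensor) _ _ (hp A K) (hp B L) X
      ((V.psi2 A B K L).app X z)
    exact (congrArg (fun w => (V.psi2 A B K L).app X w) h1).trans h2.symm
  map_psi0 := by
    refine psh_hom_ext fun X z => ?_
    exact (convOver_id_apply (P := V.seq.tensor) (𝟙 V.par.unit) (𝟙 V.par.unit)
      (fun _ _ => rfl) (fun _ _ => rfl) X (V.psi0.app X z)).symm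
  map_phi2 := by
    refine psh_hom_ext fun X z => ?_
    exact congrArg (fun w => V.phi2.app X w) (convOver_id_apply (P := V.par.tensor)
      (𝟙 V.seq.unit) (𝟙 V.seq.unit) (fun _ _ => rfl) (fun _ _ => rfl) X z)
  map_phi0 := rfl
  map_sym _ _ := rfl

/-- Composition of symmetric produoidal functors. -/
def SymProduoidalFunctor.comp {U : SymProduoidalCat C} {V : SymProduoidalCat D}
    {W : SymProduoidalCat E} (s : SymProduoidalFunctor U V) (t : SymProduoidalFunctor V W) :
    SymProduoidalFunctor U W where
  functor := s.functor ⋙ t.functor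
  par := s.par.comp t.par
  seq := s.seq.comp t.seq
  map_psi2 A B K L := by
    refine psh_hom_ext fun X z => ?_
    have hp := fun A B => convOver_comp_apply s.par.split t.par.split
      (a := yonedaMap s.functor A) (b := yonedaMap s.functor B)
      (a' := yonedaMap t.functor _) (b' := yonedaMap t.functor _)
      (a'' := yonedaMap (s.functor ⋙ t.functor) A) (b'' := yonedaMap (s.functor ⋙ t.functor) B)
      (fun _ _ => rfl) (fun _ _ => rfl)
    have hs := fun A B => convOver_comp_apply s.seq.split t.seq.split
      (a := yonedaMap s.functor A) (b := yonedaMap s.functor B)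
      (a' := yonedaMap t.functor _) (b' := yonedaMap t.functor _)
      (a'' := yonedaMap (s.functor ⋙ t.functor) A) (b'' := yonedaMap (s.functor ⋙ t.functor) B)
      (fun _ _ => rfl) (fun _ _ => rfl)
    have h1 := convOver_comp_apply s.par.split t.par.split (hs A B) (hs K L) X z
    have h2 := convOver_comp_apply s.seq.split t.seq.split (hp A K) (hp B L) X
      ((U.psi2 A B K L).app X z)
    have e1 := congrArg (fun k => k.app X z) (s.map_psi2 A B K L)
    have e2 := congrArg (fun k => k.app (s.functor.op.obj X) ((convOver s.par.split
      (convOver s.seq.split (yonedaMap s.functor A) (yonedaMap s.functor B))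
      (convOver s.seq.split (yonedaMap s.functor K) (yonedaMap s.functor L))).app X z))
      (t.map_psi2 (s.functor.obj A) (s.functor.obj B) (s.functor.obj K) (s.functor.obj L))
    refine (congrArg (fun w => (W.psi2 _ _ _ _).app
      ((s.functor ⋙ t.functor).op.obj X) w) h1).trans (e2.trans ?_)
    refine Eq.trans ?_ h2.symm
    exact congrArg (fun w => (convOver t.seq.split
      (convOver t.par.split (yonedaMap t.functor (s.functor.obj A))
        (yonedaMap t.functor (s.functor.obj K)))
      (convOver t.par.split (yonedaMap t.functor (s.functor.obj B))
        (yonedaMap t.functor (s.functor.obj L)))).app (s.functor.op.obj X) w) e1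
  map_psi0 := by
    refine psh_hom_ext fun X z => ?_
    have h := convOver_comp_apply s.seq.split t.seq.split (a := s.par.unit) (b := s.par.unit)
      (a' := t.par.unit) (b' := t.par.unit) (a'' := (s.par.comp t.par).unit)
      (b'' := (s.par.comp t.par).unit) (fun _ _ => rfl) (fun _ _ => rfl) X (U.psi0.app X z)
    have e1 := congrArg (fun k => k.app X z) s.map_psi0
    have e2 := congrArg (fun k => k.app (s.functor.op.obj X) (s.par.unit.app X z)) t.map_psi0
    refine e2.trans (Eq.trans ?_ h.symm)
    exact congrArg (fun w => (convOver t.seq.split t.par.unit t.par.unit).app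
      (s.functor.op.obj X) w) e1
  map_phi2 := by
    refine psh_hom_ext fun X z => ?_
    have h := convOver_comp_apply s.par.split t.par.split (a := s.seq.unit) (b := s.seq.unit)
      (a' := t.seq.unit) (b' := t.seq.unit) (a'' := (s.seq.comp t.seq).unit)
      (b'' := (s.seq.comp t.seq).unit) (fun _ _ => rfl) (fun _ _ => rfl) X z
    have e1 := congrArg (fun k => k.app X z) s.map_phi2
    have e2 := congrArg (fun k => k.app (s.functor.op.obj X)
      ((convOver s.par.split s.seq.unit s.seq.unit).app X z)) t.map_phi2
    refine (congrArg (fun w => W.phi2.app ((s.functor ⋙ t.functor).op.obj X) w) h).trans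
      (e2.trans ?_)
    exact congrArg (fun w => t.seq.unit.app (s.functor.op.obj X) w) e1
  map_phi0 := by
    refine psh_hom_ext fun X z => ?_
    have e1 := congrArg (fun k => k.app X z) s.map_phi0
    have e2 := congrArg (fun k => k.app (s.functor.op.obj X) (s.par.unit.app X z)) t.map_phi0
    exact e2.trans (congrArg (fun w => t.seq.unit.app (s.functor.op.obj X) w) e1)
  map_sym A B := by
    refine psh_hom_ext fun X z => ?_
    have e1 := congrArg (fun k => k.app X z) (s.map_sym A B)
    have e2 := congrArg (fun k => k.app (s.functor.op.obj X) ((s.par.split.app A B).app X z))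
      (t.map_sym (s.functor.obj A) (s.functor.obj B))
    exact e2.trans (congrArg (fun w => (t.par.split.app (s.functor.obj B)
      (s.functor.obj A)).app (s.functor.op.obj X) w) e1)

end SymFunctors

/-- A small symmetric produoidal category. -/
structure SymProduo : Type (u + 1) where
  carrier : Type u
  [category : SmallCategory carrier]
  str : SymProduoidalCat carrier

attribute [instance] SymProduo.category

/-- The category of small symmetric produoidal categories and symmetric produoidal functors. -/
instance : Category SymProduo.{u} where
  Hom V W := SymProduoidalFunctor V.str W.str
  id V := SymProduoidalFunctor.id V.str
  comp F G := SymProduoidalFunctor.comp F G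
  id_comp _ := rfl
  comp_id _ := rfl
  assoc _ _ _ := rfl

/-- Normality: the laxator `φ₀ : V(•; I) ⟶ V(•; N)` is an isomorphism. -/
def isNormal : ObjectProperty SymProduo.{u} := fun V => IsIso V.str.phi0

/-- Normal symmetric produoidal categories, with symmetric produoidal functors. -/
abbrev NSymProduo : Type (u + 1) := (isNormal.{u}).FullSubcategory

/-- The inclusion of normal symmetric produoidal categories. -/
abbrev inclusion : NSymProduo.{u} ⥤ SymProduo.{u} := (isNormal.{u}).ι

section Normalization

variable {C : Type u} [SmallCategory C] (V : SymProduoidalCat C)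

/-- The presheaf `𝓝V(•; B) = V(•; N ⊗ B)`. -/
abbrev normHom (B : C) : Psh C := conv V.par.tensor V.seq.unit (yo B)

/-- The presheaf `𝓝V(•; A ⊗ B) = V(•; N ⊗ (A ⊗ B))`. -/
abbrev normPar (A B : C) : Psh C :=
  conv V.par.tensor V.seq.unit ((V.par.tensor.obj A).obj B)

/-- The presheaf `𝓝V(•; A ◁ B) = V(•; (N ⊗ A) ◁ (N ⊗ B))`. -/
abbrev normSeq (A B : C) : Psh C := conv V.seq.tensor (normHom V A) (normHom V B)

/-- The unit of the promonad `V(•; N ⊗ •)`: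
`V(•; B) ≅ V(•; I ⊗ B) ⟶ V(•; N ⊗ B)`. -/
def normId (B : C) : yo B ⟶ normHom V B :=
  (V.par.leftUnitor B).inv ≫ convMap V.par.tensor V.phi0 (𝟙 (yo B))

/-- The multiplication of the promonad `V(•; N ⊗ •)`:
`∫^B V(A; N ⊗ B) × V(B; N ⊗ D) ≅ V(A; N ⊗ (N ⊗ D)) ≅ V(A; (N ⊗ N) ⊗ D) ⟶ V(A; N ⊗ D)`. -/
def normComp {A B D : C} (x : (normHom V B).obj (op A)) (y : (normHom V D).obj (op B)) :
    (normHom V D).obj (op A) :=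
  (convMap V.par.tensor (𝟙 V.seq.unit) (elt y) ≫
    V.par.assocInvExt V.seq.unit V.seq.unit (yo D) ≫
      convMap V.par.tensor V.phi2 (𝟙 (yo D))).app (op A) x

end Normalization

section Comparison

variable {V W : SymProduo.{u}} (hW : isNormal W) (F : V ⟶ W)

/-- The map `V(•; N) ⟶ W(F •; N) ≅ W(F •; I)` for `W` normal. -/
noncomputable def cmpUnit : V.str.seq.unit ⟶ F.functor.op ⋙ W.str.par.unit :=
  haveI : IsIso W.str.phi0 := hW
  F.seq.unit ≫ Functor.whiskerLeft F.functor.op (inv W.str.phi0)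

/-- The map `V(•; N ⊗ G) ⟶ W(F •; I ⊗ G') ≅ G' (F •)` induced by `G ⟶ F.op ⋙ G'`. -/
noncomputable def cmp {G : Psh V.carrier} {G' : Psh W.carrier} (a : G ⟶ F.functor.op ⋙ G') :
    conv V.str.par.tensor V.str.seq.unit G ⟶ F.functor.op ⋙ G' :=
  convOver F.par.split (cmpUnit hW F) a ≫
    Functor.whiskerLeft F.functor.op (W.str.par.leftExt G')

/-- The map `V(•; N ⊗ B) ⟶ W(F •; F B)`. -/
noncomputable def cmpHom (B : V.carrier) :
    normHom V.str B ⟶ F.functor.op ⋙ yo (F.functor.obj B) :=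
  cmp hW F (yonedaMap F.functor B)

/-- The map `V(•; N ⊗ (A ⊗ B)) ⟶ W(F •; F A ⊗ F B)`. -/
noncomputable def cmpPar (A B : V.carrier) :
    normPar V.str A B ⟶
      F.functor.op ⋙ (W.str.par.tensor.obj (F.functor.obj A)).obj (F.functor.obj B) :=
  cmp hW F (F.par.split.app A B)

/-- The map `V(•; (N ⊗ A) ◁ (N ⊗ B)) ⟶ W(F •; F A ◁ F B)`. -/
noncomputable def cmpSeq (A B : V.carrier) :
    normSeq V.str A B ⟶
      F.functor.op ⋙ (W.str.seq.tensor.obj (F.functor.obj A)).obj (F.functor.obj B) :=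
  convOver F.seq.split (cmpHom hW F A) (cmpHom hW F B) ≫
    Functor.whiskerLeft F.functor.op
      (convYo W.str.seq.tensor (F.functor.obj A) (F.functor.obj B))

/-- `η : V ⟶ W` exhibits the normal symmetric produoidal category `W` as the symmetric
normalization `𝓝_σ V` of `V`: up to the canonical comparison maps, `W` has the objects of `V`, its
underlying category is the Kleisli category of the promonad `V(•; N ⊗ •)`, its parallel splits are
`V(•; N ⊗ (A ⊗ B))` with the symmetry coming from that of `V`, its sequential splits are
`V(•; (N ⊗ A) ◁ (N ⊗ B))`, and both of its units are `V(•; N)`. -/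
structure IsSymNormalization (η : V ⟶ W) : Prop where
  obj_bijective : Function.Bijective η.functor.obj
  isIso_hom : ∀ B : V.carrier, IsIso (cmpHom hW η B)
  hom_id : ∀ {A B : V.carrier} (f : A ⟶ B),
    (cmpHom hW η B).app (op A) ((normId V.str B).app (op A) f) = η.functor.map f
  hom_comp : ∀ {A B D : V.carrier} (x : (normHom V.str B).obj (op A))
    (y : (normHom V.str D).obj (op B)),
    (cmpHom hW η D).app (op A) (normComp V.str x y) =
      ((cmpHom hW η B).app (op A) x : η.functor.obj A ⟶ η.functor.obj B) ≫
        ((cmpHom hW η D).app (op B) y : η.functor.obj B ⟶ η.functor.obj D)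
  isIso_par : ∀ A B : V.carrier, IsIso (cmpPar hW η A B)
  par_sym : ∀ A B : V.carrier,
    cmpPar hW η A B ≫ Functor.whiskerLeft η.functor.op
        (W.str.sym.app (η.functor.obj A) (η.functor.obj B)) =
      convMap V.str.par.tensor (𝟙 V.str.seq.unit) (V.str.sym.app A B) ≫ cmpPar hW η B A
  isIso_seq : ∀ A B : V.carrier, IsIso (cmpSeq hW η A B)
  isIso_par_unit : IsIso (cmpUnit hW η)
  isIso_seq_unit : IsIso η.seq.unit

end Comparison

end Produoidal

set_option autoImplicit false
set_option linter.style.haveILetI false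

namespace Produoidal

/-! ### Extensionality for maps out of nested convolutions of presheaves. -/

section PresheafExt

variable {C : Type u} [SmallCategory C]

/-! Everything is moved to presheaves. Day convolution extends `⊗` and `◁` from representables to
all of `Psh V`, giving a symmetric monoidal structure, a second monoidal structure, and laxators
between them. In this setting `N`, with multiplication `φ₂` and unit `φ₀`, is a commutative monoid
for `⊗`; commutativity is the equation `φ₂ ∘ σ = φ₂`. The promonad `V(•; N ⊗ •)` is the free module
monad `N ⊗ -` restricted to representables, so its Kleisli category `Kl V` consists of the free
`N`-modules on representables, and presheaves on `Kl V` amount to `N`-modules in `Psh V`: a module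
is made into a presheaf by `NModule.toPsh`, and a presheaf on `Kl V` restricts to a module by
`resAct`.

The two structures on `Kl V` are then forced. The parallel one is the tensor product of modules over
`N`: `parQ` is the universal bilinear map (`nBilinear_parQ`, `parDesc`), and on free modules the
product of `N ⊗ G` and `N ⊗ H` is `N ⊗ (G ⊗ H)` (`freeConv`). The sequential one is the plain `◁` of
underlying presheaves, on which `N` acts through `N ≅ N ◁ N` and `ψ₂` (`seqAct`); no quotient is
needed, which is expressed by the invertibility of `seqQ`. Both units are `N`, and `φ₀` becomes the
identity. The laxator `ψ₂` descends because it is bilinear (`nBilinear_psi2`).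

Coherence on `Kl V` is never computed directly. Each structure map of `Kl V` fits in a commutative
square over the corresponding map of `V`, and a family of generators determines maps on `Kl V`.
Pasting squares over the axiom in `V` therefore yields the axiom in `Kl V` (`Generates.eq_of_sq`).

For the universal property, let `F : V ⟶ W` with `W` normal. The composite of `F_N` with the inverse
of `φ₀` is a monoid map from `N` to the restriction of `I`, so every presheaf on `W` restricts along
`F` to an `N`-module (`nAction_cmpAct`). With respect to these actions `F_⊗` is bilinear
(`nBilinear_cmpAct`) and `F_◁` is linear (`nLinear_cmpAct`), so all the data of `F` extend linearly
along `η`; this is `lift`. Uniqueness holds because the comparison maps attached to a composite `η ≫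
H` are the components of `H` itself, so `H` is recovered from `η ≫ H` (`lift_normEta`). The same
computation for `H = 𝟙` shows that the comparison maps of `η` are identities on elements, which
gives the explicit description of the normalization. -/

lemma elt_comp {F G : Psh C} {A : C} (x : F.obj (op A)) (t : F ⟶ G) :
    elt x ≫ t = elt (t.app (op A) x) := by
  ext B f
  exact NatTrans.naturality_apply t f.op x

lemma elt_injective {F : Psh C} {A : C} {x y : F.obj (op A)} (h : elt x = elt y) : x = y := by
  rw [← elt_app_id x, h, elt_app_id]

lemma elt_app_one {F : Psh C} {A : C} (t : yo A ⟶ F) : elt (t.app (op A) (𝟙 A)) = t := by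
  rw [← elt_comp, elt_id, CategoryTheory.Functor.map_id, Category.id_comp]

@[simp] lemma convMap_id (P : Split C) (F G : Psh C) : convMap P (𝟙 F) (𝟙 G) = 𝟙 (conv P F G) := by
  ext X Y x y : 1
  rfl

lemma psh_elt_ext {F Z : Psh C} {t t' : F ⟶ Z}
    (h : ∀ (A : C) (x : F.obj (op A)), elt x ≫ t = elt x ≫ t') : t = t' := by
  refine psh_hom_ext fun A x => ?_
  have := h A.unop x
  rw [elt_comp, elt_comp] at this
  exact elt_injective this

lemma convMap_elt_cmk (P : Split C) {F G : Psh C} {X Y : C} {A : Cᵒᵖ} (s : ((P.obj X).obj Y).obj A)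
    (x : F.obj (op X)) (y : G.obj (op Y)) :
    (convMap P (elt x) (elt y)).app A (cmk s (𝟙 X) (𝟙 Y)) = cmk s x y := by
  rw [convMap_cmk, elt_app_id, elt_app_id]

lemma conv_elt_ext {P : Split C} {F G Z : Psh C} {t t' : conv P F G ⟶ Z}
    (h : ∀ (A B : C) (x : F.obj (op A)) (y : G.obj (op B)),
      convMap P (elt x) (elt y) ≫ t = convMap P (elt x) (elt y) ≫ t') : t = t' := by
  refine psh_hom_ext fun A e => ?_
  induction e using conv_ind with | h X Y s x y =>
  have := congrArg (fun k => k.app A (cmk s (𝟙 X) (𝟙 Y))) (h X Y x y)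
  rw [← convMap_elt_cmk]
  exact this

/-- Presheaf morphisms `T ⟶ Z` agree once they agree on a jointly surjective family of morphisms
`S ⟶ T`. -/
def JointlySurjective {T : Psh C} (p : ∀ S : Psh C, (S ⟶ T) → Prop) : Prop :=
  ∀ (A : Cᵒᵖ) (x : T.obj A), ∃ (S : Psh C) (f : S ⟶ T) (y : S.obj A), p S f ∧ f.app A y = x

/-- The family of all morphisms out of representables. -/
inductive IsElt (F : Psh C) : ∀ S : Psh C, (S ⟶ F) → Prop
  | mk {A : C} (x : F.obj (op A)) : IsElt F (yo A) (elt x)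

/-- The family of convolutions of two families. -/
inductive ConvFam (P : Split C) {F G : Psh C} (p : ∀ S : Psh C, (S ⟶ F) → Prop)
    (q : ∀ S : Psh C, (S ⟶ G) → Prop) : ∀ S : Psh C, (S ⟶ conv P F G) → Prop
  | mk {S T : Psh C} (f : S ⟶ F) (g : T ⟶ G) (hf : p S f) (hg : q T g) :
      ConvFam P p q (conv P S T) (convMap P f g)

lemma jointlySurjective_isElt (F : Psh C) : JointlySurjective (IsElt F) :=
  fun A x => ⟨yo A.unop, elt (A := A.unop) x, 𝟙 _, .mk _, elt_app_id (A := A.unop) x⟩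

/-- An element of the coend is a class `[s; x, y]`, and `x` and `y` can be lifted separately. This
makes one extensionality principle serve every bracketing of a nested convolution. -/
lemma JointlySurjective.conv {P : Split C} {F G : Psh C} {p : ∀ S : Psh C, (S ⟶ F) → Prop}
    {q : ∀ S : Psh C, (S ⟶ G) → Prop} (hp : JointlySurjective p) (hq : JointlySurjective q) :
    JointlySurjective (ConvFam P p q) := by
  intro A e
  induction e using conv_ind with | h X Y s x y =>
  obtain ⟨S, f, x', hf, rfl⟩ := hp _ x
  obtain ⟨T, g, y', hg, rfl⟩ := hq _ y
  exact ⟨_, _, cmk s x' y', .mk f g hf hg, rfl⟩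

lemma JointlySurjective.hom_ext {T : Psh C} {p : ∀ S : Psh C, (S ⟶ T) → Prop}
    (hp : JointlySurjective p) {Z : Psh C} {t t' : T ⟶ Z}
    (h : ∀ S (f : S ⟶ T), p S f → f ≫ t = f ≫ t') : t = t' := by
  refine psh_hom_ext fun A x => ?_
  obtain ⟨S, f, y, hf, rfl⟩ := hp A x
  exact congrArg (fun k => k.app A y) (h S f hf)

lemma convL_elt_ext {P Q : Split C} {F G H Z : Psh C} {t t' : conv P (conv Q F G) H ⟶ Z}
    (h : ∀ (A B D : C) (x : F.obj (op A)) (y : G.obj (op B)) (z : H.obj (op D)),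
      convMap P (convMap Q (elt x) (elt y)) (elt z) ≫ t =
        convMap P (convMap Q (elt x) (elt y)) (elt z) ≫ t') : t = t' := by
  refine (((jointlySurjective_isElt F).conv (jointlySurjective_isElt G)).conv
    (jointlySurjective_isElt H)).hom_ext ?_
  rintro _ _ ⟨_, _, ⟨_, _, ⟨x⟩, ⟨y⟩⟩, ⟨z⟩⟩
  exact h _ _ _ x y z

lemma convR_elt_ext {P Q : Split C} {F G H Z : Psh C} {t t' : conv P F (conv Q G H) ⟶ Z}
    (h : ∀ (A B D : C) (x : F.obj (op A)) (y : G.obj (op B)) (z : H.obj (op D)),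
      convMap P (elt x) (convMap Q (elt y) (elt z)) ≫ t =
        convMap P (elt x) (convMap Q (elt y) (elt z)) ≫ t') : t = t' := by
  refine ((jointlySurjective_isElt F).conv ((jointlySurjective_isElt G).conv
    (jointlySurjective_isElt H))).hom_ext ?_
  rintro _ _ ⟨_, _, ⟨x⟩, ⟨_, _, ⟨y⟩, ⟨z⟩⟩⟩
  exact h _ _ _ x y z

lemma convLR_elt_ext {P Q : Split C} {F G H K Z : Psh C}
    {t t' : conv P (conv Q F G) (conv Q H K) ⟶ Z}
    (h : ∀ (A B D E : C) (x : F.obj (op A)) (y : G.obj (op B)) (z : H.obj (op D))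
      (w : K.obj (op E)),
      convMap P (convMap Q (elt x) (elt y)) (convMap Q (elt z) (elt w)) ≫ t =
        convMap P (convMap Q (elt x) (elt y)) (convMap Q (elt z) (elt w)) ≫ t') : t = t' := by
  refine (((jointlySurjective_isElt F).conv (jointlySurjective_isElt G)).conv
    ((jointlySurjective_isElt H).conv (jointlySurjective_isElt K))).hom_ext ?_
  rintro _ _ ⟨_, _, ⟨_, _, ⟨x⟩, ⟨y⟩⟩, ⟨_, _, ⟨z⟩, ⟨w⟩⟩⟩
  exact h _ _ _ _ x y z w

/-- The naturality hypothesis for `f`, `g`, `h`, evaluated at the class built from identities, is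
exactly the required equation. From here on `extL` is used only through this rule, without unfolding
its quotient lifts; likewise `extR` and `extLR`. -/
lemma extL_elt {P Q : Split C} {F G H Z : Psh C}
    (t : ∀ A B D : C, F.obj (op A) → G.obj (op B) → H.obj (op D) →
      (conv P (conv Q (yo A) (yo B)) (yo D) ⟶ Z))
    (ht : ∀ {A A' B B' D D' : C} (f : A ⟶ A') (g : B ⟶ B') (h : D ⟶ D')
      (x : F.obj (op A')) (y : G.obj (op B')) (z : H.obj (op D')),
      convMap P (convMap Q (yoneda.map f) (yoneda.map g)) (yoneda.map h) ≫ t A' B' D' x y z =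
        t A B D (F.map f.op x) (G.map g.op y) (H.map h.op z))
    {A B D : C} (x : F.obj (op A)) (y : G.obj (op B)) (z : H.obj (op D)) :
    convMap P (convMap Q (elt x) (elt y)) (elt z) ≫ extL t ht = t A B D x y z := by
  refine psh_hom_ext fun L e => ?_
  induction e using conv_ind with | h X Y s u h =>
  induction u using conv_ind with | h X' Y' s' f g =>
  have := congrArg (fun k => k.app L (cmk s (cmk s' (𝟙 X') (𝟙 Y') :
    (conv Q (yo X') (yo Y')).obj (op X)) (𝟙 Y))) (ht f g h x y z)
  simp at this
  exact this.symm

lemma extR_elt {P Q : Split C} {F G H Z : Psh C}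
    (t : ∀ A B D : C, F.obj (op A) → G.obj (op B) → H.obj (op D) →
      (conv P (yo A) (conv Q (yo B) (yo D)) ⟶ Z))
    (ht : ∀ {A A' B B' D D' : C} (f : A ⟶ A') (g : B ⟶ B') (h : D ⟶ D')
      (x : F.obj (op A')) (y : G.obj (op B')) (z : H.obj (op D')),
      convMap P (yoneda.map f) (convMap Q (yoneda.map g) (yoneda.map h)) ≫ t A' B' D' x y z =
        t A B D (F.map f.op x) (G.map g.op y) (H.map h.op z))
    {A B D : C} (x : F.obj (op A)) (y : G.obj (op B)) (z : H.obj (op D)) :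
    convMap P (elt x) (convMap Q (elt y) (elt z)) ≫ extR t ht = t A B D x y z := by
  refine psh_hom_ext fun L e => ?_
  induction e using conv_ind with | h X Y s f u =>
  induction u using conv_ind with | h X' Y' s' g h =>
  have := congrArg (fun k => k.app L (cmk s (𝟙 X) (cmk s' (𝟙 X') (𝟙 Y') :
    (conv Q (yo X') (yo Y')).obj (op Y)))) (ht f g h x y z)
  simp at this
  exact this.symm

lemma extLR_elt {P Q : Split C} {F G H K Z : Psh C}
    (t : ∀ A B D E : C, F.obj (op A) → G.obj (op B) → H.obj (op D) → K.obj (op E) →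
      (conv P (conv Q (yo A) (yo B)) (conv Q (yo D) (yo E)) ⟶ Z))
    (ht : ∀ {A A' B B' D D' E E' : C} (f : A ⟶ A') (g : B ⟶ B') (h : D ⟶ D') (k : E ⟶ E')
      (x : F.obj (op A')) (y : G.obj (op B')) (z : H.obj (op D')) (w : K.obj (op E')),
      convMap P (convMap Q (yoneda.map f) (yoneda.map g))
          (convMap Q (yoneda.map h) (yoneda.map k)) ≫ t A' B' D' E' x y z w =
        t A B D E (F.map f.op x) (G.map g.op y) (H.map h.op z) (K.map k.op w))
    {A B D E : C} (x : F.obj (op A)) (y : G.obj (op B)) (z : H.obj (op D)) (w : K.obj (op E)) :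
    convMap P (convMap Q (elt x) (elt y)) (convMap Q (elt z) (elt w)) ≫ extLR t ht =
      t A B D E x y z w := by
  refine psh_hom_ext fun L e => ?_
  induction e using conv_ind with | h X Y s u v =>
  induction u using conv_ind with | h X' Y' s' f g =>
  induction v using conv_ind with | h X'' Y'' s'' h k =>
  have := congrArg (fun k => k.app L (cmk s (cmk s' (𝟙 X') (𝟙 Y') :
    (conv Q (yo X') (yo Y')).obj (op X)) (cmk s'' (𝟙 X'') (𝟙 Y'') :
    (conv Q (yo X'') (yo Y'')).obj (op Y)))) (ht f g h k x y z w)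
  simp at this
  exact this.symm

end PresheafExt

/-! ### Day convolution makes presheaves on a promonoidal category a monoidal category. -/

section PromonoidalExt

variable {C : Type u} [SmallCategory C]

namespace PromonoidalData

variable (M : PromonoidalData C)

lemma assocExt_elt {F G H : Psh C} {A B D : C} (x : F.obj (op A)) (y : G.obj (op B))
    (z : H.obj (op D)) :
    convMap M.tensor (convMap M.tensor (elt x) (elt y)) (elt z) ≫ M.assocExt F G H =
      (M.assoc A B D).hom ≫ convMap M.tensor (elt x) (convMap M.tensor (elt y) (elt z)) := by
  unfold assocExt; generalize_proofs ht; exact extL_elt _ ht x y z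

lemma assocInvExt_elt {F G H : Psh C} {A B D : C} (x : F.obj (op A)) (y : G.obj (op B))
    (z : H.obj (op D)) :
    convMap M.tensor (elt x) (convMap M.tensor (elt y) (elt z)) ≫ M.assocInvExt F G H =
      (M.assoc A B D).inv ≫ convMap M.tensor (convMap M.tensor (elt x) (elt y)) (elt z) := by
  unfold assocInvExt; generalize_proofs ht; exact extR_elt _ ht x y z

lemma leftExt_elt {F : Psh C} {A : C} (x : F.obj (op A)) :
    convMap M.tensor (𝟙 M.unit) (elt x) ≫ M.leftExt F = (M.leftUnitor A).hom ≫ elt x := by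
  refine psh_hom_ext fun L e => ?_
  induction e using conv_ind with | h X Y s i f =>
  have := congrArg (fun k => (k ≫ elt x).app L (cmk s i (𝟙 Y))) (M.leftUnitor_natural f)
  simp only [Category.assoc, yo_map_elt] at this
  simp at this
  exact this.symm

lemma rightExt_elt {F : Psh C} {A : C} (x : F.obj (op A)) :
    convMap M.tensor (elt x) (𝟙 M.unit) ≫ M.rightExt F = (M.rightUnitor A).hom ≫ elt x := by
  refine psh_hom_ext fun L e => ?_
  induction e using conv_ind with | h X Y s f i =>
  have := congrArg (fun k => (k ≫ elt x).app L (cmk s (𝟙 X) i)) (M.rightUnitor_natural f)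
  simp only [Category.assoc, yo_map_elt] at this
  simp at this
  exact this.symm

/-- Passage between the axioms, which concern the associators at representables, and the
presheaf-level statements, which concern their extensions. -/
lemma assocExt_yo (A B D : C) : M.assocExt (yo A) (yo B) (yo D) = (M.assoc A B D).hom := by
  have := M.assocExt_elt (F := yo A) (G := yo B) (H := yo D) (𝟙 A) (𝟙 B) (𝟙 D)
  simpa using this

lemma leftExt_yo (A : C) : M.leftExt (yo A) = (M.leftUnitor A).hom := by
  have := M.leftExt_elt (F := yo A) (𝟙 A)
  simpa using this

lemma rightExt_yo (A : C) : M.rightExt (yo A) = (M.rightUnitor A).hom := by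
  have := M.rightExt_elt (F := yo A) (𝟙 A)
  simpa using this

lemma assocExt_natural {F F' G G' H H' : Psh C} (f : F ⟶ F') (g : G ⟶ G') (h : H ⟶ H') :
    convMap M.tensor (convMap M.tensor f g) h ≫ M.assocExt F' G' H' =
      M.assocExt F G H ≫ convMap M.tensor f (convMap M.tensor g h) := by
  refine convL_elt_ext fun A B D x y z => ?_
  rw [← Category.assoc, ← convMap_comp, ← convMap_comp, elt_comp, elt_comp, elt_comp,
    assocExt_elt, ← Category.assoc, assocExt_elt, Category.assoc, ← convMap_comp, ← convMap_comp,
    elt_comp, elt_comp, elt_comp]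

lemma assocExt_assocInvExt (F G H : Psh C) : M.assocExt F G H ≫ M.assocInvExt F G H = 𝟙 _ := by
  refine convL_elt_ext fun A B D x y z => ?_
  rw [← Category.assoc, assocExt_elt, Category.assoc, assocInvExt_elt, Iso.hom_inv_id_assoc,
    Category.comp_id]

lemma assocInvExt_assocExt (F G H : Psh C) : M.assocInvExt F G H ≫ M.assocExt F G H = 𝟙 _ := by
  refine convR_elt_ext fun A B D x y z => ?_
  rw [← Category.assoc, assocInvExt_elt, Category.assoc, assocExt_elt, Iso.inv_hom_id_assoc,
    Category.comp_id]

/-- The associator at virtual objects. -/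
@[simps] def assocIso (F G H : Psh C) :
    conv M.tensor (conv M.tensor F G) H ≅ conv M.tensor F (conv M.tensor G H) where
  hom := M.assocExt F G H
  inv := M.assocInvExt F G H
  hom_inv_id := M.assocExt_assocInvExt F G H
  inv_hom_id := M.assocInvExt_assocExt F G H

/-- The unitors are natural only in the other variable, so the slot of the unit must be kept whole
instead of being resolved into elements. -/
lemma conv_unit_left_ext {F Z : Psh C} {t t' : conv M.tensor M.unit F ⟶ Z}
    (h : ∀ (A : C) (x : F.obj (op A)), convMap M.tensor (𝟙 M.unit) (elt x) ≫ t =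
      convMap M.tensor (𝟙 M.unit) (elt x) ≫ t') : t = t' := by
  refine conv_elt_ext fun A B i x => ?_
  have : convMap M.tensor (elt i) (elt x) =
      convMap M.tensor (elt i) (𝟙 _) ≫ convMap M.tensor (𝟙 _) (elt x) := by
    rw [← convMap_comp, Category.id_comp, Category.comp_id]
  rw [this, Category.assoc, h, Category.assoc]

lemma conv_unit_right_ext {F Z : Psh C} {t t' : conv M.tensor F M.unit ⟶ Z}
    (h : ∀ (A : C) (x : F.obj (op A)), convMap M.tensor (elt x) (𝟙 M.unit) ≫ t =
      convMap M.tensor (elt x) (𝟙 M.unit) ≫ t') : t = t' := by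
  refine conv_elt_ext fun A B x i => ?_
  have : convMap M.tensor (elt x) (elt i) =
      convMap M.tensor (𝟙 _) (elt i) ≫ convMap M.tensor (elt x) (𝟙 _) := by
    rw [← convMap_comp, Category.id_comp, Category.comp_id]
  rw [this, Category.assoc, h, Category.assoc]

lemma leftExt_natural {F F' : Psh C} (f : F ⟶ F') :
    convMap M.tensor (𝟙 M.unit) f ≫ M.leftExt F' = M.leftExt F ≫ f := by
  refine M.conv_unit_left_ext fun A x => ?_
  rw [← Category.assoc, ← convMap_comp, Category.id_comp, elt_comp, leftExt_elt, ← Category.assoc,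
    leftExt_elt, Category.assoc, elt_comp]

lemma rightExt_natural {F F' : Psh C} (f : F ⟶ F') :
    convMap M.tensor f (𝟙 M.unit) ≫ M.rightExt F' = M.rightExt F ≫ f := by
  refine M.conv_unit_right_ext fun A x => ?_
  rw [← Category.assoc, ← convMap_comp, Category.id_comp, elt_comp, rightExt_elt, ← Category.assoc,
    rightExt_elt, Category.assoc, elt_comp]

/-- The inverse left unitor at a virtual object. -/
def leftInvExt (F : Psh C) : F ⟶ conv M.tensor M.unit F where
  app A := ↾fun x => (convMap M.tensor (𝟙 M.unit) (elt (A := A.unop) x)).app A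
    ((M.leftUnitor A.unop).inv.app A (𝟙 A.unop))
  naturality A B f := by
    ext x
    have h1 : (M.leftUnitor B.unop).inv ≫ convMap M.tensor (𝟙 M.unit) (yoneda.map f.unop) =
        yoneda.map f.unop ≫ (M.leftUnitor A.unop).inv := by
      rw [Iso.inv_comp_eq, ← Category.assoc, Iso.eq_comp_inv, M.leftUnitor_natural]
    have h := congrArg (fun k => (k ≫ convMap M.tensor (𝟙 M.unit) (elt (A := A.unop) x)).app B
      (𝟙 B.unop)) h1
    simp only [Category.assoc, ← convMap_comp, yo_map_elt, Category.id_comp] at h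
    simp at h
    dsimp
    refine h.trans ?_
    -- Writing `f` as a restriction of the identity makes the two remaining factors movable by
    -- naturality.
    have e : f.unop = (yo A.unop).map f (𝟙 A.unop) := by simp
    conv_lhs => rw [e]
    rw [NatTrans.naturality_apply, NatTrans.naturality_apply]

/-- The inverse right unitor at a virtual object. -/
def rightInvExt (F : Psh C) : F ⟶ conv M.tensor F M.unit where
  app A := ↾fun x => (convMap M.tensor (elt (A := A.unop) x) (𝟙 M.unit)).app A
    ((M.rightUnitor A.unop).inv.app A (𝟙 A.unop))
  naturality A B f := by
    ext x
    have h1 : (M.rightUnitor B.unop).inv ≫ convMap M.tensor (yoneda.map f.unop) (𝟙 M.unit) =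
        yoneda.map f.unop ≫ (M.rightUnitor A.unop).inv := by
      rw [Iso.inv_comp_eq, ← Category.assoc, Iso.eq_comp_inv, M.rightUnitor_natural]
    have h := congrArg (fun k => (k ≫ convMap M.tensor (elt (A := A.unop) x) (𝟙 M.unit)).app B
      (𝟙 B.unop)) h1
    simp only [Category.assoc, ← convMap_comp, yo_map_elt, Category.id_comp] at h
    simp at h
    dsimp
    refine h.trans ?_
    have e : f.unop = (yo A.unop).map f (𝟙 A.unop) := by simp
    conv_lhs => rw [e]
    rw [NatTrans.naturality_apply, NatTrans.naturality_apply]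

lemma elt_leftInvExt {F : Psh C} {A : C} (x : F.obj (op A)) :
    elt x ≫ M.leftInvExt F = (M.leftUnitor A).inv ≫ convMap M.tensor (𝟙 M.unit) (elt x) := by
  rw [elt_comp, ← elt_app_one ((M.leftUnitor A).inv ≫ convMap M.tensor (𝟙 M.unit) (elt x))]
  rfl

lemma elt_rightInvExt {F : Psh C} {A : C} (x : F.obj (op A)) :
    elt x ≫ M.rightInvExt F = (M.rightUnitor A).inv ≫ convMap M.tensor (elt x) (𝟙 M.unit) := by
  rw [elt_comp, ← elt_app_one ((M.rightUnitor A).inv ≫ convMap M.tensor (elt x) (𝟙 M.unit))]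
  rfl

/-- The left unitor at a virtual object. -/
@[simps] def leftIso (F : Psh C) : conv M.tensor M.unit F ≅ F where
  hom := M.leftExt F
  inv := M.leftInvExt F
  hom_inv_id := M.conv_unit_left_ext fun A x => by
    rw [← Category.assoc, leftExt_elt, Category.assoc, elt_leftInvExt, Iso.hom_inv_id_assoc,
      Category.comp_id]
  inv_hom_id := psh_elt_ext fun A x => by
    rw [← Category.assoc, elt_leftInvExt, Category.assoc, leftExt_elt, Iso.inv_hom_id_assoc,
      Category.comp_id]

/-- The right unitor at a virtual object. -/
@[simps] def rightIso (F : Psh C) : conv M.tensor F M.unit ≅ F where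
  hom := M.rightExt F
  inv := M.rightInvExt F
  hom_inv_id := M.conv_unit_right_ext fun A x => by
    rw [← Category.assoc, rightExt_elt, Category.assoc, elt_rightInvExt, Iso.hom_inv_id_assoc,
      Category.comp_id]
  inv_hom_id := psh_elt_ext fun A x => by
    rw [← Category.assoc, elt_rightInvExt, Category.assoc, rightExt_elt, Iso.inv_hom_id_assoc,
      Category.comp_id]

lemma leftInvExt_yo (A : C) : M.leftInvExt (yo A) = (M.leftUnitor A).inv := by
  have := M.elt_leftInvExt (F := yo A) (𝟙 A)
  simpa using this

end PromonoidalData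

/-- The transport device for coherence: an equation on top of two pasted rectangles with the same
vertical sides gives the equation at the bottom, up to precomposition with the left side. With
jointly surjective left sides the bottom equation follows. -/
lemma eq_of_sq {𝒞 : Type*} [Category 𝒞] {S S' T T' : 𝒞} {t u : S ⟶ T} {t' u' : S' ⟶ T'} {a : S ⟶ S'}
    {b : T ⟶ T'} (h : t = u) (ht : CommSq t a b t') (hu : CommSq u a b u') : a ≫ t' = a ≫ u' := by
  rw [← ht.w, ← hu.w, h]

lemma sqId {𝒞 : Type*} [Category 𝒞] {S T : 𝒞} (f : S ⟶ T) : CommSq (𝟙 S) f f (𝟙 T) := ⟨by simp⟩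

lemma sqMap (P : Split C) {F F' G G' H H' K K' : Psh C} {t : F ⟶ G} {a : F ⟶ F'} {b : G ⟶ G'}
    {t' : F' ⟶ G'} {u : H ⟶ K} {c : H ⟶ H'} {d : K ⟶ K'} {u' : H' ⟶ K'}
    (h : CommSq t a b t') (k : CommSq u c d u') :
    CommSq (convMap P t u) (convMap P a c) (convMap P b d) (convMap P t' u') :=
  ⟨by rw [← convMap_comp, ← convMap_comp, h.w, k.w]⟩

namespace PromonoidalData

variable (M : PromonoidalData C)

lemma assocSq {F F' G G' H H' : Psh C} (f : F ⟶ F') (g : G ⟶ G') (h : H ⟶ H') :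
    CommSq (M.assocExt F G H) (convMap M.tensor (convMap M.tensor f g) h)
      (convMap M.tensor f (convMap M.tensor g h)) (M.assocExt F' G' H') :=
  ⟨(M.assocExt_natural f g h).symm⟩

lemma leftSq {F F' : Psh C} (f : F ⟶ F') :
    CommSq (M.leftExt F) (convMap M.tensor (𝟙 M.unit) f) f (M.leftExt F') :=
  ⟨(M.leftExt_natural f).symm⟩

lemma rightSq {F F' : Psh C} (f : F ⟶ F') :
    CommSq (M.rightExt F) (convMap M.tensor f (𝟙 M.unit)) f (M.rightExt F') :=
  ⟨(M.rightExt_natural f).symm⟩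

end PromonoidalData

/-- The family consisting of the identity. -/
inductive IsIdentity (F : Psh C) : ∀ S : Psh C, (S ⟶ F) → Prop
  | mk : IsIdentity F F (𝟙 F)

/-- Used for slots occupied by a unit presheaf: there the axioms already mention the presheaf
itself, so nothing has to be resolved into representables. -/
lemma jointlySurjective_id (F : Psh C) : JointlySurjective (IsIdentity F) :=
  fun _ x => ⟨F, 𝟙 F, x, .mk, rfl⟩

namespace Promonoidal

variable (M : Promonoidal C)

/-- Elements of the four presheaves give maps out of representables, along which the naturality
squares of the associator are pasted over the pentagon of `M`. -/
lemma pentagonExt (F G H K : Psh C) :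
    M.assocExt (conv M.tensor F G) H K ≫ M.assocExt F G (conv M.tensor H K) =
      convMap M.tensor (M.assocExt F G H) (𝟙 K) ≫ M.assocExt F (conv M.tensor G H) K ≫
        convMap M.tensor (𝟙 F) (M.assocExt G H K) := by
  refine ((((jointlySurjective_isElt F).conv (jointlySurjective_isElt G)).conv
    (jointlySurjective_isElt H)).conv (jointlySurjective_isElt K)).hom_ext ?_
  rintro _ _ ⟨_, _, ⟨_, _, ⟨_, _, @⟨A, x⟩, @⟨B, y⟩⟩, @⟨D, z⟩⟩, @⟨E, w⟩⟩
  have h := M.pentagon A B D E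
  rw [← PromonoidalData.assocExt_yo, ← PromonoidalData.assocExt_yo] at h
  refine eq_of_sq h
    ((M.assocSq _ (elt z) (elt w)).horiz_comp (M.assocSq (elt x) (elt y) _))
    ((sqMap _ (M.assocSq _ _ _) (sqId (elt w))).horiz_comp ((M.assocSq (elt x) _ (elt w)).horiz_comp
      (sqMap _ (sqId (elt x)) (M.assocSq _ _ _))))

lemma triangleExt (F G : Psh C) :
    M.assocExt F M.unit G ≫ convMap M.tensor (𝟙 F) (M.leftExt G) =
      convMap M.tensor (M.rightExt F) (𝟙 G) := by
  refine (((jointlySurjective_isElt F).conv (jointlySurjective_id M.unit)).conv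
    (jointlySurjective_isElt G)).hom_ext ?_
  rintro _ _ ⟨_, _, ⟨_, _, @⟨A, x⟩, ⟨⟩⟩, @⟨B, y⟩⟩
  have h := M.triangle A B
  rw [← PromonoidalData.leftExt_yo, ← PromonoidalData.rightExt_yo] at h
  exact eq_of_sq h ((M.assocSq (elt x) (𝟙 _) (elt y)).horiz_comp
      (sqMap _ (sqId (elt x)) (M.leftSq (elt y))))
    (sqMap _ (M.rightSq (elt x)) (sqId (elt y)))

/-- Convolution is a monoidal structure on presheaves. -/
@[reducible] def monoidalCategory : MonoidalCategory (Psh C) where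
  tensorObj := conv M.tensor
  whiskerLeft F _ _ g := convMap M.tensor (𝟙 F) g
  whiskerRight f G := convMap M.tensor f (𝟙 G)
  tensorHom := convMap M.tensor
  tensorUnit := M.unit
  associator := M.assocIso
  leftUnitor := M.leftIso
  rightUnitor := M.rightIso
  tensorHom_def f g := by rw [← convMap_comp, Category.id_comp, Category.comp_id]
  id_tensorHom_id F G := convMap_id _ F G
  tensorHom_comp_tensorHom f g f' g' := (convMap_comp M.tensor f f' g g').symm
  whiskerLeft_id F G := convMap_id _ F G
  id_whiskerRight F G := convMap_id _ F G
  associator_naturality f g h := M.assocExt_natural f g h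
  leftUnitor_naturality f := M.leftExt_natural f
  rightUnitor_naturality f := M.rightExt_natural f
  pentagon F G H K := (M.pentagonExt F G H K).symm
  triangle F G := M.triangleExt F G

end Promonoidal
end PromonoidalExt

/-! ### Laxators and symmetry on presheaves. -/

section DuoidalExt

variable {C : Type u} [SmallCategory C]

namespace DuoData

variable (V : DuoData C)

lemma psi2Ext_elt {F G H K : Psh C} {A B D E : C} (x : F.obj (op A)) (y : G.obj (op B))
    (z : H.obj (op D)) (w : K.obj (op E)) :
    convMap V.par.tensor (convMap V.seq.tensor (elt x) (elt y))
        (convMap V.seq.tensor (elt z) (elt w)) ≫ V.psi2Ext F G H K =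
      V.psi2 A B D E ≫ convMap V.seq.tensor (convMap V.par.tensor (elt x) (elt z))
        (convMap V.par.tensor (elt y) (elt w)) := by
  unfold psi2Ext; generalize_proofs ht; exact extLR_elt _ ht x y z w

lemma psi2Ext_yo (A B D E : C) : V.psi2Ext (yo A) (yo B) (yo D) (yo E) = V.psi2 A B D E := by
  have := V.psi2Ext_elt (F := yo A) (G := yo B) (H := yo D) (K := yo E) (𝟙 A) (𝟙 B) (𝟙 D) (𝟙 E)
  simpa using this

lemma psi2Sq {F F' G G' H H' K K' : Psh C} (f : F ⟶ F') (g : G ⟶ G') (h : H ⟶ H') (k : K ⟶ K') :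
    CommSq (V.psi2Ext F G H K)
      (convMap V.par.tensor (convMap V.seq.tensor f g) (convMap V.seq.tensor h k))
      (convMap V.seq.tensor (convMap V.par.tensor f h) (convMap V.par.tensor g k))
      (V.psi2Ext F' G' H' K') := by
  refine ⟨convLR_elt_ext fun A B D E x y z w => ?_⟩
  rw [← Category.assoc, psi2Ext_elt, Category.assoc]
  simp only [← convMap_comp, elt_comp, ← Category.assoc]
  rw [psi2Ext_elt]

end DuoData

namespace Symmetry

variable {P : Split C} (S : Symmetry P)

lemma extSq {F F' G G' : Psh C} (f : F ⟶ F') (g : G ⟶ G') :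
    CommSq (S.ext F G) (convMap P f g) (convMap P g f) (S.ext F' G') := by
  refine ⟨?_⟩
  ext X Y x y : 1
  rfl

lemma ext_ext (F G : Psh C) : S.ext F G ≫ S.ext G F = 𝟙 _ := by
  ext X Y x y : 1
  have h := S.symmetry X Y =≫ ins P x y
  rw [Category.assoc, Category.id_comp] at h
  exact h

/-- The symmetry at virtual objects, as an isomorphism. -/
@[simps] def iso (F G : Psh C) : conv P F G ≅ conv P G F where
  hom := S.ext F G
  inv := S.ext G F
  hom_inv_id := S.ext_ext F G
  inv_hom_id := S.ext_ext G F

end Symmetry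

namespace ProduoidalCat

variable (V : ProduoidalCat C)

/-- Pasting of naturality squares of the associator and of `ψ₂` over the axiom at representables;
the remaining duoidal axioms are extended in the same way. -/
lemma psi2_par_assocExt (F G H K L N : Psh C) :
    V.par.assocExt (conv V.seq.tensor F G) (conv V.seq.tensor H K) (conv V.seq.tensor L N) ≫
      convMap V.par.tensor (𝟙 _) (V.psi2Ext H K L N) ≫
        V.psi2Ext F G (conv V.par.tensor H L) (conv V.par.tensor K N) =
    convMap V.par.tensor (V.psi2Ext F G H K) (𝟙 _) ≫
      V.psi2Ext (conv V.par.tensor F H) (conv V.par.tensor G K) L N ≫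
        convMap V.seq.tensor (V.par.assocExt F H L) (V.par.assocExt G K N) := by
  refine ((((jointlySurjective_isElt F).conv (jointlySurjective_isElt G)).conv
    ((jointlySurjective_isElt H).conv (jointlySurjective_isElt K))).conv
    ((jointlySurjective_isElt L).conv (jointlySurjective_isElt N))).hom_ext ?_
  rintro _ _ ⟨_, _, ⟨_, _, ⟨_, _, @⟨A, x⟩, @⟨B, y⟩⟩, ⟨_, _, @⟨D, z⟩, @⟨E, w⟩⟩⟩,
    ⟨_, _, @⟨A', x'⟩, @⟨B', y'⟩⟩⟩
  have h := V.psi2_par_assoc A B D E A' B'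
  simp only [← PromonoidalData.assocExt_yo, ← DuoData.psi2Ext_yo] at h
  exact eq_of_sq h
    ((V.par.assocSq _ _ _).horiz_comp ((sqMap _ (sqId _) (V.psi2Sq _ _ _ _)).horiz_comp
      (V.psi2Sq _ _ _ _)))
    ((sqMap _ (V.psi2Sq _ _ _ _) (sqId _)).horiz_comp ((V.psi2Sq _ _ _ _).horiz_comp
      (sqMap _ (V.par.assocSq _ _ _) (V.par.assocSq _ _ _))))

lemma psi2_seq_assocExt (F G H K L N : Psh C) :
    convMap V.par.tensor (V.seq.assocExt F G H) (V.seq.assocExt K L N) ≫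
      V.psi2Ext F (conv V.seq.tensor G H) K (conv V.seq.tensor L N) ≫
        convMap V.seq.tensor (𝟙 _) (V.psi2Ext G H L N) =
    V.psi2Ext (conv V.seq.tensor F G) H (conv V.seq.tensor K L) N ≫
      convMap V.seq.tensor (V.psi2Ext F G K L) (𝟙 _) ≫
        V.seq.assocExt (conv V.par.tensor F K) (conv V.par.tensor G L)
          (conv V.par.tensor H N) := by
  refine ((((jointlySurjective_isElt F).conv (jointlySurjective_isElt G)).conv
    (jointlySurjective_isElt H)).conv (((jointlySurjective_isElt K).conv
    (jointlySurjective_isElt L)).conv (jointlySurjective_isElt N))).hom_ext ?_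
  rintro _ _ ⟨_, _, ⟨_, _, ⟨_, _, @⟨A, x⟩, @⟨B, y⟩⟩, @⟨D, z⟩⟩,
    ⟨_, _, ⟨_, _, @⟨E, w⟩, @⟨A', x'⟩⟩, @⟨B', y'⟩⟩⟩
  have h := V.psi2_seq_assoc A B D E A' B'
  simp only [← PromonoidalData.assocExt_yo, ← DuoData.psi2Ext_yo] at h
  exact eq_of_sq h
    ((sqMap _ (V.seq.assocSq _ _ _) (V.seq.assocSq _ _ _)).horiz_comp
      ((V.psi2Sq _ _ _ _).horiz_comp (sqMap _ (sqId _) (V.psi2Sq _ _ _ _))))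
    ((V.psi2Sq _ _ _ _).horiz_comp ((sqMap _ (V.psi2Sq _ _ _ _) (sqId _)).horiz_comp
      (V.seq.assocSq _ _ _)))

lemma psi2_par_leftExt (F G : Psh C) :
    convMap V.par.tensor V.psi0 (𝟙 (conv V.seq.tensor F G)) ≫
      V.psi2Ext V.par.unit V.par.unit F G ≫
        convMap V.seq.tensor (V.par.leftExt F) (V.par.leftExt G) =
    V.par.leftExt (conv V.seq.tensor F G) := by
  refine ((jointlySurjective_id _).conv ((jointlySurjective_isElt F).conv
    (jointlySurjective_isElt G))).hom_ext ?_
  rintro _ _ ⟨_, _, ⟨⟩, ⟨_, _, @⟨A, x⟩, @⟨B, y⟩⟩⟩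
  have h := V.psi2_par_left A B
  simp only [← PromonoidalData.leftExt_yo] at h
  -- The square over `ψ₀` is trivial, but its right side has to be presented as a convolution of
  -- identities in order to match the left side of the naturality square of `ψ₂`.
  refine eq_of_sq h ((sqMap _ (c := convMap _ (elt x) (elt y)) (b := convMap _ (𝟙 _) (𝟙 _))
    ⟨by simp⟩ (sqId _)).horiz_comp
    ((V.psi2Sq _ _ _ _).horiz_comp (sqMap _ (V.par.leftSq _) (V.par.leftSq _))))
    (V.par.leftSq _)

lemma psi2_par_rightExt (F G : Psh C) :
    convMap V.par.tensor (𝟙 (conv V.seq.tensor F G)) V.psi0 ≫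
      V.psi2Ext F G V.par.unit V.par.unit ≫
        convMap V.seq.tensor (V.par.rightExt F) (V.par.rightExt G) =
    V.par.rightExt (conv V.seq.tensor F G) := by
  refine (((jointlySurjective_isElt F).conv
    (jointlySurjective_isElt G)).conv (jointlySurjective_id _)).hom_ext ?_
  rintro _ _ ⟨_, _, ⟨_, _, @⟨A, x⟩, @⟨B, y⟩⟩, ⟨⟩⟩
  have h := V.psi2_par_right A B
  simp only [← PromonoidalData.rightExt_yo] at h
  refine eq_of_sq h ((sqMap _ (a := convMap _ (elt x) (elt y)) (d := convMap _ (𝟙 _) (𝟙 _))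
    (sqId _) ⟨by simp⟩).horiz_comp
    ((V.psi2Sq _ _ _ _).horiz_comp (sqMap _ (V.par.rightSq _) (V.par.rightSq _))))
    (V.par.rightSq _)

lemma psi2_seq_leftExt (F G : Psh C) :
    V.psi2Ext V.seq.unit F V.seq.unit G ≫
      convMap V.seq.tensor V.phi2 (𝟙 (conv V.par.tensor F G)) ≫
        V.seq.leftExt (conv V.par.tensor F G) =
    convMap V.par.tensor (V.seq.leftExt F) (V.seq.leftExt G) := by
  refine (((jointlySurjective_id _).conv (jointlySurjective_isElt F)).conv
    ((jointlySurjective_id _).conv (jointlySurjective_isElt G))).hom_ext ?_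
  rintro _ _ ⟨_, _, ⟨_, _, ⟨⟩, @⟨A, x⟩⟩, ⟨_, _, ⟨⟩, @⟨B, y⟩⟩⟩
  have h := V.psi2_seq_left A B
  simp only [← PromonoidalData.leftExt_yo] at h
  refine eq_of_sq h ((V.psi2Sq _ _ _ _).horiz_comp ((sqMap _ (b := 𝟙 _)
    (c := convMap _ (elt x) (elt y)) ⟨by simp⟩ (sqId _)).horiz_comp (V.seq.leftSq _)))
    (sqMap _ (V.seq.leftSq _) (V.seq.leftSq _))

lemma psi2_seq_rightExt (F G : Psh C) :
    V.psi2Ext F V.seq.unit G V.seq.unit ≫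
      convMap V.seq.tensor (𝟙 (conv V.par.tensor F G)) V.phi2 ≫
        V.seq.rightExt (conv V.par.tensor F G) =
    convMap V.par.tensor (V.seq.rightExt F) (V.seq.rightExt G) := by
  refine (((jointlySurjective_isElt F).conv (jointlySurjective_id _)).conv
    ((jointlySurjective_isElt G).conv (jointlySurjective_id _))).hom_ext ?_
  rintro _ _ ⟨_, _, ⟨_, _, @⟨A, x⟩, ⟨⟩⟩, ⟨_, _, @⟨B, y⟩, ⟨⟩⟩⟩
  have h := V.psi2_seq_right A B
  simp only [← PromonoidalData.rightExt_yo] at h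
  refine eq_of_sq h ((V.psi2Sq _ _ _ _).horiz_comp ((sqMap _ (d := 𝟙 _)
    (a := convMap _ (elt x) (elt y)) (sqId _) ⟨by simp⟩).horiz_comp (V.seq.rightSq _)))
    (sqMap _ (V.seq.rightSq _) (V.seq.rightSq _))

end ProduoidalCat

namespace SymProduoidalCat

variable (V : SymProduoidalCat C)

lemma hexagonExt (F G H : Psh C) :
    V.par.assocExt F G H ≫ V.sym.ext F (conv V.par.tensor G H) ≫ V.par.assocExt G H F =
      convMap V.par.tensor (V.sym.ext F G) (𝟙 H) ≫ V.par.assocExt G F H ≫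
        convMap V.par.tensor (𝟙 G) (V.sym.ext F H) := by
  refine convL_elt_ext fun A B D x y z => ?_
  have h := V.hexagon A B D
  simp only [← PromonoidalData.assocExt_yo] at h
  exact eq_of_sq h ((V.par.assocSq _ _ _).horiz_comp ((V.sym.extSq _ _).horiz_comp
    (V.par.assocSq _ _ _)))
    ((sqMap _ (V.sym.extSq _ _) (sqId _)).horiz_comp ((V.par.assocSq _ _ _).horiz_comp
      (sqMap _ (sqId _) (V.sym.extSq _ _))))

lemma psi2_symExt (F G H K : Psh C) :
    V.sym.ext (conv V.seq.tensor F G) (conv V.seq.tensor H K) ≫ V.psi2Ext H K F G =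
      V.psi2Ext F G H K ≫ convMap V.seq.tensor (V.sym.ext F H) (V.sym.ext G K) := by
  refine convLR_elt_ext fun A B D E x y z w => ?_
  have h := V.psi2_sym A B D E
  simp only [← DuoData.psi2Ext_yo] at h
  exact eq_of_sq h ((V.sym.extSq _ _).horiz_comp (V.psi2Sq _ _ _ _))
    ((V.psi2Sq _ _ _ _).horiz_comp (sqMap _ (V.sym.extSq _ _) (V.sym.extSq _ _)))

/-- The symmetry of the convolution of presheaves. -/
@[reducible] def symmetricCategory :
    @SymmetricCategory (Psh C) _ V.par.monoidalCategory :=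
  letI := V.par.monoidalCategory
  open MonoidalCategory in
  { braiding := V.sym.iso
    braiding_naturality_right := fun F _ _ g => (V.sym.extSq (𝟙 F) g).w.symm
    braiding_naturality_left := fun f G => (V.sym.extSq f (𝟙 G)).w.symm
    hexagon_forward := V.hexagonExt
    -- Since the symmetry is its own inverse, the second hexagon is the inverse of the first one at
    -- `H`, `F`, `G`.
    hexagon_reverse := fun F G H => by
      have h := V.hexagonExt H F G
      have h' : V.par.assocIso H F G ≪≫ V.sym.iso H (conv V.par.tensor F G) ≪≫
          V.par.assocIso F G H = whiskerRightIso (V.sym.iso H F) G ≪≫ V.par.assocIso F H G ≪≫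
            whiskerLeftIso F (V.sym.iso H G) := Iso.ext h
      have h2 := congrArg Iso.inv h'
      simp only [Iso.trans_inv, Category.assoc] at h2
      exact h2
    symmetry := V.sym.ext_ext }

end SymProduoidalCat

end DuoidalExt

/-! ### Preservation of structure along a functor, extended from representables to presheaves. -/

section OverFunctor

variable {C D : Type u} [SmallCategory C] [SmallCategory D] {J : C ⥤ D}

/-- Yoneda over the functor `J`. It splits a map over `J` restricted to an element into `yonedaMap J
A`, to which preservation hypotheses apply, and a map of presheaves on the target. -/
lemma elt_over {G : Psh C} {G' : Psh D} (a : G ⟶ J.op ⋙ G') {A : C} (x : G.obj (op A)) :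
    elt x ≫ a = yonedaMap J A ≫ Functor.whiskerLeft J.op
      (elt (A := J.obj A) (a.app (op A) x)) := by
  rw [elt_comp]
  ext B f
  simp [elt]

lemma sqOver {P : Split C} {Q : Split D} (s : SplitMap J P Q) {F G H K : Psh C}
    {F' G' H' K' : Psh D} {t : F ⟶ G} {a : F ⟶ J.op ⋙ F'} {b : G ⟶ J.op ⋙ G'} {t' : F' ⟶ G'}
    {u : H ⟶ K} {c : H ⟶ J.op ⋙ H'} {d : K ⟶ J.op ⋙ K'} {u' : H' ⟶ K'}
    (h : CommSq t a b (Functor.whiskerLeft J.op t')) (k : CommSq u c d (Functor.whiskerLeft J.op u')) :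
    CommSq (convMap P t u) (convOver s a c) (convOver s b d)
      (Functor.whiskerLeft J.op (convMap Q t' u')) := by
  refine ⟨psh_hom_ext fun A e => ?_⟩
  induction e using conv_ind with | h X Y r x y =>
  have h1 := congrArg (fun k => k.app (op X) x) h.w
  have h2 := congrArg (fun k => k.app (op Y) y) k.w
  exact congrArg₂ (fun x y => (cmk ((s.app X Y).app A r) x y : (conv Q G' K').obj (J.op.obj A)))
    h1 h2

lemma convMap_convOver {P : Split C} {Q : Split D} (s : SplitMap J P Q) {F G H K : Psh C}
    {G' K' : Psh D} (t : F ⟶ G) (b : G ⟶ J.op ⋙ G') (u : H ⟶ K) (d : K ⟶ J.op ⋙ K') :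
    convMap P t u ≫ convOver s b d = convOver s (t ≫ b) (u ≫ d) := by
  ext X Y x y : 1
  rfl

lemma convOver_convMap {P : Split C} {Q : Split D} (s : SplitMap J P Q) {F H : Psh C}
    {F' G' H' K' : Psh D} (a : F ⟶ J.op ⋙ F') (t : F' ⟶ G') (c : H ⟶ J.op ⋙ H') (u : H' ⟶ K') :
    convOver s a c ≫ Functor.whiskerLeft J.op (convMap Q t u) =
      convOver s (a ≫ Functor.whiskerLeft J.op t) (c ≫ Functor.whiskerLeft J.op u) := by
  ext X Y x y : 1
  rfl

/-- Preservation of associators by a transformation of splits. -/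
def PreservesAssoc {M : PromonoidalData C} {M' : PromonoidalData D}
    (s : SplitMap J M.tensor M'.tensor) : Prop :=
  ∀ A B K : C,
    convOver s (convOver s (yonedaMap J A) (yonedaMap J B)) (yonedaMap J K) ≫
        Functor.whiskerLeft J.op (M'.assoc (J.obj A) (J.obj B) (J.obj K)).hom =
      (M.assoc A B K).hom ≫
        convOver s (yonedaMap J A) (convOver s (yonedaMap J B) (yonedaMap J K))

/-- Preservation of left unitors. -/
def PreservesLeft {M : PromonoidalData C} {M' : PromonoidalData D}
    (s : SplitMap J M.tensor M'.tensor) (i : M.unit ⟶ J.op ⋙ M'.unit) : Prop :=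
  ∀ A : C,
    convOver s i (yonedaMap J A) ≫ Functor.whiskerLeft J.op (M'.leftUnitor (J.obj A)).hom =
      (M.leftUnitor A).hom ≫ yonedaMap J A

/-- Preservation of right unitors. -/
def PreservesRight {M : PromonoidalData C} {M' : PromonoidalData D}
    (s : SplitMap J M.tensor M'.tensor) (i : M.unit ⟶ J.op ⋙ M'.unit) : Prop :=
  ∀ A : C,
    convOver s (yonedaMap J A) i ≫ Functor.whiskerLeft J.op (M'.rightUnitor (J.obj A)).hom =
      (M.rightUnitor A).hom ≫ yonedaMap J A

/-- Preservation of the laxators `ψ₂`. -/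
def PreservesPsi2 {V : DuoData C} {W : DuoData D} (s : SplitMap J V.par.tensor W.par.tensor)
    (t : SplitMap J V.seq.tensor W.seq.tensor) : Prop :=
  ∀ A B K L : C,
    convOver s (convOver t (yonedaMap J A) (yonedaMap J B))
          (convOver t (yonedaMap J K) (yonedaMap J L)) ≫
        Functor.whiskerLeft J.op
          (W.psi2 (J.obj A) (J.obj B) (J.obj K) (J.obj L)) =
      V.psi2 A B K L ≫
        convOver t (convOver s (yonedaMap J A) (yonedaMap J K))
          (convOver s (yonedaMap J B) (yonedaMap J L))

/-- Preservation of the symmetries. -/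
def PreservesSym {P : Split C} {Q : Split D} (S : Symmetry P) (T : Symmetry Q)
    (s : SplitMap J P Q) : Prop :=
  ∀ A B : C,
    s.app A B ≫ Functor.whiskerLeft J.op (T.app (J.obj A) (J.obj B)) = S.app A B ≫ s.app B A

/-- After restriction to elements, `elt_over` isolates the convolutions of `yonedaMap`, where the
hypothesis applies, and the rest is naturality of the target associator. These squares are the
building blocks of all later pastings, both for `η` and for arbitrary functors. -/
lemma PreservesAssoc.sq {M : PromonoidalData C} {M' : PromonoidalData D}
    {s : SplitMap J M.tensor M'.tensor} (hs : PreservesAssoc s) {F G H : Psh C} {F' G' H' : Psh D}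
    (a : F ⟶ J.op ⋙ F') (b : G ⟶ J.op ⋙ G') (c : H ⟶ J.op ⋙ H') :
    CommSq (M.assocExt F G H) (convOver s (convOver s a b) c) (convOver s a (convOver s b c))
      (Functor.whiskerLeft J.op (M'.assocExt F' G' H')) := by
  refine ⟨convL_elt_ext fun A B K x y z => ?_⟩
  rw [← Category.assoc, M.assocExt_elt, Category.assoc]
  simp only [convMap_convOver, elt_over, ← convOver_convMap, ← Category.assoc]
  rw [← hs]
  simp only [Category.assoc, ← Functor.whiskerLeft_comp, M'.assocExt_elt]

lemma PreservesLeft.sq {M : PromonoidalData C} {M' : PromonoidalData D}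
    {s : SplitMap J M.tensor M'.tensor} {i : M.unit ⟶ J.op ⋙ M'.unit} (hs : PreservesLeft s i)
    {F : Psh C} {F' : Psh D} (a : F ⟶ J.op ⋙ F') :
    CommSq (M.leftExt F) (convOver s i a) a (Functor.whiskerLeft J.op (M'.leftExt F')) := by
  refine ⟨M.conv_unit_left_ext fun A x => ?_⟩
  -- Padding the unit slot by an identity lets `convOver_convMap` be read from right to left.
  have e : i = i ≫ Functor.whiskerLeft J.op (𝟙 M'.unit) := by simp
  rw [← Category.assoc, M.leftExt_elt, ← Category.assoc (convMap _ _ _), convMap_convOver,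
    Category.id_comp, Category.assoc, elt_over]
  conv_rhs => rw [e]
  rw [← convOver_convMap, Category.assoc, ← Functor.whiskerLeft_comp, M'.leftExt_elt,
    Functor.whiskerLeft_comp, reassoc_of% (hs A)]

lemma PreservesRight.sq {M : PromonoidalData C} {M' : PromonoidalData D}
    {s : SplitMap J M.tensor M'.tensor} {i : M.unit ⟶ J.op ⋙ M'.unit} (hs : PreservesRight s i)
    {F : Psh C} {F' : Psh D} (a : F ⟶ J.op ⋙ F') :
    CommSq (M.rightExt F) (convOver s a i) a (Functor.whiskerLeft J.op (M'.rightExt F')) := by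
  refine ⟨M.conv_unit_right_ext fun A x => ?_⟩
  have e : i = i ≫ Functor.whiskerLeft J.op (𝟙 M'.unit) := by simp
  rw [← Category.assoc, M.rightExt_elt, ← Category.assoc (convMap _ _ _), convMap_convOver,
    Category.id_comp, Category.assoc, elt_over]
  conv_rhs => rw [e]
  rw [← convOver_convMap, Category.assoc, ← Functor.whiskerLeft_comp, M'.rightExt_elt,
    Functor.whiskerLeft_comp, reassoc_of% (hs A)]

lemma PreservesPsi2.sq {V : DuoData C} {W : DuoData D} {s : SplitMap J V.par.tensor W.par.tensor}
    {t : SplitMap J V.seq.tensor W.seq.tensor} (hst : PreservesPsi2 s t) {F G H K : Psh C}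
    {F' G' H' K' : Psh D}
    (a : F ⟶ J.op ⋙ F') (b : G ⟶ J.op ⋙ G') (c : H ⟶ J.op ⋙ H') (d : K ⟶ J.op ⋙ K') :
    CommSq (V.psi2Ext F G H K) (convOver s (convOver t a b) (convOver t c d))
      (convOver t (convOver s a c) (convOver s b d))
      (Functor.whiskerLeft J.op (W.psi2Ext F' G' H' K')) := by
  refine ⟨convLR_elt_ext fun A B K L x y z w => ?_⟩
  rw [← Category.assoc, V.psi2Ext_elt, Category.assoc]
  simp only [convMap_convOver, elt_over, ← convOver_convMap, ← Category.assoc]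
  rw [← hst]
  simp only [Category.assoc, ← Functor.whiskerLeft_comp, W.psi2Ext_elt]

lemma PreservesSym.sq {P : Split C} {Q : Split D} {S : Symmetry P} {T : Symmetry Q}
    {s : SplitMap J P Q} (hs : PreservesSym S T s) {F G : Psh C} {F' G' : Psh D}
    (a : F ⟶ J.op ⋙ F') (b : G ⟶ J.op ⋙ G') :
    CommSq (S.ext F G) (convOver s a b) (convOver s b a)
      (Functor.whiskerLeft J.op (T.ext F' G')) := by
  refine ⟨psh_hom_ext fun A e => ?_⟩
  induction e using conv_ind with | h X Y r x y =>
  have h := congrArg (fun k => (k.app A r)) (hs X Y)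
  exact (congrArg (fun r => (cmk r (b.app (op Y) y) (a.app (op X) x) :
    (conv Q G' F').obj (J.op.obj A))) h).symm

end OverFunctor

/-! ### Modules over a commutative monoid in a symmetric monoidal category. -/

section Modules

set_option linter.unusedSectionVars false

open MonoidalCategory MonObj

variable {𝒞 : Type*} [Category 𝒞] [MonoidalCategory 𝒞] [SymmetricCategory 𝒞]
variable (N : 𝒞) [MonObj N]

/-- The action on a free module. -/
def freeAct (G : 𝒞) : N ⊗ N ⊗ G ⟶ N ⊗ G := (α_ N N G).inv ≫ μ[N] ▷ G

/-- The inclusion of the generators of a free module. -/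
def freeUnit (G : 𝒞) : G ⟶ N ⊗ G := (λ_ G).inv ≫ η[N] ▷ G

/-- Moving a scalar past a factor. -/
def scalarSwap (M G : 𝒞) : M ⊗ N ⊗ G ⟶ N ⊗ M ⊗ G :=
  (α_ M N G).inv ≫ (β_ M N).hom ▷ G ≫ (α_ N M G).hom

/-- The multiplication of two elements of free modules. -/
def freePair (G H : 𝒞) : (N ⊗ G) ⊗ N ⊗ H ⟶ N ⊗ G ⊗ H :=
  tensorμ N G N H ≫ μ[N] ▷ (G ⊗ H)

lemma freeAct_assoc (G : 𝒞) : N ◁ freeAct N G ≫ freeAct N G = freeAct N (N ⊗ G) ≫ freeAct N G := by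
  simp only [freeAct, MonoidalCategory.whiskerLeft_comp, Category.assoc]
  have h := MonObj.mul_assoc N
  have h' : N ◁ μ[N] ≫ μ[N] = (α_ N N N).inv ≫ μ[N] ▷ N ≫ μ[N] := by rw [h, Iso.inv_hom_id_assoc]
  rw [associator_inv_naturality_middle_assoc, ← comp_whiskerRight, h',
    associator_inv_naturality_left_assoc]
  simp [-MonObj.mul_assoc, -MonObj.mul_assoc_assoc]

lemma freeAct_unit (G : 𝒞) : η[N] ▷ (N ⊗ G) ≫ freeAct N G = (λ_ (N ⊗ G)).hom := by
  rw [freeAct, associator_inv_naturality_left_assoc, ← comp_whiskerRight, MonObj.one_mul]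
  simp

lemma freeUnit_freeAct (G : 𝒞) : freeUnit N (N ⊗ G) ≫ freeAct N G = 𝟙 _ := by
  rw [freeUnit, Category.assoc, freeAct_unit, Iso.inv_hom_id]

lemma whisker_freeUnit_freeAct (G : 𝒞) : N ◁ freeUnit N G ≫ freeAct N G = 𝟙 _ := by
  simp only [freeAct, freeUnit, MonoidalCategory.whiskerLeft_comp, Category.assoc]
  rw [associator_inv_naturality_middle_assoc, ← comp_whiskerRight, MonObj.mul_one]
  simp

lemma freeUnit_natural {G H : 𝒞} (f : G ⟶ H) : f ≫ freeUnit N H = freeUnit N G ≫ N ◁ f := by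
  rw [freeUnit, freeUnit, Category.assoc, ← whisker_exchange, leftUnitor_inv_naturality_assoc]

lemma freeAct_natural {G H : 𝒞} (f : G ⟶ H) :
    N ◁ N ◁ f ≫ freeAct N H = freeAct N G ≫ N ◁ f := by
  rw [freeAct, freeAct, Category.assoc, ← whisker_exchange, associator_inv_naturality_right_assoc]

variable {N} in
/-- The laws of a module over a monoid. -/
structure IsAction {M : 𝒞} (a : N ⊗ M ⟶ M) : Prop where
  assoc : N ◁ a ≫ a = freeAct N M ≫ a
  unit : freeUnit N M ≫ a = 𝟙 M

lemma isAction_mul : IsAction μ[N] where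
  assoc := by rw [freeAct, Category.assoc, MonObj.mul_assoc, Iso.inv_hom_id_assoc]
  unit := by rw [freeUnit, Category.assoc, MonObj.one_mul, Iso.inv_hom_id]

variable {N} in
/-- Bilinear morphisms out of a tensor product of two modules. -/
structure IsBilinear {M₁ M₂ M₃ : 𝒞} (a₁ : N ⊗ M₁ ⟶ M₁) (a₂ : N ⊗ M₂ ⟶ M₂) (a₃ : N ⊗ M₃ ⟶ M₃)
    (b : M₁ ⊗ M₂ ⟶ M₃) : Prop where
  left : a₁ ▷ M₂ ≫ b = (α_ N M₁ M₂).hom ≫ N ◁ b ≫ a₃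
  right : M₁ ◁ a₂ ≫ b = scalarSwap N M₁ M₂ ≫ N ◁ b ≫ a₃

/-- By the hexagon, `M` passes `N` and then `G`; the second crossing is undone by symmetry. This is
what exchanges linearity in the second variable with linearity in the first. -/
lemma scalarSwap_braiding (M G : 𝒞) :
    (β_ M (N ⊗ G)).hom ≫ (α_ N G M).hom ≫ N ◁ (β_ G M).hom = scalarSwap N M G := by
  rw [scalarSwap, BraidedCategory.braiding_tensor_right_hom]
  simp [← MonoidalCategory.whiskerLeft_comp]

lemma scalarSwap_eq_braiding (M G : 𝒞) :
    (β_ (N ⊗ M) G).hom ≫ scalarSwap N G M = (α_ N M G).hom ≫ N ◁ (β_ M G).hom := by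
  rw [← scalarSwap_braiding, SymmetricCategory.symmetry_assoc]

variable {N}

lemma scalarSwap_natural {M M' G G' : 𝒞} (f : M ⟶ M') (g : G ⟶ G') :
    (f ⊗ₘ N ◁ g) ≫ scalarSwap N M' G' = scalarSwap N M G ≫ N ◁ (f ⊗ₘ g) := by
  simp only [scalarSwap, MonoidalCategory.tensorHom_def, Category.assoc,
    MonoidalCategory.whiskerLeft_comp]
  rw [associator_inv_naturality_right_assoc, whisker_exchange_assoc, associator_naturality_right,
    associator_inv_naturality_left_assoc, ← comp_whiskerRight_assoc,
    BraidedCategory.braiding_naturality_left, comp_whiskerRight_assoc,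
    associator_naturality_middle_assoc]

/-- Linearity on the right is linearity on the left of the braided map, by `scalarSwap_braiding`.
Concrete bilinearity proofs thus reduce to one kind of computation, performed twice. -/
lemma IsBilinear.of_left {M₁ M₂ M₃ : 𝒞} {a₁ : N ⊗ M₁ ⟶ M₁} {a₂ : N ⊗ M₂ ⟶ M₂}
    {a₃ : N ⊗ M₃ ⟶ M₃} {b : M₁ ⊗ M₂ ⟶ M₃}
    (h : a₁ ▷ M₂ ≫ b = (α_ N M₁ M₂).hom ≫ N ◁ b ≫ a₃)
    (h' : a₂ ▷ M₁ ≫ (β_ M₂ M₁).hom ≫ b = (α_ N M₂ M₁).hom ≫ N ◁ ((β_ M₂ M₁).hom ≫ b) ≫ a₃) :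
    IsBilinear a₁ a₂ a₃ b where
  left := h
  right := by
    rw [← scalarSwap_braiding, Category.assoc, Category.assoc]
    rw [MonoidalCategory.whiskerLeft_comp, Category.assoc] at h'
    rw [← h', ← BraidedCategory.braiding_naturality_right_assoc, SymmetricCategory.symmetry_assoc]

lemma IsBilinear.braid {M₁ M₂ M₃ : 𝒞} {a₁ : N ⊗ M₁ ⟶ M₁} {a₂ : N ⊗ M₂ ⟶ M₂}
    {a₃ : N ⊗ M₃ ⟶ M₃} {b : M₁ ⊗ M₂ ⟶ M₃} (h : IsBilinear a₁ a₂ a₃ b) :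
    IsBilinear a₂ a₁ a₃ ((β_ M₂ M₁).hom ≫ b) where
  left := by
    rw [BraidedCategory.braiding_naturality_left_assoc, h.right, MonoidalCategory.whiskerLeft_comp,
      Category.assoc, reassoc_of% (scalarSwap_eq_braiding N M₂ M₁)]
  right := by
    rw [BraidedCategory.braiding_naturality_right_assoc, h.left, MonoidalCategory.whiskerLeft_comp,
      Category.assoc, ← scalarSwap_braiding, Category.assoc, Category.assoc,
      ← MonoidalCategory.whiskerLeft_comp_assoc, SymmetricCategory.symmetry]
    simp

lemma IsBilinear.comp {M₁ M₂ M₃ M₄ : 𝒞} {a₁ : N ⊗ M₁ ⟶ M₁} {a₂ : N ⊗ M₂ ⟶ M₂}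
    {a₃ : N ⊗ M₃ ⟶ M₃} {a₄ : N ⊗ M₄ ⟶ M₄} {b : M₁ ⊗ M₂ ⟶ M₃} (h : IsBilinear a₁ a₂ a₃ b)
    {f : M₃ ⟶ M₄} (hf : a₃ ≫ f = N ◁ f ≫ a₄) : IsBilinear a₁ a₂ a₄ (b ≫ f) where
  left := by rw [← Category.assoc, h.left]; simp [hf]
  right := by rw [← Category.assoc, h.right]; simp [hf]

lemma IsBilinear.precomp {M₁ M₂ M₃ M₁' M₂' : 𝒞} {a₁ : N ⊗ M₁ ⟶ M₁} {a₂ : N ⊗ M₂ ⟶ M₂}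
    {a₃ : N ⊗ M₃ ⟶ M₃} {b : M₁ ⊗ M₂ ⟶ M₃} (h : IsBilinear a₁ a₂ a₃ b)
    {a₁' : N ⊗ M₁' ⟶ M₁'} {a₂' : N ⊗ M₂' ⟶ M₂'}
    {f : M₁' ⟶ M₁} (hf : a₁' ≫ f = N ◁ f ≫ a₁) {g : M₂' ⟶ M₂} (hg : a₂' ≫ g = N ◁ g ≫ a₂) :
    IsBilinear a₁' a₂' a₃ ((f ⊗ₘ g) ≫ b) where
  left := by
    have e : a₁' ▷ M₂' ≫ (f ⊗ₘ g) = (N ◁ f ⊗ₘ g) ≫ a₁ ▷ M₂ := by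
      rw [← tensorHom_id, ← tensorHom_id, tensorHom_comp_tensorHom, tensorHom_comp_tensorHom, hf,
        Category.id_comp, Category.comp_id]
    rw [← Category.assoc, e, Category.assoc, h.left, ← id_tensorHom, associator_naturality_assoc,
      id_tensorHom, MonoidalCategory.whiskerLeft_comp_assoc]
  right := by
    have e : M₁' ◁ a₂' ≫ (f ⊗ₘ g) = (f ⊗ₘ N ◁ g) ≫ M₁ ◁ a₂ := by
      rw [← id_tensorHom M₁', ← id_tensorHom M₁, tensorHom_comp_tensorHom,
        tensorHom_comp_tensorHom, hg,
        Category.id_comp, Category.comp_id]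
    rw [← Category.assoc, e, Category.assoc, h.right, reassoc_of% (scalarSwap_natural (N := N)),
      MonoidalCategory.whiskerLeft_comp_assoc]

lemma freePair_eq (G H : 𝒞) : freePair N G H =
    (α_ N G (N ⊗ H)).hom ≫ N ◁ scalarSwap N G H ≫ freeAct N (G ⊗ H) := by
  simp [freePair, tensorμ, scalarSwap, freeAct]

/-- The two scalars are extracted one after the other, by left and then right linearity, and are
multiplied by the associativity of `a₃`. -/
lemma IsBilinear.tensor_act {M₁ M₂ M₃ : 𝒞} {a₁ : N ⊗ M₁ ⟶ M₁} {a₂ : N ⊗ M₂ ⟶ M₂}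
    {a₃ : N ⊗ M₃ ⟶ M₃} {b : M₁ ⊗ M₂ ⟶ M₃} (h : IsBilinear a₁ a₂ a₃ b)
    (h₃ : IsAction a₃) : (a₁ ⊗ₘ a₂) ≫ b = freePair N M₁ M₂ ≫ N ◁ b ≫ a₃ := by
  rw [MonoidalCategory.tensorHom_def', Category.assoc, h.left, associator_naturality_right_assoc,
    ← MonoidalCategory.whiskerLeft_comp_assoc, h.right, MonoidalCategory.whiskerLeft_comp_assoc,
    MonoidalCategory.whiskerLeft_comp_assoc, h₃.assoc, reassoc_of% (freeAct_natural N), freePair_eq]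
  simp only [Category.assoc]

lemma freePair_natural {G G' H H' : 𝒞} (g : G ⟶ G') (h : H ⟶ H') :
    (N ◁ g ⊗ₘ N ◁ h) ≫ freePair N G' H' = freePair N G H ≫ N ◁ (g ⊗ₘ h) := by
  have := tensorμ_natural_assoc (𝟙 N) g (𝟙 N) h (μ[N] ▷ (G' ⊗ H'))
  simp only [id_tensorHom, MonoidalCategory.whiskerLeft_id, id_tensorHom] at this
  rw [freePair, this, freePair, Category.assoc, whisker_exchange]

/-- The extension of a morphism into a module to the free module. -/
def freeLift {G M : 𝒞} (a : N ⊗ M ⟶ M) (g : G ⟶ M) : N ⊗ G ⟶ M := N ◁ g ≫ a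

lemma freeUnit_freeLift {G M : 𝒞} {a : N ⊗ M ⟶ M} (ha : IsAction a) (g : G ⟶ M) :
    freeUnit N G ≫ freeLift a g = g := by
  rw [freeLift, ← Category.assoc, ← freeUnit_natural, Category.assoc, ha.unit, Category.comp_id]

lemma freeLift_freeLift {G H M : 𝒞} {a : N ⊗ M ⟶ M} (ha : IsAction a) (g : G ⟶ N ⊗ H)
    (h : H ⟶ M) : freeLift (freeAct N H) g ≫ freeLift a h = freeLift a (g ≫ freeLift a h) := by
  simp only [freeLift, MonoidalCategory.whiskerLeft_comp, Category.assoc, ha.assoc]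
  rw [reassoc_of% (freeAct_natural N h)]

lemma freeLift_comp_linear {G M M' : 𝒞} {a : N ⊗ M ⟶ M} {a' : N ⊗ M' ⟶ M'} (g : G ⟶ M)
    {f : M ⟶ M'} (hf : a ≫ f = N ◁ f ≫ a') : freeLift a g ≫ f = freeLift a' (g ≫ f) := by
  simp [freeLift, hf]

lemma freeLift_linear {G M : 𝒞} {a : N ⊗ M ⟶ M} (ha : IsAction a) (g : G ⟶ M) :
    freeAct N G ≫ freeLift a g = N ◁ freeLift a g ≫ a := by
  simp only [freeLift, MonoidalCategory.whiskerLeft_comp, Category.assoc, ha.assoc]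
  rw [reassoc_of% (freeAct_natural N g)]

lemma freeLift_freeUnit (G : 𝒞) : freeLift (freeAct N G) (freeUnit N G) = 𝟙 _ :=
  whisker_freeUnit_freeAct N G

/-- The main computation rule for the parallel structure: on free modules a bilinear map is the
linear extension of its values on generators, precomposed with the product `freePair`. -/
lemma IsBilinear.tensor_freeLift {M₁ M₂ M₃ : 𝒞} {a₁ : N ⊗ M₁ ⟶ M₁} {a₂ : N ⊗ M₂ ⟶ M₂}
    {a₃ : N ⊗ M₃ ⟶ M₃} {b : M₁ ⊗ M₂ ⟶ M₃} (h : IsBilinear a₁ a₂ a₃ b)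
    (h₃ : IsAction a₃) {G H : 𝒞} (g : G ⟶ M₁) (k : H ⟶ M₂) :
    (freeLift a₁ g ⊗ₘ freeLift a₂ k) ≫ b = freePair N G H ≫ freeLift a₃ ((g ⊗ₘ k) ≫ b) := by
  rw [freeLift, freeLift, ← tensorHom_comp_tensorHom, Category.assoc, h.tensor_act h₃,
    reassoc_of% (freePair_natural (N := N)), freeLift, MonoidalCategory.whiskerLeft_comp_assoc]

lemma whisker_freeUnit_freePair (G H : 𝒞) :
    (N ⊗ G) ◁ freeUnit N H ≫ freePair N G H = (α_ N G H).hom := by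
  rw [freePair_eq, associator_naturality_right_assoc, ← MonoidalCategory.whiskerLeft_comp_assoc]
  -- A unit scalar moves past `G` without trace, since braiding with the tensor unit is a composite
  -- of unitors.
  have : G ◁ freeUnit N H ≫ scalarSwap N G H = freeUnit N (G ⊗ H) := by
    have e : G ◁ η[N] ≫ (β_ G N).hom = (ρ_ G).hom ≫ (λ_ G).inv ≫ η[N] ▷ G := by
      rw [BraidedCategory.braiding_naturality_right, braiding_tensorUnit_right, Category.assoc]
    rw [freeUnit, scalarSwap, MonoidalCategory.whiskerLeft_comp, Category.assoc,
      associator_inv_naturality_middle_assoc, ← comp_whiskerRight_assoc, e]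
    simp [freeUnit]
  rw [this, whisker_freeUnit_freeAct, Category.comp_id]

lemma freeUnit_whisker (G H : 𝒞) : freeUnit N G ▷ H ≫ (α_ N G H).hom = freeUnit N (G ⊗ H) := by
  simp [freeUnit]

lemma freeUnit_freePair (G H : 𝒞) :
    (freeUnit N G ⊗ₘ freeUnit N H) ≫ freePair N G H = freeUnit N (G ⊗ H) := by
  rw [MonoidalCategory.tensorHom_def, Category.assoc, whisker_freeUnit_freePair, freeUnit_whisker]

/-- The rearrangement of six factors is `tensor_associativity`; multiplying the three scalars
afterwards, `MonObj.mul_assoc` reconciles the two bracketings. -/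
lemma freePair_associativity (G H K : 𝒞) :
    freePair N G H ▷ (N ⊗ K) ≫ freePair N (G ⊗ H) K ≫ N ◁ (α_ G H K).hom =
      (α_ (N ⊗ G) (N ⊗ H) (N ⊗ K)).hom ≫ (N ⊗ G) ◁ freePair N H K ≫ freePair N G (H ⊗ K) := by
  have h := tensor_associativity N G N H N K
  simp only [freePair, comp_whiskerRight, MonoidalCategory.whiskerLeft_comp, Category.assoc]
  have h1 := tensorμ_natural_left μ[N] (𝟙 (G ⊗ H)) N K
  have h2 := tensorμ_natural_right N G μ[N] (𝟙 (H ⊗ K))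
  simp only [tensorHom_id, id_whiskerRight, MonoidalCategory.whiskerLeft_id] at h1 h2
  have h' := h =≫ ((N ◁ μ[N] ≫ μ[N]) ▷ (G ⊗ H ⊗ K))
  simp only [Category.assoc, ← tensorHom_id, tensorHom_comp_tensorHom, Category.comp_id,
    ← MonObj.mul_assoc] at h'
  rw [reassoc_of% h1, reassoc_of% h2, ← comp_whiskerRight, ← tensorHom_id (N ◁ μ[N] ≫ μ[N]), ← h',
    tensorHom_id, tensorHom_id, MonoidalCategory.tensorHom_def (_ ≫ _), ← comp_whiskerRight_assoc]

variable [IsCommMonObj N]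

/-- Braiding two free modules also exchanges their scalars, and commutativity of `N` absorbs this
exchange. -/
lemma freePair_braiding (G H : 𝒞) :
    freePair N G H ≫ N ◁ (β_ G H).hom = (β_ (N ⊗ G) (N ⊗ H)).hom ≫ freePair N H G := by
  have h : (β_ (N ⊗ G) (N ⊗ H)).hom ≫ tensorμ N H N G =
      tensorμ N G N H ≫ ((β_ N N).hom ⊗ₘ (β_ G H).hom) := by
    simp [tensorμ, SymmetricCategory.braiding_swap_eq_inv_braiding H N,
      MonoidalCategory.tensorHom_def]
  rw [freePair, freePair, reassoc_of% h, Category.assoc, ← tensorHom_id _ (H ⊗ G),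
    tensorHom_comp_tensorHom, IsCommMonObj.mul_comm, Category.comp_id,
    MonoidalCategory.tensorHom_def]

/-- Linearity on the left is associativity of the free action. Linearity on the right is the same
fact conjugated by the braiding, by `freePair_braiding`. -/
lemma isBilinear_freePair (G H : 𝒞) :
    IsBilinear (freeAct N G) (freeAct N H) (freeAct N (G ⊗ H)) (freePair N G H) := by
  have h : ∀ G H : 𝒞, freeAct N G ▷ (N ⊗ H) ≫ freePair N G H =
      (α_ N (N ⊗ G) (N ⊗ H)).hom ≫ N ◁ freePair N G H ≫ freeAct N (G ⊗ H) := by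
    intro G H
    have e : freeAct N G ▷ (N ⊗ H) ≫ (α_ N G (N ⊗ H)).hom =
      (α_ N (N ⊗ G) (N ⊗ H)).hom ≫ N ◁ (α_ N G (N ⊗ H)).hom ≫ freeAct N (G ⊗ N ⊗ H) := by
      simp [freeAct]
    simp only [freePair_eq, MonoidalCategory.whiskerLeft_comp, Category.assoc]
    rw [freeAct_assoc, reassoc_of% (freeAct_natural N), ← Category.assoc, e]
    simp
  refine .of_left (h G H) ?_
  rw [← freePair_braiding, MonoidalCategory.whiskerLeft_comp, Category.assoc, freeAct_natural,
    ← Category.assoc, h]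
  simp

/-- In the second variable a scalar has to cross another scalar, so commutativity of `N` is
essential. This is what lets the action descend to a left unitor with unit `N`. -/
lemma IsAction.isBilinear {M : 𝒞} {a : N ⊗ M ⟶ M} (h : IsAction a) : IsBilinear μ[N] a a a where
  left := by
    rw [h.assoc, freeAct]
    simp
  right := by
    rw [h.assoc, scalarSwap, freeAct]
    simp [← comp_whiskerRight_assoc]

end Modules

/-! ### The Kleisli category of `V(•; N ⊗ •)` and its presheaves as `N`-modules. -/

section Kleisli

variable {C : Type u} [SmallCategory C] (V : SymProduoidalCat C)

/-- The presheaf `N` is a monoid for convolution. -/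
@[reducible] def unitMonObj : @MonObj (Psh C) _ V.par.monoidalCategory V.seq.unit :=
  letI := V.par.monoidalCategory
  { one := V.phi0
    mul := V.phi2
    one_mul := V.phi2_left
    mul_one := V.phi2_right
    mul_assoc := V.phi2_assoc.symm }

lemma unit_isCommMonObj :
    letI := V.par.monoidalCategory
    letI := V.symmetricCategory
    letI := unitMonObj V
    IsCommMonObj V.seq.unit :=
  letI := V.par.monoidalCategory
  letI := V.symmetricCategory
  letI := unitMonObj V
  { mul_comm := V.phi2_sym }

/-- The free action of `N` on `V(•; N ⊗ G)`. -/
def nAct (G : Psh C) : conv V.par.tensor V.seq.unit (conv V.par.tensor V.seq.unit G) ⟶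
    conv V.par.tensor V.seq.unit G :=
  V.par.assocInvExt V.seq.unit V.seq.unit G ≫ convMap V.par.tensor V.phi2 (𝟙 G)

/-- The generators `G ⟶ V(•; N ⊗ G)`. -/
def nUnit (G : Psh C) : G ⟶ conv V.par.tensor V.seq.unit G :=
  V.par.leftInvExt G ≫ convMap V.par.tensor V.phi0 (𝟙 G)

/-- The linear extension of a morphism of presheaves. -/
def nLift {G M : Psh C} (a : conv V.par.tensor V.seq.unit M ⟶ M) (g : G ⟶ M) :
    conv V.par.tensor V.seq.unit G ⟶ M :=
  convMap V.par.tensor (𝟙 V.seq.unit) g ≫ a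

/-- The laws of an action of `N`. -/
structure NAction {M : Psh C} (a : conv V.par.tensor V.seq.unit M ⟶ M) : Prop where
  assoc : convMap V.par.tensor (𝟙 V.seq.unit) a ≫ a = nAct V M ≫ a
  unit : nUnit V M ≫ a = 𝟙 M

/-- Linear maps between presheaves with an action of `N`. -/
def NLinear {M M' : Psh C} (a : conv V.par.tensor V.seq.unit M ⟶ M)
    (a' : conv V.par.tensor V.seq.unit M' ⟶ M') (f : M ⟶ M') : Prop :=
  a ≫ f = convMap V.par.tensor (𝟙 V.seq.unit) f ≫ a'

/-- Bilinear maps between presheaves with an action of `N`. -/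
def NBilinear {M₁ M₂ M₃ : Psh C} (a₁ : conv V.par.tensor V.seq.unit M₁ ⟶ M₁)
    (a₂ : conv V.par.tensor V.seq.unit M₂ ⟶ M₂) (a₃ : conv V.par.tensor V.seq.unit M₃ ⟶ M₃)
    (b : conv V.par.tensor M₁ M₂ ⟶ M₃) : Prop :=
  letI := V.par.monoidalCategory
  letI := V.symmetricCategory
  IsBilinear a₁ a₂ a₃ b

/-- The product `V(•; (N ⊗ G) ⊗ (N ⊗ H)) ⟶ V(•; N ⊗ (G ⊗ H))`. -/
def nPair (G H : Psh C) : conv V.par.tensor (conv V.par.tensor V.seq.unit G)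
    (conv V.par.tensor V.seq.unit H) ⟶ conv V.par.tensor V.seq.unit (conv V.par.tensor G H) :=
  letI := V.par.monoidalCategory
  letI := V.symmetricCategory
  letI := unitMonObj V
  freePair V.seq.unit G H

variable {V}

/-- Bridge to the abstract theory of modules. Since `Psh C` carries two monoidal structures, neither
is made a global instance; each abstract fact needed is restated with explicit convolutions, the
parallel structure being introduced locally. -/
lemma NAction.isAction {M : Psh C} {a : conv V.par.tensor V.seq.unit M ⟶ M} (h : NAction V a) :
    letI := V.par.monoidalCategory
    letI := unitMonObj V
    IsAction (N := V.seq.unit) a :=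
  letI := V.par.monoidalCategory
  letI := unitMonObj V
  ⟨h.assoc, h.unit⟩

variable (V)

lemma nAction_nAct (G : Psh C) : NAction V (nAct V G) := by
  letI := V.par.monoidalCategory
  letI := V.symmetricCategory
  letI := unitMonObj V
  exact ⟨freeAct_assoc V.seq.unit G, freeUnit_freeAct V.seq.unit G⟩

lemma nAction_phi2 : NAction V V.phi2 := by
  letI := V.par.monoidalCategory
  letI := V.symmetricCategory
  letI := unitMonObj V
  exact ⟨(isAction_mul V.seq.unit).assoc, (isAction_mul V.seq.unit).unit⟩

lemma nUnit_natural {G H : Psh C} (f : G ⟶ H) :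
    f ≫ nUnit V H = nUnit V G ≫ convMap V.par.tensor (𝟙 V.seq.unit) f := by
  letI := V.par.monoidalCategory
  letI := V.symmetricCategory
  letI := unitMonObj V
  exact freeUnit_natural V.seq.unit f

variable {V}

lemma nUnit_nLift {G M : Psh C} {a : conv V.par.tensor V.seq.unit M ⟶ M} (ha : NAction V a)
    (g : G ⟶ M) : nUnit V G ≫ nLift V a g = g := by
  letI := V.par.monoidalCategory
  letI := V.symmetricCategory
  letI := unitMonObj V
  exact freeUnit_freeLift ha.isAction g

lemma nLift_nLift {G H M : Psh C} {a : conv V.par.tensor V.seq.unit M ⟶ M} (ha : NAction V a)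
    (g : G ⟶ conv V.par.tensor V.seq.unit H) (h : H ⟶ M) :
    nLift V (nAct V H) g ≫ nLift V a h = nLift V a (g ≫ nLift V a h) := by
  letI := V.par.monoidalCategory
  letI := V.symmetricCategory
  letI := unitMonObj V
  exact freeLift_freeLift ha.isAction g h

lemma nLift_comp {G M M' : Psh C} {a : conv V.par.tensor V.seq.unit M ⟶ M}
    {a' : conv V.par.tensor V.seq.unit M' ⟶ M'} (g : G ⟶ M) {f : M ⟶ M'} (hf : NLinear V a a' f) :
    nLift V a g ≫ f = nLift V a' (g ≫ f) := by
  letI := V.par.monoidalCategory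
  letI := V.symmetricCategory
  letI := unitMonObj V
  exact freeLift_comp_linear g hf

lemma nLift_linear {G M : Psh C} {a : conv V.par.tensor V.seq.unit M ⟶ M} (ha : NAction V a)
    (g : G ⟶ M) : NLinear V (nAct V G) a (nLift V a g) := by
  letI := V.par.monoidalCategory
  letI := V.symmetricCategory
  letI := unitMonObj V
  exact freeLift_linear ha.isAction g

variable (V)

lemma nLift_nUnit (G : Psh C) : nLift V (nAct V G) (nUnit V G) = 𝟙 _ := by
  letI := V.par.monoidalCategory
  letI := V.symmetricCategory
  letI := unitMonObj V
  exact freeLift_freeUnit G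

lemma nLift_comp_nUnit {G H : Psh C} (f : G ⟶ H) :
    nLift V (nAct V H) (f ≫ nUnit V H) = convMap V.par.tensor (𝟙 V.seq.unit) f := by
  have h := nLift_nUnit V H
  rw [nLift] at h ⊢
  rw [← Category.id_comp (𝟙 V.seq.unit), convMap_comp, Category.assoc, h, Category.comp_id,
    Category.id_comp]

lemma convMap_nLift {G H M : Psh C} (a : conv V.par.tensor V.seq.unit M ⟶ M) (f : G ⟶ H)
    (g : H ⟶ M) : convMap V.par.tensor (𝟙 V.seq.unit) f ≫ nLift V a g = nLift V a (f ≫ g) := by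
  rw [nLift, nLift, ← Category.assoc, ← convMap_comp, Category.id_comp]

lemma normId_eq (B : C) : normId V B = nUnit V (yo B) := by
  rw [normId, nUnit, PromonoidalData.leftInvExt_yo]

lemma normComp_eq {A B D : C} (x : (normHom V B).obj (op A)) (y : (normHom V D).obj (op B)) :
    normComp V x y = (nLift V (nAct V (yo D)) (elt y)).app (op A) x := rfl

/-- The objects of the Kleisli category of the promonad `V(•; N ⊗ •)`. -/
structure Kl {C : Type u} [SmallCategory C] (_V : SymProduoidalCat C) : Type u where
  of : C

variable {V}

/-- Acting by a Kleisli composite is acting twice. For free modules this is associativity of the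
Kleisli category; for general modules it is functoriality of `NModule.toPsh`. -/
lemma nLift_elt_apply {M : Psh C} {a : conv V.par.tensor V.seq.unit M ⟶ M} (ha : NAction V a)
    {A B D : C} (x : (normHom V B).obj (op A)) (y : (normHom V D).obj (op B))
    (z : M.obj (op D)) :
    (nLift V a (elt ((nLift V a (elt z)).app (op B) y))).app (op A) x =
      (nLift V a (elt z)).app (op A) (normComp V x y) := by
  rw [normComp_eq, ← elt_comp, ← nLift_nLift ha]
  rfl

/-- Scalars coming from the unit of the promonad act by restriction along morphisms of `V`. Hence
the identity laws, and the agreement of `M.toPsh`, restricted along `klFunctor`, with `M`. -/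
lemma nLift_elt_normId {M : Psh C} {a : conv V.par.tensor V.seq.unit M ⟶ M} (ha : NAction V a)
    {A B : C} (f : A ⟶ B) (z : M.obj (op B)) :
    (nLift V a (elt z)).app (op A) ((normId V B).app (op A) f) = M.map f.op z := by
  have h := congrArg (fun k => k.app (op A) f) (nUnit_nLift ha (elt z))
  rw [normId_eq]
  exact h

/-- Composition is the action of Kleisli morphisms on free modules, so the category axioms are
instances of the module laws of `nAct`. -/
instance : SmallCategory (Kl V) where
  Hom A B := (normHom V B.of).obj (op A.of)
  id A := (normId V A.of).app (op A.of) (𝟙 A.of)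
  comp x y := normComp V x y
  id_comp {A B} x := by
    rw [normComp_eq, nLift_elt_normId (nAction_nAct V _), op_id, Functor.map_id_apply]
  comp_id {A B} x := by
    rw [normComp_eq, ← elt_comp, elt_id, CategoryTheory.Functor.map_id, Category.id_comp,
      normId_eq, nLift_nUnit]
    rfl
  assoc x y z := by
    rw [normComp_eq V x (normComp V y z), normComp_eq V y z, nLift_elt_apply (nAction_nAct V _)]
    rfl

lemma Kl.comp_eq {A B D : Kl V} (x : A ⟶ B) (y : B ⟶ D) :
    x ≫ y = (nLift V (nAct V (yo D.of)) (elt (A := B.of) y)).app (op A.of) x := rfl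

variable (V) in
/-- The canonical functor to the Kleisli category. -/
def klFunctor : C ⥤ Kl V where
  obj A := ⟨A⟩
  map {A B} f := (normId V B).app (op A) f
  map_id _ := rfl
  map_comp {A B D} f g := by
    change _ = normComp V _ _
    rw [normComp_eq, nLift_elt_normId (nAction_nAct V _), ← NatTrans.naturality_apply]
    simp

lemma comp_klFunctor_map {A : Kl V} {B D : C} (x : A ⟶ (klFunctor V).obj B) (f : B ⟶ D) :
    x ≫ (klFunctor V).map f =
      (convMap V.par.tensor (𝟙 V.seq.unit) (yoneda.map f)).app (op A.of) x := by
  rw [Kl.comp_eq]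
  change (nLift V (nAct V (yo D)) (elt ((normId V D).app (op B) f))).app (op A.of) x = _
  rw [← elt_comp, elt_id, normId_eq, nLift_comp_nUnit]

variable (V)

/-- A presheaf with an action of `N`. -/
structure NModule where
  psh : Psh C
  act : conv V.par.tensor V.seq.unit psh ⟶ psh
  isAction : NAction V act

/-- The free module on a presheaf. -/
abbrev freeModule (G : Psh C) : NModule V where
  psh := conv V.par.tensor V.seq.unit G
  act := nAct V G
  isAction := nAction_nAct V G

/-- The presheaf `N` as a module. -/
abbrev unitModule : NModule V where
  psh := V.seq.unit
  act := V.phi2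
  isAction := nAction_phi2 V

variable {V}

/-- The presheaf on the Kleisli category given by a module. -/
def NModule.toPsh (M : NModule V) : Psh (Kl V) where
  obj A := M.psh.obj (op A.unop.of)
  map {A B} x := ↾fun z => (nLift V M.act (elt z)).app (op B.unop.of) x.unop
  map_id A := by
    ext z
    refine (nLift_elt_normId M.isAction (𝟙 A.unop.of) z).trans ?_
    rw [op_id, Functor.map_id_apply]
    rfl
  map_comp {A B D} x y := by
    ext z
    exact (nLift_elt_apply M.isAction y.unop x.unop z).symm

/-- The restriction of `M.toPsh` is `M`. -/
def NModule.res (M : NModule V) : M.psh ⟶ (klFunctor V).op ⋙ M.toPsh where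
  app A := ↾fun z => z
  naturality A B f := by
    ext z
    exact (nLift_elt_normId M.isAction f.unop z).symm

/-- The restriction of `M.toPsh` is `M`. -/
def NModule.resInv (M : NModule V) : (klFunctor V).op ⋙ M.toPsh ⟶ M.psh where
  app A := ↾fun z => z
  naturality A B f := by
    ext z
    exact nLift_elt_normId M.isAction f.unop z

variable (V) in
/-- The restriction of the representable presheaf at `B` is `V(•; N ⊗ B)`. -/
def homRes (B : C) : normHom V B ⟶ (klFunctor V).op ⋙ yo ((klFunctor V).obj B) :=
  (freeModule V (yo B)).res

/-- The morphism `V(•; N ⊗ B) ⟶ F` named by an element of `F B`. -/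
def resElt {F : Psh (Kl V)} {B : C} (z : ((klFunctor V).op ⋙ F).obj (op B)) :
    normHom V B ⟶ (klFunctor V).op ⋙ F :=
  homRes V B ≫ Functor.whiskerLeft (klFunctor V).op (elt (F := F) (A := (klFunctor V).obj B) z)

/-- A morphism of the Kleisli category, given by an element of `V(A; N ⊗ B)`. -/
abbrev Kl.hom {A B : C} (x : (normHom V B).obj (op A)) :
    (klFunctor V).obj A ⟶ (klFunctor V).obj B := x

lemma yoneda_map_resElt {F : Psh (Kl V)} {B D : C} (f : B ⟶ D)
    (z : ((klFunctor V).op ⋙ F).obj (op D)) :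
    convMap V.par.tensor (𝟙 V.seq.unit) (yoneda.map f) ≫ resElt z =
      resElt (((klFunctor V).op ⋙ F).map f.op z) := by
  refine psh_hom_ext fun ⟨A⟩ x => ?_
  have h := comp_klFunctor_map (A := (klFunctor V).obj A) x f
  refine (congrArg (fun k : (klFunctor V).obj A ⟶ (klFunctor V).obj D => F.map k.op z)
    h.symm).trans ?_
  exact F.map_comp_apply ((klFunctor V).map f).op (Kl.hom x).op z

lemma elt_resElt {F : Psh (Kl V)} {A B : C} (z : ((klFunctor V).op ⋙ F).obj (op B))
    (y : (normHom V B).obj (op A)) :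
    resElt (F := F) (B := A) (F.map (Kl.hom y).op z) =
      nLift V (nAct V _) (elt y) ≫ resElt z := by
  refine psh_hom_ext fun ⟨D⟩ x => ?_
  exact (F.map_comp_apply (Kl.hom y).op (Kl.hom x).op z).symm

/-- The action of `N` on the restriction of a presheaf on the Kleisli category. -/
def resAct (F : Psh (Kl V)) :
    conv V.par.tensor V.seq.unit ((klFunctor V).op ⋙ F) ⟶ (klFunctor V).op ⋙ F :=
  convDesc (fun X Y n f => ins V.par.tensor n (𝟙 Y : (yo Y).obj (op Y)) ≫ resElt f) (by
    intro X X' Y Y' f g n z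
    rw [← yoneda_map_resElt, ← Category.assoc ((V.par.tensor.obj X').map g),
      ← Category.assoc ((V.par.tensor.map f).app Y), ins_din,
      ← Category.assoc (ins V.par.tensor _ _) (convMap _ _ _), ins_convMap]
    simp)

lemma resAct_elt {F : Psh (Kl V)} {B : C} (z : ((klFunctor V).op ⋙ F).obj (op B)) :
    convMap V.par.tensor (𝟙 V.seq.unit) (elt z) ≫ resAct F = resElt z := by
  refine psh_hom_ext fun L e => ?_
  induction e using conv_ind with | h X Y s n g =>
  refine (congrArg (fun k => k.app L (cmk s n (𝟙 Y))) (yoneda_map_resElt g z)).symm.trans ?_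
  exact congrArg (fun k => (resElt z).app L (cmk s n k : (normHom V B).obj L)) (Category.id_comp g)

lemma conv_right_elt_ext {P : Split C} {F G Z : Psh C} {t t' : conv P F G ⟶ Z}
    (h : ∀ (A : C) (x : G.obj (op A)), convMap P (𝟙 F) (elt x) ≫ t =
      convMap P (𝟙 F) (elt x) ≫ t') : t = t' := by
  refine ((jointlySurjective_id F).conv (jointlySurjective_isElt G)).hom_ext ?_
  rintro _ _ ⟨_, _, ⟨⟩, ⟨x⟩⟩
  exact h _ x

/-- Both laws are functoriality of `F`: the unit law holds by the definition of restriction along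
`klFunctor`, and associativity is the preservation of Kleisli composites, `elt_resElt`. -/
lemma nAction_resAct (F : Psh (Kl V)) : NAction V (resAct F) where
  unit := by
    refine psh_elt_ext fun A z => ?_
    rw [← Category.assoc, nUnit_natural, Category.assoc, resAct_elt, ← normId_eq, Category.comp_id]
    refine psh_hom_ext fun ⟨B⟩ f => ?_
    rfl
  assoc := by
    refine ((jointlySurjective_id _).conv ((jointlySurjective_id _).conv
      (jointlySurjective_isElt _))).hom_ext ?_
    rintro _ _ ⟨_, _, ⟨⟩, ⟨_, _, ⟨⟩, ⟨z⟩⟩⟩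
    refine conv_right_elt_ext fun A y => ?_
    have h2 : convMap V.par.tensor (𝟙 V.seq.unit) (convMap V.par.tensor (𝟙 V.seq.unit) (elt z)) ≫
        nAct V _ = nAct V _ ≫ convMap V.par.tensor (𝟙 V.seq.unit) (elt z) := by
      letI := V.par.monoidalCategory
      letI := V.symmetricCategory
      letI := unitMonObj V
      exact freeAct_natural V.seq.unit (elt z)
    rw [reassoc_of% h2, resAct_elt]
    simp only [← Category.assoc, ← convMap_comp, Category.id_comp]
    rw [Category.assoc (elt y), resAct_elt, elt_comp, resAct_elt]
    exact elt_resElt z y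

end Kleisli

/-! ### Linear maps, free presheaves on the Kleisli category, and generators. -/

section KleisliPresheaves

variable {C : Type u} [SmallCategory C] {V : SymProduoidalCat C}

/-- Linearity is naturality with respect to the Kleisli morphisms. `NModule.desc` is the converse
passage, from linear maps to natural ones. -/
lemma whiskerLeft_linear {F G : Psh (Kl V)} (t : F ⟶ G) :
    NLinear V (resAct F) (resAct G) (Functor.whiskerLeft (klFunctor V).op t) := by
  refine conv_right_elt_ext fun A z => ?_
  rw [← Category.assoc, resAct_elt, ← Category.assoc, ← convMap_comp, elt_comp, Category.id_comp,
    resAct_elt]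
  refine psh_hom_ext fun ⟨B⟩ x => ?_
  exact NatTrans.naturality_apply t (Kl.hom x).op z

namespace NModule

variable (M : NModule V)

lemma nLift_elt_linear {Z : Psh (Kl V)} {b : M.psh ⟶ (klFunctor V).op ⋙ Z}
    (hb : NLinear V M.act (resAct Z) b) {A : C} (z : M.psh.obj (op A)) :
    nLift V M.act (elt z) ≫ b = resElt (b.app (op A) z) := by
  rw [nLift_comp _ hb, elt_comp, nLift, resAct_elt]

lemma res_linear : NLinear V M.act (resAct M.toPsh) M.res := by
  refine conv_right_elt_ext fun A z => ?_
  rw [← Category.assoc (convMap _ _ _) (convMap _ _ _), ← convMap_comp, elt_comp, Category.id_comp,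
    resAct_elt]
  rfl

/-- A linear map out of a module is a morphism of presheaves on the Kleisli category. -/
def desc {Z : Psh (Kl V)} (b : M.psh ⟶ (klFunctor V).op ⋙ Z)
    (hb : NLinear V M.act (resAct Z) b) : M.toPsh ⟶ Z where
  app A := ↾fun z => b.app (op A.unop.of) z
  naturality := by
    rintro ⟨A⟩ ⟨B⟩ ⟨x⟩
    ext z
    exact congrArg (fun k => k.app (op B.of) x) (M.nLift_elt_linear hb z)

lemma res_desc {Z : Psh (Kl V)} (b : M.psh ⟶ (klFunctor V).op ⋙ Z)
    (hb : NLinear V M.act (resAct Z) b) :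
    M.res ≫ Functor.whiskerLeft (klFunctor V).op (M.desc b hb) = b := rfl

variable {M} in
lemma hom_ext {Z : Psh (Kl V)} {s t : M.toPsh ⟶ Z}
    (h : M.res ≫ Functor.whiskerLeft (klFunctor V).op s =
      M.res ≫ Functor.whiskerLeft (klFunctor V).op t) : s = t := by
  refine psh_hom_ext fun A z => ?_
  exact congrArg (fun k => k.app (op A.unop.of) z) h

end NModule

/-- The restriction of a presheaf on the Kleisli category, as a module. -/
abbrev resModule (F : Psh (Kl V)) : NModule V where
  psh := (klFunctor V).op ⋙ F
  act := resAct F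
  isAction := nAction_resAct F

variable (V) in
/-- The presheaf on the Kleisli category freely generated by a presheaf. -/
abbrev klFree (G : Psh C) : Psh (Kl V) := (freeModule V G).toPsh

variable (V) in
/-- The restriction of `klFree V G`. -/
def freeRes (G : Psh C) :
    conv V.par.tensor V.seq.unit G ⟶ (klFunctor V).op ⋙ klFree V G := (freeModule V G).res

variable (V) in
/-- The inverse of `freeRes V G`. -/
def freeResInv (G : Psh C) :
    (klFunctor V).op ⋙ klFree V G ⟶ conv V.par.tensor V.seq.unit G := (freeModule V G).resInv

variable (V) in
lemma freeRes_linear (G : Psh C) :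
    NLinear V (nAct V G) (resAct (klFree V G)) (freeRes V G) := (freeModule V G).res_linear

variable (V) in
/-- The generators of `klFree V G`. -/
def klGen (G : Psh C) : G ⟶ (klFunctor V).op ⋙ klFree V G := nUnit V G ≫ freeRes V G

/-- The extension of a morphism from the generators. -/
def freeDesc {G : Psh C} {Z : Psh (Kl V)} (g : G ⟶ (klFunctor V).op ⋙ Z) : klFree V G ⟶ Z :=
  (freeModule V G).desc (nLift V (resAct Z) g) (nLift_linear (nAction_resAct Z) g)

lemma freeRes_freeDesc {G : Psh C} {Z : Psh (Kl V)} (g : G ⟶ (klFunctor V).op ⋙ Z) :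
    freeRes V G ≫ Functor.whiskerLeft (klFunctor V).op (freeDesc g) =
      nLift V (resAct Z) g := rfl

lemma klGen_freeDesc {G : Psh C} {Z : Psh (Kl V)} (g : G ⟶ (klFunctor V).op ⋙ Z) :
    klGen V G ≫ Functor.whiskerLeft (klFunctor V).op (freeDesc g) = g :=
  nUnit_nLift (nAction_resAct Z) g

lemma nLift_klGen {G H : Psh C} (f : G ⟶ conv V.par.tensor V.seq.unit H) :
    nLift V (resAct (klFree V H)) (f ≫ freeRes V H) = nLift V (nAct V H) f ≫ freeRes V H :=
  (nLift_comp f (freeRes_linear V H)).symm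

/-- The elements of a presheaf on the Kleisli category generated by a morphism. -/
def Generates {G : Psh C} {F : Psh (Kl V)} (g : G ⟶ (klFunctor V).op ⋙ F) : Prop :=
  ∀ (A : Kl V) (z : F.obj (op A)), ∃ (B : C) (m : A ⟶ (klFunctor V).obj B) (y : G.obj (op B)),
    F.map m.op (g.app (op B) y) = z

/-- Naturality in Kleisli morphisms propagates agreement from the generators to all elements. Every
equation of maps on `Kl V` is checked in this way. -/
lemma Generates.hom_ext {G : Psh C} {F : Psh (Kl V)} {g : G ⟶ (klFunctor V).op ⋙ F}
    (hg : Generates g) {Z : Psh (Kl V)} {s t : F ⟶ Z}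
    (h : g ≫ Functor.whiskerLeft (klFunctor V).op s =
      g ≫ Functor.whiskerLeft (klFunctor V).op t) : s = t := by
  refine psh_hom_ext fun ⟨A⟩ z => ?_
  obtain ⟨B, m, y, rfl⟩ := hg A z
  have h' := congrArg (fun k => k.app (op B) y) h
  rw [NatTrans.naturality_apply, NatTrans.naturality_apply]
  exact congrArg (Z.map m.op) h'

/-- A class `[s; n, y]` in `N ⊗ G` is the generator `y` restricted along the Kleisli morphism `[s;
n, 𝟙]`. -/
lemma generates_klGen (G : Psh C) : Generates (klGen V G) := by
  intro A z
  change (conv V.par.tensor V.seq.unit G).obj (op A.of) at z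
  induction z using conv_ind with | h X Y s n y =>
  refine ⟨Y, (cmk s n (𝟙 Y) : (normHom V Y).obj (op A.of)), y, ?_⟩
  change (nLift V (nAct V G) (elt ((nUnit V G).app (op Y) y))).app (op A.of) _ = _
  rw [← elt_comp, nLift_comp_nUnit]
  exact congrArg (fun k => (cmk s n k : (conv V.par.tensor V.seq.unit G).obj (op A.of)))
    (elt_app_id y)

lemma klFree_hom_ext {G : Psh C} {Z : Psh (Kl V)} {s t : klFree V G ⟶ Z}
    (h : klGen V G ≫ Functor.whiskerLeft (klFunctor V).op s =
      klGen V G ≫ Functor.whiskerLeft (klFunctor V).op t) : s = t :=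
  (generates_klGen G).hom_ext h

lemma generates_yonedaMap (B : C) : Generates (yonedaMap (klFunctor V) B) := by
  intro A z
  exact ⟨B, z, 𝟙 B, Category.comp_id z⟩

lemma generates_id (F : Psh (Kl V)) : Generates (𝟙 ((klFunctor V).op ⋙ F)) := by
  intro A z
  exact ⟨A.of, 𝟙 A, z, F.map_id_apply (op A) z⟩

end KleisliPresheaves

/-! ### Bilinear maps of presheaves with an action of `N`. -/

section Bilinear

variable {C : Type u} [SmallCategory C] (V : SymProduoidalCat C)

/-- Moving a scalar past a factor. -/
def nSwap (F G : Psh C) : conv V.par.tensor F (conv V.par.tensor V.seq.unit G) ⟶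
    conv V.par.tensor V.seq.unit (conv V.par.tensor F G) :=
  letI := V.par.monoidalCategory
  letI := V.symmetricCategory
  scalarSwap V.seq.unit F G

lemma nSwap_natural {F F' G G' : Psh C} (f : F ⟶ F') (g : G ⟶ G') :
    convMap V.par.tensor f (convMap V.par.tensor (𝟙 V.seq.unit) g) ≫ nSwap V F' G' =
      nSwap V F G ≫ convMap V.par.tensor (𝟙 V.seq.unit) (convMap V.par.tensor f g) := by
  letI := V.par.monoidalCategory
  letI := V.symmetricCategory
  letI := unitMonObj V
  exact scalarSwap_natural (N := V.seq.unit) f g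

variable {V}

section

variable {M₁ M₂ M₃ : Psh C} {a₁ : conv V.par.tensor V.seq.unit M₁ ⟶ M₁}
  {a₂ : conv V.par.tensor V.seq.unit M₂ ⟶ M₂} {a₃ : conv V.par.tensor V.seq.unit M₃ ⟶ M₃}
  {b : conv V.par.tensor M₁ M₂ ⟶ M₃}

lemma NBilinear.left (h : NBilinear V a₁ a₂ a₃ b) :
    convMap V.par.tensor a₁ (𝟙 M₂) ≫ b =
      V.par.assocExt V.seq.unit M₁ M₂ ≫ convMap V.par.tensor (𝟙 V.seq.unit) b ≫ a₃ :=
  letI := V.par.monoidalCategory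
  letI := V.symmetricCategory
  IsBilinear.left h

lemma NBilinear.right (h : NBilinear V a₁ a₂ a₃ b) :
    convMap V.par.tensor (𝟙 M₁) a₂ ≫ b =
      nSwap V M₁ M₂ ≫ convMap V.par.tensor (𝟙 V.seq.unit) b ≫ a₃ :=
  letI := V.par.monoidalCategory
  letI := V.symmetricCategory
  IsBilinear.right h

lemma nBilinear_of (hl : convMap V.par.tensor a₁ (𝟙 M₂) ≫ b =
      V.par.assocExt V.seq.unit M₁ M₂ ≫ convMap V.par.tensor (𝟙 V.seq.unit) b ≫ a₃)
    (hr : convMap V.par.tensor (𝟙 M₁) a₂ ≫ b =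
      nSwap V M₁ M₂ ≫ convMap V.par.tensor (𝟙 V.seq.unit) b ≫ a₃) : NBilinear V a₁ a₂ a₃ b := by
  letI := V.par.monoidalCategory
  letI := V.symmetricCategory
  letI := unitMonObj V
  exact IsBilinear.mk hl hr

lemma nBilinear_of_left (hl : convMap V.par.tensor a₁ (𝟙 M₂) ≫ b =
      V.par.assocExt V.seq.unit M₁ M₂ ≫ convMap V.par.tensor (𝟙 V.seq.unit) b ≫ a₃)
    (hr : convMap V.par.tensor a₂ (𝟙 M₁) ≫ V.sym.ext M₂ M₁ ≫ b = V.par.assocExt V.seq.unit M₂ M₁ ≫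
      convMap V.par.tensor (𝟙 V.seq.unit) (V.sym.ext M₂ M₁ ≫ b) ≫ a₃) :
    NBilinear V a₁ a₂ a₃ b := by
  letI := V.par.monoidalCategory
  letI := V.symmetricCategory
  letI := unitMonObj V
  exact IsBilinear.of_left hl hr

lemma NBilinear.comp {M₄ : Psh C} {a₄ : conv V.par.tensor V.seq.unit M₄ ⟶ M₄}
    (h : NBilinear V a₁ a₂ a₃ b) {f : M₃ ⟶ M₄} (hf : NLinear V a₃ a₄ f) :
    NBilinear V a₁ a₂ a₄ (b ≫ f) := by
  letI := V.par.monoidalCategory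
  letI := V.symmetricCategory
  letI := unitMonObj V
  exact IsBilinear.comp h hf

lemma NBilinear.braid (h : NBilinear V a₁ a₂ a₃ b) :
    NBilinear V a₂ a₁ a₃ (V.sym.ext M₂ M₁ ≫ b) := by
  letI := V.par.monoidalCategory
  letI := V.symmetricCategory
  letI := unitMonObj V
  exact IsBilinear.braid h

lemma NBilinear.precomp {M₁' M₂' : Psh C} {a₁' : conv V.par.tensor V.seq.unit M₁' ⟶ M₁'}
    {a₂' : conv V.par.tensor V.seq.unit M₂' ⟶ M₂'} (h : NBilinear V a₁ a₂ a₃ b)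
    {f : M₁' ⟶ M₁} (hf : NLinear V a₁' a₁ f) {g : M₂' ⟶ M₂} (hg : NLinear V a₂' a₂ g) :
    NBilinear V a₁' a₂' a₃ (convMap V.par.tensor f g ≫ b) := by
  letI := V.par.monoidalCategory
  letI := V.symmetricCategory
  letI := unitMonObj V
  exact IsBilinear.precomp h hf hg

lemma NBilinear.convMap_nLift (h : NBilinear V a₁ a₂ a₃ b) (h₃ : NAction V a₃) {G H : Psh C}
    (g : G ⟶ M₁) (k : H ⟶ M₂) :
    convMap V.par.tensor (nLift V a₁ g) (nLift V a₂ k) ≫ b =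
      nPair V G H ≫ nLift V a₃ (convMap V.par.tensor g k ≫ b) := by
  letI := V.par.monoidalCategory
  letI := V.symmetricCategory
  letI := unitMonObj V
  exact IsBilinear.tensor_freeLift h h₃.isAction g k

end

variable (V)

lemma nBilinear_nPair (G H : Psh C) :
    NBilinear V (nAct V G) (nAct V H) (nAct V (conv V.par.tensor G H)) (nPair V G H) := by
  letI := V.par.monoidalCategory
  letI := V.symmetricCategory
  letI := unitMonObj V
  haveI := unit_isCommMonObj V
  exact isBilinear_freePair (N := V.seq.unit) G H

lemma nUnit_nPair (G H : Psh C) :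
    convMap V.par.tensor (nUnit V G) (nUnit V H) ≫ nPair V G H =
      nUnit V (conv V.par.tensor G H) := by
  letI := V.par.monoidalCategory
  letI := V.symmetricCategory
  letI := unitMonObj V
  exact freeUnit_freePair (N := V.seq.unit) G H

lemma nPair_assoc (G H K : Psh C) :
    convMap V.par.tensor (nPair V G H) (𝟙 (conv V.par.tensor V.seq.unit K)) ≫
        nPair V (conv V.par.tensor G H) K ≫
          convMap V.par.tensor (𝟙 V.seq.unit) (V.par.assocExt G H K) =
      V.par.assocExt _ _ _ ≫ convMap V.par.tensor (𝟙 (conv V.par.tensor V.seq.unit G))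
        (nPair V H K) ≫ nPair V G (conv V.par.tensor H K) := by
  letI := V.par.monoidalCategory
  letI := V.symmetricCategory
  letI := unitMonObj V
  exact freePair_associativity (N := V.seq.unit) G H K

lemma nPair_sym (G H : Psh C) :
    nPair V G H ≫ convMap V.par.tensor (𝟙 V.seq.unit) (V.sym.ext G H) =
      V.sym.ext _ _ ≫ nPair V H G := by
  letI := V.par.monoidalCategory
  letI := V.symmetricCategory
  letI := unitMonObj V
  haveI := unit_isCommMonObj V
  exact freePair_braiding (N := V.seq.unit) G H

variable {V} in
lemma NAction.nBilinear {M : Psh C} {a : conv V.par.tensor V.seq.unit M ⟶ M} (h : NAction V a) :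
    NBilinear V V.phi2 a a a := by
  letI := V.par.monoidalCategory
  letI := V.symmetricCategory
  letI := unitMonObj V
  haveI := unit_isCommMonObj V
  exact h.isAction.isBilinear

lemma nLinear_convMap {G H : Psh C} (f : G ⟶ H) :
    NLinear V (nAct V G) (nAct V H) (convMap V.par.tensor (𝟙 V.seq.unit) f) := by
  rw [← nLift_comp_nUnit]
  exact nLift_linear (nAction_nAct V H) _

variable {V} in
lemma NLinear.comp {M₁ M₂ M₃ : Psh C} {a₁ : conv V.par.tensor V.seq.unit M₁ ⟶ M₁}
    {a₂ : conv V.par.tensor V.seq.unit M₂ ⟶ M₂} {a₃ : conv V.par.tensor V.seq.unit M₃ ⟶ M₃}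
    {f : M₁ ⟶ M₂} {g : M₂ ⟶ M₃} (hf : NLinear V a₁ a₂ f) (hg : NLinear V a₂ a₃ g) :
    NLinear V a₁ a₃ (f ≫ g) := by
  unfold NLinear at *
  rw [← Category.assoc, hf, Category.assoc, hg, ← Category.assoc, ← convMap_comp, Category.id_comp]

end Bilinear

/-! ### Yoneda reduction, and splits given jointly in both variables. -/

section Splits

variable {C : Type u} [SmallCategory C]

lemma convYo_ins (P : Split C) {F G : Psh C} {A B : C} (x : F.obj (op A)) (y : G.obj (op B)) :
    convYo P A B ≫ ins P x y = convMap P (elt x) (elt y) := by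
  ext X Y f g : 1
  refine Eq.trans ?_ (ins_din P f g x y)
  change ((P.map f).app Y ≫ (P.obj A).map g) ≫ ins P x y = _
  rw [Category.assoc]

lemma ins_convYo (P : Split C) {A B X Y : C} (f : X ⟶ A) (g : Y ⟶ B) :
    ins P (F := yo A) (G := yo B) f g ≫ convYo P A B = (P.map f).app Y ≫ (P.obj A).map g := rfl

/-- Yoneda reduction for splits. -/
def convYoIso (P : Split C) (A B : C) : conv P (yo A) (yo B) ≅ (P.obj A).obj B where
  hom := convYo P A B
  inv := ins P (F := yo A) (G := yo B) (𝟙 A) (𝟙 B)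
  hom_inv_id := by
    rw [convYo_ins]
    simp
  inv_hom_id := by
    rw [ins_convYo]
    simp

/-- A split given by its action on pairs of morphisms. -/
def Split.mk (obj : C → C → Psh C)
    (map : ∀ {A A' B B' : C}, (A ⟶ A') → (B ⟶ B') → (obj A B ⟶ obj A' B'))
    (map_id : ∀ A B : C, map (𝟙 A) (𝟙 B) = 𝟙 (obj A B))
    (map_comp : ∀ {A A' A'' B B' B'' : C} (f : A ⟶ A') (f' : A' ⟶ A'') (g : B ⟶ B')
      (g' : B' ⟶ B''), map (f ≫ f') (g ≫ g') = map f g ≫ map f' g') : Split C where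
  obj A :=
    { obj := fun B => obj A B
      map := fun g => map (𝟙 A) g
      map_id := fun B => map_id A B
      map_comp := fun g g' => by rw [← map_comp, Category.comp_id] }
  map f :=
    { app := fun B => map f (𝟙 B)
      naturality := fun B B' g => by
        rw [← map_comp, ← map_comp]
        simp }
  map_id A := by
    ext B : 2
    exact map_id A B
  map_comp f f' := by
    ext B : 2
    change map _ _ = map _ _ ≫ map _ _
    rw [← map_comp, Category.comp_id]

end Splits

/-! ### The parallel splits of the Kleisli category. -/

section ParallelSplit

variable {C : Type u} [SmallCategory C] (V : SymProduoidalCat C)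

/-- The product `V(•; (N ⊗ A) ⊗ (N ⊗ B)) ⟶ V(•; N ⊗ (A ⊗ B))`. -/
def parMul (A B : C) : conv V.par.tensor (normHom V A) (normHom V B) ⟶ normPar V A B :=
  nPair V (yo A) (yo B) ≫ convMap V.par.tensor (𝟙 V.seq.unit) (convYo V.par.tensor A B)

variable {V} in
-- Replaces the split `V(•; A ⊗ B)` by the convolution of representables, to which the calculus of
-- bilinear maps applies.
lemma nLift_ins {A B : C} {F G M : Psh C} {a : conv V.par.tensor V.seq.unit M ⟶ M}
    (x : F.obj (op A)) (y : G.obj (op B)) (b : conv V.par.tensor F G ⟶ M) :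
    parMul V A B ≫ nLift V a (ins V.par.tensor x y ≫ b) =
      nPair V (yo A) (yo B) ≫ nLift V a (convMap V.par.tensor (elt x) (elt y) ≫ b) := by
  rw [parMul, Category.assoc, convMap_nLift, reassoc_of% (convYo_ins V.par.tensor x y)]

lemma nUnit_parMul (A B : C) :
    convMap V.par.tensor (nUnit V (yo A)) (nUnit V (yo B)) ≫ parMul V A B =
      convYo V.par.tensor A B ≫ nUnit V _ := by
  rw [parMul, reassoc_of% (nUnit_nPair V), nUnit_natural]

/-- The linear extension of a morphism, on the Kleisli category. -/
def klExt {G H : Psh C} (g : G ⟶ conv V.par.tensor V.seq.unit H) : klFree V G ⟶ klFree V H :=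
  freeDesc (g ≫ freeRes V H)

variable {V}

lemma freeRes_klExt {G H : Psh C} (g : G ⟶ conv V.par.tensor V.seq.unit H) :
    freeRes V G ≫ Functor.whiskerLeft (klFunctor V).op (klExt V g) =
      nLift V (nAct V H) g ≫ freeRes V H := by
  rw [klExt, freeRes_freeDesc, nLift_klGen]

lemma klGen_klExt {G H : Psh C} (g : G ⟶ conv V.par.tensor V.seq.unit H) :
    klGen V G ≫ Functor.whiskerLeft (klFunctor V).op (klExt V g) = g ≫ freeRes V H :=
  klGen_freeDesc _

lemma klExt_freeDesc {G H : Psh C} {Z : Psh (Kl V)} (g : G ⟶ conv V.par.tensor V.seq.unit H)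
    (h : H ⟶ (klFunctor V).op ⋙ Z) :
    klExt V g ≫ freeDesc h = freeDesc (g ≫ nLift V (resAct Z) h) := by
  refine klFree_hom_ext ?_
  rw [Functor.whiskerLeft_comp, reassoc_of% (klGen_klExt g), freeRes_freeDesc, klGen_freeDesc]

lemma klExt_klExt {G H K : Psh C} (g : G ⟶ conv V.par.tensor V.seq.unit H)
    (h : H ⟶ conv V.par.tensor V.seq.unit K) :
    klExt V g ≫ klExt V h = klExt V (g ≫ nLift V (nAct V K) h) := by
  rw [klExt.eq_1 V h, klExt_freeDesc, nLift_klGen, klExt, Category.assoc]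

lemma klExt_nUnit (G : Psh C) : klExt V (nUnit V G) = 𝟙 _ := by
  refine klFree_hom_ext ?_
  rw [klGen_klExt]
  rfl

variable (V)

/-- The action of the Kleisli category on parallel splits. -/
def parMap {A A' B B' : Kl V} (x : A ⟶ A') (y : B ⟶ B') :
    klFree V ((V.par.tensor.obj A.of).obj B.of) ⟶ klFree V ((V.par.tensor.obj A'.of).obj B'.of) :=
  klExt V (ins V.par.tensor (F := normHom V A'.of) (G := normHom V B'.of) x y ≫
    parMul V A'.of B'.of)

lemma ins_normId {A A' B B' : C} (f : A ⟶ A') (g : B ⟶ B') :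
    ins V.par.tensor ((normId V A').app (op A) f) ((normId V B').app (op B) g) ≫ parMul V A' B' =
    (V.par.tensor.map f).app B ≫ (V.par.tensor.obj A').map g ≫ nUnit V _ := by
  rw [normId_eq, normId_eq, ← ins_convMap, Category.assoc, nUnit_parMul, ← Category.assoc,
    ins_convYo, Category.assoc]

/-- Bilinearity of `nPair`: extending both factors linearly and then multiplying is the same as
multiplying and then extending linearly. -/
lemma parMap_comp {A A' A'' B B' B'' : Kl V} (x : A ⟶ A') (x' : A' ⟶ A'') (y : B ⟶ B')
    (y' : B' ⟶ B'') : parMap V (x ≫ x') (y ≫ y') = parMap V x y ≫ parMap V x' y' := by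
  have h : ins V.par.tensor (F := normHom V A''.of) (G := normHom V B''.of) (x ≫ x')
      (y ≫ y') = ins V.par.tensor (F := normHom V A'.of) (G := normHom V B'.of) x y ≫
        convMap V.par.tensor (nLift V (nAct V _) (elt (F := normHom V A''.of) x'))
          (nLift V (nAct V _) (elt (F := normHom V B''.of) y')) := by
    rw [ins_convMap]
    rfl
  rw [parMap, parMap, parMap, klExt_klExt, Category.assoc, nLift_ins, parMul.eq_1 V A''.of,
    ← Category.assoc (convMap _ _ _) (nPair _ _ _), ← nLift_comp _ (nLinear_convMap V _),
    ← reassoc_of% (NBilinear.convMap_nLift (nBilinear_nPair V _ _) (nAction_nAct V _)), h,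
    Category.assoc]

/-- The parallel splits of the Kleisli category. -/
def parK : Split (Kl V) :=
  Split.mk (fun A B => klFree V ((V.par.tensor.obj A.of).obj B.of)) (fun x y => parMap V x y)
    (fun A B => by
      have h := ins_normId V (𝟙 A.of) (𝟙 B.of)
      rw [CategoryTheory.Functor.map_id, CategoryTheory.Functor.map_id] at h
      exact (congrArg (klExt V) (h.trans ((Category.id_comp _).trans (Category.id_comp _)))).trans
        (klExt_nUnit _))
    (fun x x' y y' => parMap_comp V x x' y y')

lemma parK_map {A A' B B' : Kl V} (x : A ⟶ A') (y : B ⟶ B') :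
    ((parK V).map x).app B ≫ ((parK V).obj A').map y = parMap V x y := by
  change parMap V x (𝟙 B) ≫ parMap V (𝟙 A') y = _
  rw [← parMap_comp, Category.id_comp, Category.comp_id]

lemma klGen_normId {A A' B B' : C} (f : A ⟶ A') (g : B ⟶ B') :
    (V.par.tensor.map f).app B ≫ (V.par.tensor.obj A').map g ≫ klGen V _ =
      klGen V _ ≫ Functor.whiskerLeft (klFunctor V).op (klExt V (ins V.par.tensor
        ((normId V A').app (op A) f) ((normId V B').app (op B) g) ≫ parMul V A' B')) := by
  rw [klGen_klExt, ins_normId, Category.assoc, Category.assoc, klGen]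

/-- The canonical map from the parallel splits of `V` to those of the Kleisli category. -/
def parEta : SplitMap (klFunctor V) V.par.tensor (parK V) where
  app A B := klGen V ((V.par.tensor.obj A).obj B)
  natural {A _ B _} f g := (klGen_normId V f g).trans (congrArg (fun t =>
    klGen V ((V.par.tensor.obj A).obj B) ≫ Functor.whiskerLeft (klFunctor V).op t)
      (parK_map V ((klFunctor V).map f) ((klFunctor V).map g)).symm)

/-- On representables of `Kl V`, and after Yoneda reduction, the map induced by `η` on convolutions
is the product of free modules. Bilinearity of `parQ` is inherited from `parMul` through this
identity. -/
lemma convOver_homRes (A B : C) :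
    convOver (parEta V) (homRes V A) (homRes V B) ≫
        Functor.whiskerLeft (klFunctor V).op
          (convYo (parK V) ((klFunctor V).obj A) ((klFunctor V).obj B)) =
      parMul V A B ≫ freeRes V _ := by
  ext X Y x y : 1
  refine .trans ?_ ((congrArg (fun t => klGen V ((V.par.tensor.obj X).obj Y) ≫
    Functor.whiskerLeft (klFunctor V).op t) (parK_map V (Kl.hom x) (Kl.hom y))).trans
      (klGen_klExt _))
  rfl

end ParallelSplit

/-! ### Parallel convolution on the Kleisli category as a tensor product of modules. -/

section ParallelDesc

variable {C : Type u} [SmallCategory C] {V : SymProduoidalCat C}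

/-- The laws can be tested after jointly surjective maps, and scalars pass through `f` and `g`
because these are linear. -/
lemma nBilinear_of_jointlySurjective {M₁ M₂ M₃ : Psh C}
    {a₁ : conv V.par.tensor V.seq.unit M₁ ⟶ M₁} {a₂ : conv V.par.tensor V.seq.unit M₂ ⟶ M₂}
    {a₃ : conv V.par.tensor V.seq.unit M₃ ⟶ M₃} {b : conv V.par.tensor M₁ M₂ ⟶ M₃}
    {p : ∀ S : Psh C, (S ⟶ M₁) → Prop} {q : ∀ S : Psh C, (S ⟶ M₂) → Prop}
    (hp : JointlySurjective p) (hq : JointlySurjective q)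
    (h : ∀ S (f : S ⟶ M₁) T (g : T ⟶ M₂), p S f → q T g → ∃ a a', NLinear V a a₁ f ∧
      NLinear V a' a₂ g ∧ NBilinear V a a' a₃ (convMap V.par.tensor f g ≫ b)) :
    NBilinear V a₁ a₂ a₃ b := by
  refine nBilinear_of ?_ ?_
  · refine (((jointlySurjective_id _).conv hp).conv hq).hom_ext ?_
    rintro _ _ ⟨f', g, ⟨_, f, ⟨⟩, hf⟩, hg⟩
    obtain ⟨a, a', ha, ha', hb⟩ := h _ f _ g hf hg
    have h1 := hb.left
    unfold NLinear at ha
    rw [← Category.assoc, ← convMap_comp, ← ha, reassoc_of% (V.par.assocExt_natural (𝟙 _) f g),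
      ← Category.assoc (convMap _ _ (convMap _ _ _)), ← convMap_comp, Category.id_comp, ← h1,
      ← Category.assoc (convMap _ a _), ← convMap_comp, Category.id_comp, Category.comp_id]
  · refine (hp.conv ((jointlySurjective_id _).conv hq)).hom_ext ?_
    rintro _ _ ⟨f, g', hf, ⟨_, g, ⟨⟩, hg⟩⟩
    obtain ⟨a, a', ha, ha', hb⟩ := h _ f _ g hf hg
    have h1 := hb.right
    unfold NLinear at ha'
    rw [← Category.assoc, ← convMap_comp, ← ha', reassoc_of% (nSwap_natural V f g),
      ← Category.assoc (convMap _ _ (convMap _ _ _)), ← convMap_comp, Category.id_comp, ← h1,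
      ← Category.assoc (convMap _ _ a'), ← convMap_comp, Category.id_comp, Category.comp_id]

/-- The family of all linear extensions of elements. -/
inductive IsResElt (F : Psh (Kl V)) : ∀ S : Psh C, (S ⟶ (klFunctor V).op ⋙ F) → Prop
  | mk {A : C} (x : ((klFunctor V).op ⋙ F).obj (op A)) : IsResElt F (normHom V A) (resElt x)

lemma nUnit_resElt {F : Psh (Kl V)} {A : C} (x : ((klFunctor V).op ⋙ F).obj (op A)) :
    nUnit V (yo A) ≫ resElt x = elt x := by
  rw [← resAct_elt]
  exact nUnit_nLift (nAction_resAct F) _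

lemma resElt_linear {F : Psh (Kl V)} {A : C} (x : ((klFunctor V).op ⋙ F).obj (op A)) :
    NLinear V (nAct V (yo A)) (resAct F) (resElt x) := by
  rw [← resAct_elt]
  exact nLift_linear (nAction_resAct F) _

/-- Each `x` is the value of its linear extension at the unit generator. Every module is thus
covered by linear maps from free modules on representables. -/
lemma jointlySurjective_isResElt (F : Psh (Kl V)) : JointlySurjective (IsResElt F) := by
  intro A x
  refine ⟨_, resElt (B := A.unop) x, (nUnit V (yo A.unop)).app A (𝟙 A.unop), .mk _, ?_⟩
  have h := congrArg (fun k => k.app A (𝟙 A.unop)) (nUnit_resElt (A := A.unop) x)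
  exact h.trans (elt_app_id (A := A.unop) x)

/-- The universal bilinear map. -/
abbrev parQ (F G : Psh (Kl V)) : conv V.par.tensor ((klFunctor V).op ⋙ F) ((klFunctor V).op ⋙ G) ⟶
    (klFunctor V).op ⋙ conv (parK V) F G :=
  convOver (parEta V) (𝟙 ((klFunctor V).op ⋙ F)) (𝟙 ((klFunctor V).op ⋙ G))

lemma convMap_parQ {F G : Psh (Kl V)} {H K : Psh C} (f : H ⟶ (klFunctor V).op ⋙ F)
    (g : K ⟶ (klFunctor V).op ⋙ G) :
    convMap V.par.tensor f g ≫ parQ F G = convOver (parEta V) f g := by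
  rw [parQ, convMap_convOver, Category.comp_id, Category.comp_id]

variable (V) in
lemma nBilinear_parMul (A B : C) :
    NBilinear V (nAct V (yo A)) (nAct V (yo B)) (nAct V _) (parMul V A B) :=
  (nBilinear_nPair V _ _).comp (nLinear_convMap V _)

lemma NBilinear.of_comp_iso {M₁ M₂ : Psh C} {Z Z' : Psh (Kl V)}
    {a₁ : conv V.par.tensor V.seq.unit M₁ ⟶ M₁} {a₂ : conv V.par.tensor V.seq.unit M₂ ⟶ M₂}
    {b : conv V.par.tensor M₁ M₂ ⟶ (klFunctor V).op ⋙ Z} (e : Z ≅ Z')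
    (h : NBilinear V a₁ a₂ (resAct Z') (b ≫ Functor.whiskerLeft (klFunctor V).op e.hom)) :
    NBilinear V a₁ a₂ (resAct Z) b := by
  have h' := h.comp (whiskerLeft_linear e.inv)
  rwa [Category.assoc, ← Functor.whiskerLeft_comp, e.hom_inv_id, Functor.whiskerLeft_id',
    Category.comp_id] at h'

variable (V) in
lemma nBilinear_convOver_homRes (A B : C) :
    NBilinear V (nAct V (yo A)) (nAct V (yo B)) (resAct _)
      (convOver (parEta V) (homRes V A) (homRes V B)) := by
  refine NBilinear.of_comp_iso
    (convYoIso (parK V) ((klFunctor V).obj A) ((klFunctor V).obj B)) ?_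
  have h := (nBilinear_parMul V A B).comp (freeRes_linear V _)
  rw [← convOver_homRes] at h
  exact h

/-- Covering both modules by free modules on representables reduces the claim to `convOver (parEta
V)` of `homRes`, where it is bilinearity of `parMul`. -/
lemma nBilinear_parQ (F G : Psh (Kl V)) :
    NBilinear V (resAct F) (resAct G) (resAct (conv (parK V) F G)) (parQ F G) := by
  refine nBilinear_of_jointlySurjective (jointlySurjective_isResElt F)
    (jointlySurjective_isResElt G) ?_
  rintro _ _ _ _ ⟨x⟩ ⟨y⟩
  refine ⟨_, _, resElt_linear x, resElt_linear y, ?_⟩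
  rw [convMap_parQ, resElt, resElt, ← convOver_convMap]
  exact (nBilinear_convOver_homRes V _ _).comp (whiskerLeft_linear _)

/-- The dinaturality required by the coend in `parDesc`, now for all Kleisli morphisms; bilinearity
of `b` is precisely what allows the scalars in `x` and `y` to be moved onto `f` and `g`. -/
lemma klExt_ins_freeDesc {F G Z : Psh (Kl V)}
    {b : conv V.par.tensor ((klFunctor V).op ⋙ F) ((klFunctor V).op ⋙ G) ⟶ (klFunctor V).op ⋙ Z}
    (hb : NBilinear V (resAct F) (resAct G) (resAct Z) b) {A A' B B' : C}
    (x : (normHom V A').obj (op A)) (y : (normHom V B').obj (op B))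
    (f : ((klFunctor V).op ⋙ F).obj (op A')) (g : ((klFunctor V).op ⋙ G).obj (op B')) :
    klExt V (ins V.par.tensor x y ≫ parMul V A' B') ≫ freeDesc (ins V.par.tensor f g ≫ b) =
      freeDesc (ins V.par.tensor ((resElt f).app (op A) x) ((resElt g).app (op B) y) ≫ b) := by
  rw [klExt_freeDesc, Category.assoc, nLift_ins, ← hb.convMap_nLift (nAction_resAct Z),
    ← Category.assoc, ins_convMap, nLift, nLift, resAct_elt, resAct_elt]

/-- A bilinear map is a morphism out of the convolution on the Kleisli category. -/
def parDesc {F G Z : Psh (Kl V)}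
    (b : conv V.par.tensor ((klFunctor V).op ⋙ F) ((klFunctor V).op ⋙ G) ⟶ (klFunctor V).op ⋙ Z)
    (hb : NBilinear V (resAct F) (resAct G) (resAct Z) b) : conv (parK V) F G ⟶ Z :=
  convDesc (fun X Y f g => freeDesc (ins V.par.tensor (F := (klFunctor V).op ⋙ F)
      (G := (klFunctor V).op ⋙ G) (X := X.of) (Y := Y.of) f g ≫ b)) (by
    intro X X' Y Y' x y f g
    refine (Category.assoc _ _ _).symm.trans ((congrArg (fun t : (klFree V ((V.par.tensor.obj
      X.of).obj Y.of)) ⟶ (klFree V ((V.par.tensor.obj X'.of).obj Y'.of)) => t ≫ freeDesc (ins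
        V.par.tensor (F := (klFunctor V).op ⋙ F) (G := (klFunctor V).op ⋙ G) (X := X'.of)
          (Y := Y'.of) f g ≫ b)) (parK_map V x y)).trans ?_)
    exact klExt_ins_freeDesc hb (A := X.of) (A' := X'.of) (B := Y.of) (B' := Y'.of) x y f g)

lemma parQ_parDesc {F G Z : Psh (Kl V)}
    (b : conv V.par.tensor ((klFunctor V).op ⋙ F) ((klFunctor V).op ⋙ G) ⟶ (klFunctor V).op ⋙ Z)
    (hb : NBilinear V (resAct F) (resAct G) (resAct Z) b) :
    parQ F G ≫ Functor.whiskerLeft (klFunctor V).op (parDesc b hb) = b := by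
  ext X Y x y : 1
  exact klGen_freeDesc (ins V.par.tensor x y ≫ b)

lemma convOver_parDesc {F G Z : Psh (Kl V)}
    (b : conv V.par.tensor ((klFunctor V).op ⋙ F) ((klFunctor V).op ⋙ G) ⟶ (klFunctor V).op ⋙ Z)
    (hb : NBilinear V (resAct F) (resAct G) (resAct Z) b) {H K : Psh C}
    (f : H ⟶ (klFunctor V).op ⋙ F) (g : K ⟶ (klFunctor V).op ⋙ G) :
    convOver (parEta V) f g ≫ Functor.whiskerLeft (klFunctor V).op (parDesc b hb) =
      convMap V.par.tensor f g ≫ b := by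
  rw [← convMap_parQ, Category.assoc, parQ_parDesc]

/-- Dinaturality moves the Kleisli morphisms attached to `x` and `y` into the split, which is itself
generated by a split of `V` since it is a free presheaf. -/
lemma Generates.par {G H : Psh C} {F K : Psh (Kl V)} {g : G ⟶ (klFunctor V).op ⋙ F}
    {h : H ⟶ (klFunctor V).op ⋙ K} (hg : Generates g) (hh : Generates h) :
    Generates (convOver (parEta V) g h) := by
  intro A e
  induction e using conv_ind with | h X Y t x y =>
  obtain ⟨B, m, x, rfl⟩ := hg X x
  obtain ⟨B', m', y, rfl⟩ := hh Y y
  rw [← cmk_din]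
  obtain ⟨D, k, s, hs⟩ := generates_klGen _ A ((((parK V).obj ((klFunctor V).obj B)).map m').app
    (op A) ((((parK V).map m).app Y).app (op A) t))
  refine ⟨D, k, cmk s x y, ?_⟩
  rw [← hs]
  rfl

end ParallelDesc

/-! ### Parallel associator, unitors and symmetry on the Kleisli category. -/

section ParallelStructure

variable {C : Type u} [SmallCategory C] {V : SymProduoidalCat C}

lemma yonedaMap_eq (B : C) : yonedaMap (klFunctor V) B = nUnit V (yo B) ≫ homRes V B := by
  rw [← normId_eq]
  rfl

/-- Functoriality of `klFree`. -/
def klMap {G H : Psh C} (f : G ⟶ H) : klFree V G ⟶ klFree V H := klExt V (f ≫ nUnit V H)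

lemma klGen_klMap {G H : Psh C} (f : G ⟶ H) :
    klGen V G ≫ Functor.whiskerLeft (klFunctor V).op (klMap f) = f ≫ klGen V H := by
  rw [klMap, klGen_klExt, Category.assoc, klGen]

lemma freeRes_klMap {G H : Psh C} (f : G ⟶ H) :
    freeRes V G ≫ Functor.whiskerLeft (klFunctor V).op (klMap f) =
      convMap V.par.tensor (𝟙 V.seq.unit) f ≫ freeRes V H := by
  rw [klMap, freeRes_klExt, nLift_comp_nUnit]

/-- Functoriality of `klFree`. -/
@[simps] def klMapIso {G H : Psh C} (e : G ≅ H) : klFree V G ≅ klFree V H where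
  hom := klMap e.hom
  inv := klMap e.inv
  hom_inv_id := klFree_hom_ext (by
    rw [Functor.whiskerLeft_comp, reassoc_of% (klGen_klMap e.hom), klGen_klMap,
      e.hom_inv_id_assoc, Functor.whiskerLeft_id', Category.comp_id])
  inv_hom_id := klFree_hom_ext (by
    rw [Functor.whiskerLeft_comp, reassoc_of% (klGen_klMap e.inv), klGen_klMap,
      e.inv_hom_id_assoc, Functor.whiskerLeft_id', Category.comp_id])

/-- Functoriality of convolution. -/
@[simps] def convMapIso (P : Split C) {F F' G G' : Psh C} (e : F ≅ F') (e' : G ≅ G') :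
    conv P F G ≅ conv P F' G' where
  hom := convMap P e.hom e'.hom
  inv := convMap P e.inv e'.inv
  hom_inv_id := by rw [← convMap_comp, e.hom_inv_id, e'.hom_inv_id, convMap_id]
  inv_hom_id := by rw [← convMap_comp, e.inv_hom_id, e'.inv_hom_id, convMap_id]

lemma freeResInv_linear (G : Psh C) :
    NLinear V (resAct (klFree V G)) (nAct V G) (freeResInv V G) := by
  have h := freeRes_linear V G
  unfold NLinear at h ⊢
  have e : freeResInv V G ≫ freeRes V G = 𝟙 _ := rfl
  have e' : freeRes V G ≫ freeResInv V G = 𝟙 _ := rfl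
  have h2 := convMap V.par.tensor (𝟙 V.seq.unit) (freeResInv V G) ≫= (h =≫ freeResInv V G)
  rw [Category.assoc, Category.assoc, e', Category.comp_id, ← Category.assoc (convMap _ _ _)
    (convMap _ _ _), ← convMap_comp, e, Category.id_comp, convMap_id, Category.id_comp] at h2
  exact h2.symm

variable (V) in
/-- The bilinear product on free presheaves. -/
def freeMul (G H : Psh C) : conv V.par.tensor ((klFunctor V).op ⋙ klFree V G)
    ((klFunctor V).op ⋙ klFree V H) ⟶ (klFunctor V).op ⋙ klFree V (conv V.par.tensor G H) :=
  convMap V.par.tensor (freeResInv V G) (freeResInv V H) ≫ nPair V G H ≫ freeRes V _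

lemma nBilinear_freeMul (G H : Psh C) :
    NBilinear V (resAct _) (resAct _) (resAct _) (freeMul V G H) :=
  ((nBilinear_nPair V G H).comp (freeRes_linear V _)).precomp (freeResInv_linear G)
    (freeResInv_linear H)

lemma freeRes_freeMul (G H : Psh C) :
    convMap V.par.tensor (freeRes V G) (freeRes V H) ≫ freeMul V G H =
      nPair V G H ≫ freeRes V _ := by
  have e : ∀ G, freeRes V G ≫ freeResInv V G = 𝟙 _ := fun _ => rfl
  rw [freeMul, ← Category.assoc, ← convMap_comp, e, e, convMap_id, Category.id_comp]

lemma klGen_freeMul (G H : Psh C) :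
    convMap V.par.tensor (klGen V G) (klGen V H) ≫ freeMul V G H = klGen V _ := by
  rw [klGen, klGen, convMap_comp, Category.assoc, freeRes_freeMul,
    reassoc_of% (nUnit_nPair V G H), klGen]

variable (V) in
/-- Convolution of free presheaves. -/
def freeConv (G H : Psh C) :
    conv (parK V) (klFree V G) (klFree V H) ≅ klFree V (conv V.par.tensor G H) where
  hom := parDesc (freeMul V G H) (nBilinear_freeMul G H)
  inv := freeDesc (convOver (parEta V) (klGen V G) (klGen V H))
  hom_inv_id := ((generates_klGen G).par (generates_klGen H)).hom_ext (by
    rw [Functor.whiskerLeft_comp, ← Category.assoc, convOver_parDesc, klGen_freeMul,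
      klGen_freeDesc, Functor.whiskerLeft_id', Category.comp_id])
  inv_hom_id := klFree_hom_ext (by
    rw [Functor.whiskerLeft_comp, ← Category.assoc, klGen_freeDesc, convOver_parDesc,
      klGen_freeMul, Functor.whiskerLeft_id', Category.comp_id])

lemma freeRes_freeConv (G H : Psh C) : convOver (parEta V) (freeRes V G) (freeRes V H) ≫
    Functor.whiskerLeft (klFunctor V).op (freeConv V G H).hom = nPair V G H ≫ freeRes V _ := by
  rw [freeConv, convOver_parDesc, freeRes_freeMul]

lemma freeRes_freeConv_inv (G H : Psh C) : nPair V G H ≫ freeRes V _ ≫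
    Functor.whiskerLeft (klFunctor V).op (freeConv V G H).inv =
      convOver (parEta V) (freeRes V G) (freeRes V H) := by
  rw [← Category.assoc, ← freeRes_freeConv, Category.assoc, ← Functor.whiskerLeft_comp,
    Iso.hom_inv_id, Functor.whiskerLeft_id', Category.comp_id]

variable (V) in
/-- The associator on free presheaves. -/
def freeAssoc (G H K : Psh C) :
    conv (parK V) (conv (parK V) (klFree V G) (klFree V H)) (klFree V K) ≅
      conv (parK V) (klFree V G) (conv (parK V) (klFree V H) (klFree V K)) :=
  convMapIso _ (freeConv V G H) (Iso.refl _) ≪≫ freeConv V _ K ≪≫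
    klMapIso (V.par.assocIso G H K) ≪≫ (freeConv V G _).symm ≪≫
      convMapIso _ (Iso.refl _) (freeConv V H K).symm

/-- Each `freeConv` turns the map on convolutions into the product `nPair`; what remains is the
associativity of that product. -/
lemma freeRes_freeAssoc (G H K : Psh C) :
    convOver (parEta V) (convOver (parEta V) (freeRes V G) (freeRes V H)) (freeRes V K) ≫
        Functor.whiskerLeft (klFunctor V).op (freeAssoc V G H K).hom =
      V.par.assocExt _ _ _ ≫ convOver (parEta V) (freeRes V G)
        (convOver (parEta V) (freeRes V H) (freeRes V K)) := by
  simp only [freeAssoc, Iso.trans_hom, Functor.whiskerLeft_comp, convMapIso_hom, Iso.refl_hom,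
    Iso.symm_hom, klMapIso_hom, PromonoidalData.assocIso_hom]
  have e1 : convOver (parEta V) (convOver (parEta V) (freeRes V G) (freeRes V H)) (freeRes V K) ≫
      Functor.whiskerLeft (klFunctor V).op (convMap _ (freeConv V G H).hom (𝟙 _)) =
      convMap V.par.tensor (nPair V G H) (𝟙 _) ≫
        convOver (parEta V) (freeRes V _) (freeRes V K) := by
    rw [convOver_convMap, freeRes_freeConv, convMap_convOver, Functor.whiskerLeft_id',
      Category.comp_id, Category.id_comp]
  have e2 : convOver (parEta V) (freeRes V G) (freeRes V (conv V.par.tensor H K)) ≫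
      Functor.whiskerLeft (klFunctor V).op (convMap _ (𝟙 _) (freeConv V H K).inv) =
      convOver (parEta V) (freeRes V G) (freeRes V (conv V.par.tensor H K) ≫
        Functor.whiskerLeft (klFunctor V).op (freeConv V H K).inv) := by
    rw [convOver_convMap, Functor.whiskerLeft_id', Category.comp_id]
  rw [reassoc_of% e1, reassoc_of% (freeRes_freeConv (V := V) (conv V.par.tensor G H) K),
    reassoc_of% (freeRes_klMap (V := V) (V.par.assocExt G H K)),
    reassoc_of% (nPair_assoc V G H K),
    reassoc_of% (freeRes_freeConv_inv (V := V) G (conv V.par.tensor H K)), e2,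
    convMap_convOver, freeRes_freeConv_inv, Category.id_comp]

lemma generators_freeAssoc {G H K G' H' K' : Psh C}
    (f : G ⟶ conv V.par.tensor V.seq.unit G') (g : H ⟶ conv V.par.tensor V.seq.unit H')
    (h : K ⟶ conv V.par.tensor V.seq.unit K') :
    convOver (parEta V) (convOver (parEta V) (f ≫ freeRes V G') (g ≫ freeRes V H'))
        (h ≫ freeRes V K') ≫
        Functor.whiskerLeft (klFunctor V).op (freeAssoc V G' H' K').hom =
      V.par.assocExt _ _ _ ≫ convOver (parEta V) (f ≫ freeRes V G')
        (convOver (parEta V) (g ≫ freeRes V H') (h ≫ freeRes V K')) := by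
  simp only [← convMap_convOver]
  rw [Category.assoc, freeRes_freeAssoc, reassoc_of% (V.par.assocExt_natural f g h)]

/-- Maps of free presheaves need not be induced from maps of presheaves on `V`. On generators,
however, each is a map `G ⟶ V(•; N ⊗ G')`, and `generators_freeAssoc` allows such maps. -/
lemma freeAssoc_natural {G H K G' H' K' : Psh C} (f : klFree V G ⟶ klFree V G')
    (g : klFree V H ⟶ klFree V H') (h : klFree V K ⟶ klFree V K') :
    convMap (parK V) (convMap (parK V) f g) h ≫ (freeAssoc V G' H' K').hom =
      (freeAssoc V G H K).hom ≫ convMap (parK V) f (convMap (parK V) g h) := by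
  refine (((generates_klGen G).par (generates_klGen H)).par (generates_klGen K)).hom_ext ?_
  have e : ∀ {G G' : Psh C} (f : klFree V G ⟶ klFree V G'),
      klGen V G ≫ Functor.whiskerLeft (klFunctor V).op f = (klGen V G ≫
        Functor.whiskerLeft (klFunctor V).op f ≫ freeResInv V G') ≫ freeRes V G' :=
    fun _ => rfl
  have h1 := generators_freeAssoc (nUnit V G) (nUnit V H) (nUnit V K)
  rw [Functor.whiskerLeft_comp, Functor.whiskerLeft_comp, ← Category.assoc, convOver_convMap,
    convOver_convMap, e f, e g, e h, generators_freeAssoc]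
  rw [← klGen, ← klGen, ← klGen] at h1
  rw [reassoc_of% h1, convOver_convMap, convOver_convMap, ← e f, ← e g, ← e h]

lemma nUnit_inv {M : Psh C} {a : conv V.par.tensor V.seq.unit M ⟶ M} (h : NAction V a) :
    convMap V.par.tensor V.phi0 (𝟙 M) ≫ a = V.par.leftExt M := by
  have h1 := V.par.leftExt M ≫= h.unit
  rwa [nUnit, Category.assoc, Category.comp_id, ← V.par.leftIso_hom, ← V.par.leftIso_inv,
    Iso.hom_inv_id_assoc] at h1

variable (V) in
/-- The unit of the Kleisli category. -/
abbrev unitK : Psh (Kl V) := (unitModule V).toPsh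

variable (V) in
/-- The map from the sequential unit. -/
def seqUnitEta : V.seq.unit ⟶ (klFunctor V).op ⋙ unitK V := (unitModule V).res

variable (V) in
/-- The inverse of `seqUnitEta`. -/
def seqUnitEtaInv : (klFunctor V).op ⋙ unitK V ⟶ V.seq.unit := (unitModule V).resInv

variable (V) in
/-- The map from the parallel unit. -/
def parUnitEta : V.par.unit ⟶ (klFunctor V).op ⋙ unitK V := V.phi0 ≫ seqUnitEta V

lemma seqUnitEtaInv_linear :
    NLinear V (resAct (unitK V)) V.phi2 (seqUnitEtaInv V) := by
  have h := (unitModule V).res_linear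
  unfold NLinear at h ⊢
  have e : seqUnitEtaInv V ≫ seqUnitEta V = 𝟙 _ := rfl
  have e' : seqUnitEta V ≫ seqUnitEtaInv V = 𝟙 _ := rfl
  have h2 := convMap V.par.tensor (𝟙 V.seq.unit) (seqUnitEtaInv V) ≫= (h =≫ seqUnitEtaInv V)
  change _ ≫ (V.phi2 ≫ seqUnitEta V) ≫ _ = _ ≫ (convMap _ (𝟙 _) (seqUnitEta V) ≫ _) ≫ _ at h2
  rw [Category.assoc, Category.assoc, e', Category.comp_id, ← Category.assoc (convMap _ _ _)
    (convMap _ _ _), ← convMap_comp, e, Category.id_comp, convMap_id, Category.id_comp] at h2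
  exact h2.symm

/-- By the right unit law of `N`, every scalar is of the form `n · φ₀(i)`. So although the unit of
`Kl V` is `N`, maps out of it are determined on `I`, where the axioms of `V` for the parallel unit
live. -/
lemma generates_parUnitEta : Generates (parUnitEta V) := by
  intro A z
  have h1 : V.par.rightInvExt V.seq.unit ≫ convMap V.par.tensor (𝟙 V.seq.unit) V.phi0 ≫ V.phi2 =
      𝟙 _ := by
    rw [V.phi2_right, ← V.par.rightIso_hom, ← V.par.rightIso_inv, Iso.inv_hom_id]
  obtain ⟨w, hw⟩ : ∃ w : (conv V.par.tensor V.seq.unit V.par.unit).obj (op A.of),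
      (convMap V.par.tensor (𝟙 V.seq.unit) V.phi0 ≫ V.phi2).app (op A.of) w = z :=
    ⟨(V.par.rightInvExt V.seq.unit).app (op A.of) z,
      congrArg (fun k => k.app (op A.of) z) h1⟩
  induction w using conv_ind with | h X Y s n i =>
  refine ⟨Y, (cmk s n (𝟙 Y) : (normHom V Y).obj (op A.of)), i, ?_⟩
  refine Eq.trans ?_ hw
  change (V.phi2.app _) (cmk s n _) = (V.phi2.app _) (cmk s n _)
  refine congrArg (fun k => (V.phi2.app (op A.of)) (cmk s n k)) ?_
  exact elt_app_id (F := V.seq.unit) (A := Y) (V.phi0.app (op Y) i)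

variable (V) in
/-- The left unitor at a presheaf. -/
def unitAct (F : Psh (Kl V)) : conv V.par.tensor ((klFunctor V).op ⋙ unitK V)
    ((klFunctor V).op ⋙ F) ⟶ (klFunctor V).op ⋙ F :=
  convMap V.par.tensor (seqUnitEtaInv V) (𝟙 _) ≫ resAct F

lemma nBilinear_unitAct (F : Psh (Kl V)) :
    NBilinear V (resAct _) (resAct _) (resAct _) (unitAct V F) :=
  (nAction_resAct F).nBilinear.precomp seqUnitEtaInv_linear (by
    unfold NLinear; rw [Category.comp_id, convMap_id, Category.id_comp])

variable (V) in
/-- The left unitor at a presheaf. -/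
def klLeft (F : Psh (Kl V)) : conv (parK V) (unitK V) F ⟶ F :=
  parDesc (unitAct V F) (nBilinear_unitAct F)

lemma seqUnitEta_klLeft {F : Psh (Kl V)} {G : Psh C} (g : G ⟶ (klFunctor V).op ⋙ F) :
    convOver (parEta V) (seqUnitEta V) g ≫ Functor.whiskerLeft (klFunctor V).op (klLeft V F) =
      nLift V (resAct F) g := by
  have e' : seqUnitEta V ≫ seqUnitEtaInv V = 𝟙 _ := rfl
  rw [klLeft, convOver_parDesc, unitAct, ← Category.assoc, ← convMap_comp, e', Category.comp_id,
    nLift]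

/-- Scalars in the image of `φ₀` act by the left unitor (`nUnit_inv`), so the action of `N`
restricts along `φ₀` to the unitor of `V`. -/
lemma parUnitEta_klLeft {F : Psh (Kl V)} {G : Psh C} (g : G ⟶ (klFunctor V).op ⋙ F) :
    convOver (parEta V) (parUnitEta V) g ≫ Functor.whiskerLeft (klFunctor V).op (klLeft V F) =
      V.par.leftExt G ≫ g := by
  have h : convOver (parEta V) (parUnitEta V) g = convMap V.par.tensor V.phi0 g ≫
      convOver (parEta V) (seqUnitEta V) (𝟙 _) := by
    rw [convMap_convOver, Category.comp_id]
    rfl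
  rw [h, Category.assoc, seqUnitEta_klLeft, nLift, convMap_id, Category.id_comp,
    ← V.par.leftExt_natural, ← nUnit_inv (nAction_resAct F), ← Category.assoc, ← convMap_comp,
    Category.id_comp, Category.comp_id]

lemma klLeft_natural {F G : Psh (Kl V)} (f : F ⟶ G) :
    convMap (parK V) (𝟙 (unitK V)) f ≫ klLeft V G = klLeft V F ≫ f := by
  refine (generates_parUnitEta.par (generates_id F)).hom_ext ?_
  rw [Functor.whiskerLeft_comp, Functor.whiskerLeft_comp, ← Category.assoc, convOver_convMap,
    Functor.whiskerLeft_id', Category.comp_id, Category.id_comp, parUnitEta_klLeft,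
    reassoc_of% (parUnitEta_klLeft (𝟙 ((klFunctor V).op ⋙ F)))]

variable (V) in
/-- The left unitor on free presheaves. -/
def freeLeft (G : Psh C) : conv (parK V) (unitK V) (klFree V G) ≅ klFree V G where
  hom := klLeft V _
  inv := freeDesc (V.par.leftInvExt G ≫ convOver (parEta V) (parUnitEta V) (klGen V G))
  hom_inv_id := (generates_parUnitEta.par (generates_klGen G)).hom_ext (by
    rw [Functor.whiskerLeft_comp, reassoc_of% (parUnitEta_klLeft (klGen V G)), klGen_freeDesc,
      ← V.par.leftIso_hom, ← V.par.leftIso_inv, Iso.hom_inv_id_assoc, Functor.whiskerLeft_id',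
      Category.comp_id])
  inv_hom_id := klFree_hom_ext (by
    rw [Functor.whiskerLeft_comp, ← Category.assoc, klGen_freeDesc, Category.assoc,
      parUnitEta_klLeft, ← V.par.leftIso_hom, ← V.par.leftIso_inv, Iso.inv_hom_id_assoc,
      Functor.whiskerLeft_id', Category.comp_id])

/-- Naturality of the symmetry in Kleisli morphisms rests on `nPair_sym`, that is, on commutativity
of `N`. -/
lemma klExt_ins_klMap {A A' B B' : C} (x : (normHom V A').obj (op A))
    (y : (normHom V B').obj (op B)) :
    klExt V (ins V.par.tensor x y ≫ parMul V A' B') ≫ klMap (V.sym.app A' B') =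
      klMap (V.sym.app A B) ≫ klExt V (ins V.par.tensor y x ≫ parMul V B' A') := by
  have h1 : parMul V A' B' ≫ convMap V.par.tensor (𝟙 V.seq.unit) (V.sym.app A' B') =
      V.sym.ext _ _ ≫ parMul V B' A' := by
    have h2 : convYo V.par.tensor A' B' ≫ V.sym.app A' B' =
        V.sym.ext _ _ ≫ convYo V.par.tensor B' A' := by
      ext X Y f g : 1
      have h3 := V.sym.natural f g
      exact (Category.assoc _ _ _).trans h3
    rw [parMul, Category.assoc, ← convMap_comp, h2, Category.id_comp, parMul,
      ← reassoc_of% (nPair_sym V (yo A') (yo B')), ← convMap_comp, Category.id_comp]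
  refine klFree_hom_ext ?_
  rw [Functor.whiskerLeft_comp, Functor.whiskerLeft_comp, reassoc_of% (klGen_klExt (ins
    V.par.tensor x y ≫ parMul V A' B')), freeRes_klMap, reassoc_of% (klGen_klMap (V := V)
    (V.sym.app A B)), klGen_klExt, Category.assoc, reassoc_of% h1]
  rfl

variable (V) in
/-- The symmetry of the Kleisli category. -/
def klSym : Symmetry (parK V) where
  app A B := klMap (V.sym.app A.of B.of)
  natural {A A' B B'} x y := by
    have h := klExt_ins_klMap (V := V) (A := A.of) (A' := A'.of) (B := B.of) (B' := B'.of) x y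
    refine (Category.assoc _ _ _).symm.trans ((congrArg (fun t : (klFree V ((V.par.tensor.obj
      A.of).obj B.of)) ⟶ (klFree V ((V.par.tensor.obj A'.of).obj B'.of)) => t ≫
        klMap (V.sym.app A'.of B'.of)) (parK_map V x y)).trans (h.trans ?_))
    exact (congrArg (fun t : (klFree V ((V.par.tensor.obj B.of).obj A.of)) ⟶
      (klFree V ((V.par.tensor.obj B'.of).obj A'.of)) => klMap (V.sym.app A.of B.of) ≫ t)
      (parK_map V y x).symm)
  symmetry A B := (klMapIso (V := V) ⟨V.sym.app A.of B.of, V.sym.app B.of A.of,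
    V.sym.symmetry _ _, V.sym.symmetry _ _⟩).hom_inv_id

lemma parEta_preservesSym : PreservesSym V.sym (klSym V) (parEta V) :=
  fun A B => klGen_klMap (V.sym.app A B)

variable (V) in
/-- The parallel promonoidal data of the Kleisli category. -/
def parDataK : PromonoidalData (Kl V) where
  tensor := parK V
  unit := unitK V
  assoc A B D := freeAssoc V (yo A.of) (yo B.of) (yo D.of)
  assoc_natural f g h := freeAssoc_natural (yoneda.map f) (yoneda.map g) (yoneda.map h)
  leftUnitor A := freeLeft V (yo A.of)
  leftUnitor_natural f := klLeft_natural (yoneda.map f)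
  -- Going through the symmetry avoids a second descent of the action. In `V` the right unitor is
  -- related to the left one in the same way, by `sym_leftExt`.
  rightUnitor A := (klSym V).iso _ _ ≪≫ freeLeft V (yo A.of)
  rightUnitor_natural {A A'} f := by
    have h1 := ((klSym V).extSq (yoneda.map f) (𝟙 (unitK V))).w
    have h2 := klLeft_natural (V := V) (yoneda.map f)
    change convMap (parK V) (yoneda.map f) (𝟙 (unitK V)) ≫ (klSym V).ext _ _ ≫ klLeft V (yo A') =
      ((klSym V).ext _ _ ≫ klLeft V (yo A)) ≫ yoneda.map f
    rw [← reassoc_of% h1, h2, Category.assoc]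

end ParallelStructure

/-! ### Pentagon, triangle and hexagon for the parallel structure. -/

section ParallelCoherence

variable {C : Type u} [SmallCategory C] (V : SymProduoidalCat C)

lemma parEta_preservesAssoc :
    PreservesAssoc (M := V.par.toPromonoidalData) (M' := parDataK V) (parEta V) := by
  intro A B K
  simp only [yonedaMap_eq, ← V.par.assocExt_yo]
  exact generators_freeAssoc (nUnit V (yo A)) (nUnit V (yo B)) (nUnit V (yo K))

lemma parEta_preservesLeft :
    PreservesLeft (M := V.par.toPromonoidalData) (M' := parDataK V) (parEta V)
      (parUnitEta V) := by
  intro A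
  rw [← V.par.leftExt_yo]
  exact parUnitEta_klLeft (yonedaMap (klFunctor V) A)

lemma sym_leftExt (F : Psh C) : V.sym.ext F V.par.unit ≫ V.par.leftExt F = V.par.rightExt F := by
  letI := V.par.monoidalCategory
  letI := V.symmetricCategory
  exact braiding_leftUnitor F

lemma parEta_preservesRight :
    PreservesRight (M := V.par.toPromonoidalData) (M' := parDataK V) (parEta V)
      (parUnitEta V) := by
  intro A
  have h1 := ((parEta_preservesSym (V := V)).sq (yonedaMap (klFunctor V) A) (parUnitEta V)).w
  have h2 := parUnitEta_klLeft (yonedaMap (klFunctor V) A)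
  rw [← V.par.rightExt_yo, ← sym_leftExt, Category.assoc, ← h2, reassoc_of% h1]
  rfl

variable {V}

lemma whiskerSq_comp {D : Type u} [SmallCategory D] {J : C ⥤ D} {F G H : Psh C} {F' G' H' : Psh D}
    {t : F ⟶ G} {u : G ⟶ H} {a : F ⟶ J.op ⋙ F'} {b : G ⟶ J.op ⋙ G'} {c : H ⟶ J.op ⋙ H'}
    {t' : F' ⟶ G'} {u' : G' ⟶ H'} (h : CommSq t a b (Functor.whiskerLeft J.op t'))
    (k : CommSq u b c (Functor.whiskerLeft J.op u')) :
    CommSq (t ≫ u) a c (Functor.whiskerLeft J.op (t' ≫ u')) :=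
  h.horiz_comp k

lemma whiskerSq_id {D : Type u} [SmallCategory D] {J : C ⥤ D} {F : Psh C} {F' : Psh D}
    (a : F ⟶ J.op ⋙ F') : CommSq (𝟙 F) a a (Functor.whiskerLeft J.op (𝟙 F')) := sqId a

/-- Equations hold on the Kleisli category once they hold for generators. -/
lemma Generates.eq_of_sq {F G : Psh C} {F' G' : Psh (Kl V)} {a : F ⟶ (klFunctor V).op ⋙ F'}
    (ha : Generates a) {b : G ⟶ (klFunctor V).op ⋙ G'} {t u : F ⟶ G} {t' u' : F' ⟶ G'}
    (h : t = u) (ht : CommSq t a b (Functor.whiskerLeft (klFunctor V).op t'))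
    (hu : CommSq u a b (Functor.whiskerLeft (klFunctor V).op u')) : t' = u' :=
  ha.hom_ext (Produoidal.eq_of_sq h ht hu)

variable (V)

/-- The model for the coherence proofs on the Kleisli category: the squares expressing that `η`
preserves associators are pasted over the pentagon of `V`, and their common left side generates the
source. -/
lemma parDataK_pentagon (A B D E : Kl V) :
    (parDataK V).assocExt (conv (parK V) (yo A) (yo B)) (yo D) (yo E) ≫
        (parDataK V).assocExt (yo A) (yo B) (conv (parK V) (yo D) (yo E)) =
      convMap (parK V) ((parDataK V).assocExt (yo A) (yo B) (yo D)) (𝟙 (yo E)) ≫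
        (parDataK V).assocExt (yo A) (conv (parK V) (yo B) (yo D)) (yo E) ≫
          convMap (parK V) (𝟙 (yo A)) ((parDataK V).assocExt (yo B) (yo D) (yo E)) := by
  have g : ∀ A : Kl V, Generates (yonedaMap (klFunctor V) A.of) := fun A => generates_yonedaMap _
  have hs := parEta_preservesAssoc V
  have s := fun A : Kl V => whiskerSq_id (yonedaMap (klFunctor V) A.of)
  refine ((((g A).par (g B)).par (g D)).par (g E)).eq_of_sq
    (V.par.pentagonExt (yo A.of) (yo B.of) (yo D.of) (yo E.of))
    (whiskerSq_comp (hs.sq _ _ _) (hs.sq _ _ _))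
    (whiskerSq_comp (sqOver _ (hs.sq _ _ _) (s E)) (whiskerSq_comp (hs.sq _ _ _)
      (sqOver _ (s A) (hs.sq _ _ _))))

lemma parDataK_triangle (A B : Kl V) :
    (parDataK V).assocExt (yo A) (unitK V) (yo B) ≫
        convMap (parK V) (𝟙 (yo A)) ((parDataK V).leftExt (yo B)) =
      convMap (parK V) ((parDataK V).rightExt (yo A)) (𝟙 (yo B)) := by
  have g : ∀ A : Kl V, Generates (yonedaMap (klFunctor V) A.of) := fun A => generates_yonedaMap _
  have s := fun A : Kl V => whiskerSq_id (yonedaMap (klFunctor V) A.of)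
  exact (((g A).par generates_parUnitEta).par (g B)).eq_of_sq
    (V.par.triangleExt (yo A.of) (yo B.of))
    (whiskerSq_comp ((parEta_preservesAssoc V).sq _ _ _)
      (sqOver _ (s A) ((parEta_preservesLeft V).sq _)))
    (sqOver _ ((parEta_preservesRight V).sq _) (s B))

/-- The parallel promonoidal structure of the Kleisli category. -/
def parPK : Promonoidal (Kl V) where
  toPromonoidalData := parDataK V
  pentagon A B D E := by
    rw [← PromonoidalData.assocExt_yo, ← PromonoidalData.assocExt_yo]
    exact parDataK_pentagon V A B D E
  triangle A B := by
    rw [← PromonoidalData.leftExt_yo, ← PromonoidalData.rightExt_yo]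
    exact parDataK_triangle V A B

lemma parDataK_hexagon (A B D : Kl V) :
    (parDataK V).assocExt (yo A) (yo B) (yo D) ≫ (klSym V).ext (yo A)
        (conv (parK V) (yo B) (yo D)) ≫ (parDataK V).assocExt (yo B) (yo D) (yo A) =
      convMap (parK V) ((klSym V).ext (yo A) (yo B)) (𝟙 (yo D)) ≫
        (parDataK V).assocExt (yo B) (yo A) (yo D) ≫
          convMap (parK V) (𝟙 (yo B)) ((klSym V).ext (yo A) (yo D)) := by
  have g : ∀ A : Kl V, Generates (yonedaMap (klFunctor V) A.of) := fun A => generates_yonedaMap _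
  have s := fun A : Kl V => whiskerSq_id (yonedaMap (klFunctor V) A.of)
  have hs := parEta_preservesAssoc V
  have hc := parEta_preservesSym (V := V)
  exact (((g A).par (g B)).par (g D)).eq_of_sq (V.hexagonExt (yo A.of) (yo B.of) (yo D.of))
    (whiskerSq_comp (hs.sq _ _ _) (whiskerSq_comp (hc.sq _ _) (hs.sq _ _ _)))
    (whiskerSq_comp (sqOver _ (hc.sq _ _) (s D)) (whiskerSq_comp (hs.sq _ _ _)
      (sqOver _ (s B) (hc.sq _ _))))

end ParallelCoherence

/-! ### The action of `N` on a sequential convolution of modules. -/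

section SequentialAction

lemma unit_coassoc {𝒞 : Type*} [Category 𝒞] [MonoidalCategory 𝒞] :
    (MonoidalCategory.leftUnitor (MonoidalCategory.tensorUnit 𝒞)).inv ≫
      MonoidalCategory.whiskerRight (MonoidalCategory.leftUnitor _).inv _ ≫
        (MonoidalCategory.associator _ _ _).hom =
    (MonoidalCategory.leftUnitor (MonoidalCategory.tensorUnit 𝒞)).inv ≫
      MonoidalCategory.whiskerLeft _ (MonoidalCategory.leftUnitor _).inv := by
  monoidal

variable {C : Type u} [SmallCategory C] (V : SymProduoidalCat C)

/-- The comultiplication of the sequential unit. -/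
def seqDelta : V.seq.unit ⟶ conv V.seq.tensor V.seq.unit V.seq.unit :=
  V.seq.leftInvExt V.seq.unit

lemma seqDelta_leftExt : seqDelta V ≫ V.seq.leftExt V.seq.unit = 𝟙 _ :=
  (V.seq.leftIso V.seq.unit).inv_hom_id

lemma leftExt_seqDelta : V.seq.leftExt V.seq.unit ≫ seqDelta V = 𝟙 _ :=
  (V.seq.leftIso V.seq.unit).hom_inv_id

lemma seq_leftExt_unit : V.seq.leftExt V.seq.unit = V.seq.rightExt V.seq.unit := by
  letI := V.seq.monoidalCategory
  exact MonoidalCategory.unitors_equal (C := Psh C)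

lemma seqDelta_coassoc :
    seqDelta V ≫ convMap V.seq.tensor (seqDelta V) (𝟙 _) ≫ V.seq.assocExt _ _ _ =
      seqDelta V ≫ convMap V.seq.tensor (𝟙 _) (seqDelta V) := by
  letI := V.seq.monoidalCategory
  exact unit_coassoc

/-- As `seqDelta` is the inverse of the unitor at `N`, the equation may be checked after that
unitor, where it becomes the counit law of `ψ₀`. -/
lemma phi0_seqDelta : V.phi0 ≫ seqDelta V = V.psi0 ≫ convMap V.seq.tensor V.phi0 V.phi0 := by
  have h : V.psi0 ≫ convMap V.seq.tensor V.phi0 V.phi0 ≫ V.seq.leftExt V.seq.unit = V.phi0 := by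
    have e : convMap V.seq.tensor V.phi0 V.phi0 = convMap V.seq.tensor V.phi0 (𝟙 _) ≫
        convMap V.seq.tensor (𝟙 _) V.phi0 := by
      rw [← convMap_comp, Category.id_comp, Category.comp_id]
    have h1 := V.psi0_left =≫ V.phi0
    rw [e, Category.assoc, V.seq.leftExt_natural]
    simpa using h1
  have h2 := h =≫ seqDelta V
  rw [Category.assoc, Category.assoc, leftExt_seqDelta, Category.comp_id] at h2
  exact h2.symm

/-- Multiplication and comultiplication of `N` are compatible as in a bimonoid. After the unitor of
`N` this is the unit axiom relating `ψ₂` and `φ₂`. -/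
lemma phi2_seqDelta : V.phi2 ≫ seqDelta V =
    convMap V.par.tensor (seqDelta V) (seqDelta V) ≫ V.psi2Ext _ _ _ _ ≫
      convMap V.seq.tensor V.phi2 V.phi2 := by
  have h : convMap V.par.tensor (seqDelta V) (seqDelta V) ≫ V.psi2Ext _ _ _ _ ≫
      convMap V.seq.tensor V.phi2 V.phi2 ≫ V.seq.leftExt V.seq.unit = V.phi2 := by
    have e : convMap V.seq.tensor V.phi2 V.phi2 = convMap V.seq.tensor V.phi2 (𝟙 _) ≫
        convMap V.seq.tensor (𝟙 _) V.phi2 := by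
      rw [← convMap_comp, Category.id_comp, Category.comp_id]
    rw [e, Category.assoc, V.seq.leftExt_natural, reassoc_of% (V.psi2_seq_leftExt V.seq.unit
      V.seq.unit), ← Category.assoc, ← convMap_comp, seqDelta_leftExt, convMap_id,
      Category.id_comp]
  have h2 := h =≫ seqDelta V
  simp only [Category.assoc, leftExt_seqDelta, Category.comp_id] at h2
  exact h2.symm

variable {V}

/-- The action of `N` on the sequential convolution of two modules. -/
def seqAct {M M' : Psh C} (a : conv V.par.tensor V.seq.unit M ⟶ M)
    (a' : conv V.par.tensor V.seq.unit M' ⟶ M') :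
    conv V.par.tensor V.seq.unit (conv V.seq.tensor M M') ⟶ conv V.seq.tensor M M' :=
  convMap V.par.tensor (seqDelta V) (𝟙 _) ≫ V.psi2Ext _ _ _ _ ≫ convMap V.seq.tensor a a'

variable {M M' M'' L L' : Psh C} {a : conv V.par.tensor V.seq.unit M ⟶ M}
  {a' : conv V.par.tensor V.seq.unit M' ⟶ M'} {a'' : conv V.par.tensor V.seq.unit M'' ⟶ M''}
  {b : conv V.par.tensor V.seq.unit L ⟶ L} {b' : conv V.par.tensor V.seq.unit L' ⟶ L'}

lemma NAction.of_left (h : V.par.assocExt V.seq.unit V.seq.unit M ≫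
      convMap V.par.tensor (𝟙 V.seq.unit) a ≫ a = convMap V.par.tensor V.phi2 (𝟙 M) ≫ a)
    (h' : convMap V.par.tensor V.phi0 (𝟙 M) ≫ a = V.par.leftExt M) : NAction V a where
  assoc := by
    rw [nAct, Category.assoc, ← h, ← V.par.assocIso_hom, ← V.par.assocIso_inv,
      Iso.inv_hom_id_assoc]
  unit := by
    rw [nUnit, Category.assoc, h', ← V.par.leftIso_hom, ← V.par.leftIso_inv, Iso.inv_hom_id]

lemma NAction.assoc_left (h : NAction V a) : V.par.assocExt V.seq.unit V.seq.unit M ≫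
      convMap V.par.tensor (𝟙 V.seq.unit) a ≫ a = convMap V.par.tensor V.phi2 (𝟙 M) ≫ a := by
  rw [h.assoc, nAct, Category.assoc, ← V.par.assocIso_hom, ← V.par.assocIso_inv,
    Iso.hom_inv_id_assoc]

lemma psi2Ext_natural {F F' G G' H H' K K' : Psh C} (f : F ⟶ F') (g : G ⟶ G') (h : H ⟶ H')
    (k : K ⟶ K') :
    convMap V.par.tensor (convMap V.seq.tensor f g) (convMap V.seq.tensor h k) ≫
      V.psi2Ext F' G' H' K' = V.psi2Ext F G H K ≫
        convMap V.seq.tensor (convMap V.par.tensor f h) (convMap V.par.tensor g k) :=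
  (V.psi2Sq f g h k).w.symm

lemma psi2Ext_natural_left {F F' G G' H K : Psh C} (f : F ⟶ F') (g : G ⟶ G') :
    convMap V.par.tensor (convMap V.seq.tensor f g) (𝟙 (conv V.seq.tensor H K)) ≫
      V.psi2Ext F' G' H K = V.psi2Ext F G H K ≫
        convMap V.seq.tensor (convMap V.par.tensor f (𝟙 H)) (convMap V.par.tensor g (𝟙 K)) := by
  rw [← psi2Ext_natural, convMap_id]

lemma psi2Ext_natural_right {F G H H' K K' : Psh C} (h : H ⟶ H') (k : K ⟶ K') :
    convMap V.par.tensor (𝟙 (conv V.seq.tensor F G)) (convMap V.seq.tensor h k) ≫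
      V.psi2Ext F G H' K' = V.psi2Ext F G H K ≫
        convMap V.seq.tensor (convMap V.par.tensor (𝟙 F) h) (convMap V.par.tensor (𝟙 G) k) := by
  rw [← psi2Ext_natural, convMap_id]

/-- A scalar acts by being duplicated along `seqDelta` and distributed by `ψ₂`. Duplication is
multiplicative by `phi2_seqDelta`, distribution by the associativity of `ψ₂` for `⊗`, and each half
acts associatively. -/
lemma seqAct_assoc_left (h : NAction V a) (h' : NAction V a') :
    V.par.assocExt V.seq.unit V.seq.unit _ ≫
      convMap V.par.tensor (𝟙 V.seq.unit) (seqAct a a') ≫ seqAct a a' =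
    convMap V.par.tensor V.phi2 (𝟙 _) ≫ seqAct a a' := by
  have e1 : convMap V.par.tensor V.phi2 (𝟙 _) ≫ seqAct a a' =
      convMap V.par.tensor (convMap V.par.tensor (seqDelta V) (seqDelta V)) (𝟙 _) ≫
        convMap V.par.tensor (V.psi2Ext _ _ _ _) (𝟙 _) ≫ V.psi2Ext _ _ _ _ ≫
          convMap V.seq.tensor (convMap V.par.tensor V.phi2 (𝟙 _) ≫ a)
            (convMap V.par.tensor V.phi2 (𝟙 _) ≫ a') := by
    rw [seqAct, ← Category.assoc, ← convMap_comp, Category.comp_id, phi2_seqDelta, convMap_comp,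
      ← reassoc_of% (psi2Ext_natural_left (V := V) (H := M) (K := M') V.phi2 V.phi2)]
    simp only [← Category.assoc, ← convMap_comp, Category.comp_id]
  have e2 := V.psi2_par_assocExt V.seq.unit V.seq.unit V.seq.unit V.seq.unit M M'
  rw [e1, ← h.assoc_left, ← h'.assoc_left, convMap_comp, ← reassoc_of% e2, seqAct,
    reassoc_of% (V.par.assocExt_natural (seqDelta V) (seqDelta V) (𝟙 (conv V.seq.tensor M M'))),
    convMap_comp, ← reassoc_of% (psi2Ext_natural_right (V := V) (F := V.seq.unit)
      (G := V.seq.unit) a a')]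
  simp only [← Category.assoc, ← convMap_comp, Category.comp_id, Category.id_comp]

/-- Duplicating a unit scalar gives `ψ₀` followed by two unit scalars, so the unit axiom of `ψ₂` for
`⊗` applies. -/
lemma seqAct_unit_left (h : NAction V a) (h' : NAction V a') :
    convMap V.par.tensor V.phi0 (𝟙 _) ≫ seqAct a a' = V.par.leftExt _ := by
  rw [← V.psi2_par_leftExt, ← nUnit_inv h, ← nUnit_inv h', convMap_comp,
    ← reassoc_of% (psi2Ext_natural_left (V := V) (H := M) (K := M') V.phi0 V.phi0), seqAct]
  simp only [← Category.assoc, ← convMap_comp, Category.comp_id, phi0_seqDelta]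

lemma nAction_seqAct (h : NAction V a) (h' : NAction V a') : NAction V (seqAct a a') :=
  .of_left (seqAct_assoc_left h h') (seqAct_unit_left h h')

lemma NLinear.seq {f : M ⟶ L} {g : M' ⟶ L'} (hf : NLinear V a b f) (hg : NLinear V a' b' g) :
    NLinear V (seqAct a a') (seqAct b b') (convMap V.seq.tensor f g) := by
  unfold NLinear at *
  rw [seqAct, seqAct, Category.assoc, Category.assoc, ← convMap_comp, hf, hg, convMap_comp,
    ← reassoc_of% (psi2Ext_natural_right (V := V) (F := V.seq.unit) (G := V.seq.unit) f g)]
  simp only [← Category.assoc, ← convMap_comp, Category.comp_id, Category.id_comp]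

variable (a a' a'') in
-- Acting on three factors triples the scalar. The two ways of tripling agree by `seqDelta_coassoc`,
-- and the two ways of distributing agree by the associativity of `ψ₂` for `◁`.
lemma nLinear_seqAssoc : NLinear V (seqAct (seqAct a a') a'') (seqAct a (seqAct a' a''))
    (V.seq.assocExt M M' M'') := by
  have e := V.psi2_seq_assocExt V.seq.unit V.seq.unit V.seq.unit M M' M''
  have e1 : seqAct (seqAct a a') a'' = convMap V.par.tensor (seqDelta V ≫
      convMap V.seq.tensor (seqDelta V) (𝟙 _)) (𝟙 _) ≫ V.psi2Ext _ _ _ _ ≫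
        convMap V.seq.tensor (V.psi2Ext _ _ _ _) (𝟙 _) ≫
          convMap V.seq.tensor (convMap V.seq.tensor a a') a'' := by
    have n := psi2Ext_natural_left (V := V) (H := conv V.seq.tensor M M') (K := M'') (seqDelta V)
      (𝟙 V.seq.unit)
    rw [convMap_id] at n
    have : convMap V.par.tensor (seqDelta V ≫ convMap V.seq.tensor (seqDelta V) (𝟙 _))
      (𝟙 (conv V.seq.tensor (conv V.seq.tensor M M') M'')) = convMap V.par.tensor (seqDelta V)
        (𝟙 _) ≫ convMap V.par.tensor (convMap V.seq.tensor (seqDelta V) (𝟙 _)) (𝟙 _) := by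
      rw [← convMap_comp, Category.comp_id]
    rw [this, Category.assoc, reassoc_of% n]
    simp only [seqAct, ← convMap_comp, Category.id_comp]
  have e2 : seqAct a (seqAct a' a'') = convMap V.par.tensor (seqDelta V ≫
      convMap V.seq.tensor (𝟙 _) (seqDelta V)) (𝟙 _) ≫ V.psi2Ext _ _ _ _ ≫
        convMap V.seq.tensor (𝟙 _) (V.psi2Ext _ _ _ _) ≫
          convMap V.seq.tensor a (convMap V.seq.tensor a' a'') := by
    have n := psi2Ext_natural_left (V := V) (H := M) (K := conv V.seq.tensor M' M'')
      (𝟙 V.seq.unit) (seqDelta V)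
    rw [convMap_id] at n
    have : convMap V.par.tensor (seqDelta V ≫ convMap V.seq.tensor (𝟙 _) (seqDelta V))
      (𝟙 (conv V.seq.tensor M (conv V.seq.tensor M' M''))) = convMap V.par.tensor (seqDelta V)
        (𝟙 _) ≫ convMap V.par.tensor (convMap V.seq.tensor (𝟙 _) (seqDelta V)) (𝟙 _) := by
      rw [← convMap_comp, Category.comp_id]
    rw [this, Category.assoc, reassoc_of% n]
    simp only [seqAct, ← convMap_comp, Category.id_comp]
  unfold NLinear
  rw [e1, e2, Category.assoc, Category.assoc, Category.assoc, V.seq.assocExt_natural,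
    ← reassoc_of% e, ← seqDelta_coassoc]
  simp only [← Category.assoc, ← convMap_comp, Category.comp_id, Category.id_comp]

variable (a) in
lemma nLinear_seqLeft : NLinear V (seqAct V.phi2 a) a (V.seq.leftExt M) := by
  unfold NLinear
  have e : convMap V.seq.tensor V.phi2 a = convMap V.seq.tensor V.phi2 (𝟙 _) ≫
      convMap V.seq.tensor (𝟙 _) a := by
    rw [← convMap_comp, Category.id_comp, Category.comp_id]
  rw [seqAct, e, Category.assoc, Category.assoc, Category.assoc, V.seq.leftExt_natural,
    reassoc_of% (V.psi2_seq_leftExt V.seq.unit M), ← Category.assoc, ← convMap_comp,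
    seqDelta_leftExt, Category.id_comp]

variable (a) in
lemma nLinear_seqRight : NLinear V (seqAct a V.phi2) a (V.seq.rightExt M) := by
  unfold NLinear
  have e : convMap V.seq.tensor a V.phi2 = convMap V.seq.tensor (𝟙 _) V.phi2 ≫
      convMap V.seq.tensor a (𝟙 _) := by
    rw [← convMap_comp, Category.id_comp, Category.comp_id]
  rw [seqAct, e, Category.assoc, Category.assoc, Category.assoc, V.seq.rightExt_natural,
    reassoc_of% (V.psi2_seq_rightExt V.seq.unit M), ← Category.assoc, ← convMap_comp,
    ← seq_leftExt_unit, seqDelta_leftExt, Category.id_comp]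

lemma nLinear_seqDelta : NLinear V V.phi2 (seqAct V.phi2 V.phi2) (seqDelta V) := by
  unfold NLinear
  rw [phi2_seqDelta, seqAct, ← Category.assoc (convMap _ (𝟙 _) _), ← convMap_comp,
    Category.id_comp, Category.comp_id]

lemma nLinear_id (a : conv V.par.tensor V.seq.unit M ⟶ M) : NLinear V a a (𝟙 M) := by
  unfold NLinear
  rw [Category.comp_id, convMap_id, Category.id_comp]

lemma NLinear.inv {f : M ⟶ L} {g : L ⟶ M} (h : NLinear V a b f) (hfg : f ≫ g = 𝟙 _)
    (hgf : g ≫ f = 𝟙 _) : NLinear V b a g := by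
  unfold NLinear at *
  have h2 := convMap V.par.tensor (𝟙 V.seq.unit) g ≫= (h =≫ g)
  rw [Category.assoc, Category.assoc, hfg, Category.comp_id, ← Category.assoc (convMap _ _ _)
    (convMap _ _ _), ← convMap_comp, hgf, Category.id_comp, convMap_id, Category.id_comp] at h2
  exact h2.symm

end SequentialAction

/-! ### The sequential splits of the Kleisli category. -/

section SequentialSplit

variable {C : Type u} [SmallCategory C] {V : SymProduoidalCat C}

/-- The sequential convolution of two modules. -/
abbrev seqModule (M M' : NModule V) : NModule V where
  psh := conv V.seq.tensor M.psh M'.psh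
  act := seqAct M.act M'.act
  isAction := nAction_seqAct M.isAction M'.isAction

/-- A linear map, as a morphism of presheaves on the Kleisli category. -/
def NModule.map {M M' : NModule V} (f : M.psh ⟶ M'.psh) (hf : NLinear V M.act M'.act f) :
    M.toPsh ⟶ M'.toPsh :=
  M.desc (f ≫ M'.res) (hf.comp M'.res_linear)

lemma NModule.res_map {M M' : NModule V} (f : M.psh ⟶ M'.psh) (hf : NLinear V M.act M'.act f) :
    M.res ≫ Functor.whiskerLeft (klFunctor V).op (NModule.map f hf) = f ≫ M'.res := rfl

lemma NModule.map_desc {M M' : NModule V} (f : M.psh ⟶ M'.psh) (hf : NLinear V M.act M'.act f)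
    {Z : Psh (Kl V)} (b : M'.psh ⟶ (klFunctor V).op ⋙ Z) (hb : NLinear V M'.act (resAct Z) b) :
    NModule.map f hf ≫ M'.desc b hb = M.desc (f ≫ b) (hf.comp hb) := rfl

/-- The linear extension of a morphism of the Kleisli category. -/
def klLift {A B : C} (x : (normHom V B).obj (op A)) : normHom V A ⟶ normHom V B :=
  nLift V (nAct V (yo B)) (elt x)

lemma klLift_linear {A B : C} (x : (normHom V B).obj (op A)) :
    NLinear V (nAct V (yo A)) (nAct V (yo B)) (klLift x) :=
  nLift_linear (nAction_nAct V _) _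

lemma klLift_resElt {F : Psh (Kl V)} {A B : C} (y : (normHom V B).obj (op A))
    (z : ((klFunctor V).op ⋙ F).obj (op B)) :
    klLift y ≫ resElt z = resElt ((resElt z).app (op A) y) :=
  (elt_resElt z y).symm

lemma klLift_normId {A B : C} (f : A ⟶ B) :
    klLift ((normId V B).app (op A) f) =
      convMap V.par.tensor (𝟙 V.seq.unit) (yoneda.map f) := by
  rw [klLift, ← elt_comp, elt_id, normId_eq, nLift_comp_nUnit]

lemma klLift_app_normId {A B : C} (x : (normHom V B).obj (op A)) :
    (klLift x).app (op A) ((normId V A).app (op A) (𝟙 A)) = x := by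
  rw [klLift, nLift_elt_normId (nAction_nAct V _), op_id, Functor.map_id_apply]

lemma klLift_comp {A B D : C} (x : (normHom V B).obj (op A)) (y : (normHom V D).obj (op B)) :
    klLift (normComp V x y) = klLift x ≫ klLift y := by
  rw [klLift, klLift, klLift, nLift_nLift (nAction_nAct V _), elt_comp]
  rfl

variable (V) in
/-- The sequential splits of the Kleisli category, as modules. -/
abbrev seqObj (A B : C) : NModule V :=
  seqModule (freeModule V (yo A)) (freeModule V (yo B))

variable (V) in
/-- The action of the Kleisli category on sequential splits. -/
def seqMap {A A' B B' : C} (x : (normHom V A').obj (op A)) (y : (normHom V B').obj (op B)) :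
    (seqObj V A B).toPsh ⟶ (seqObj V A' B').toPsh :=
  NModule.map (M := seqObj V A B) (M' := seqObj V A' B')
    (convMap V.seq.tensor (klLift x) (klLift y)) ((klLift_linear x).seq (klLift_linear y))

lemma seqMap_id (A B : C) : seqMap V ((normId V A).app (op A) (𝟙 A))
    ((normId V B).app (op B) (𝟙 B)) = 𝟙 _ := by
  refine NModule.hom_ext ?_
  rw [seqMap, NModule.res_map, klLift_normId, klLift_normId, CategoryTheory.Functor.map_id,
    CategoryTheory.Functor.map_id, convMap_id, convMap_id, convMap_id]
  rfl

lemma seqMap_comp {A A' A'' B B' B'' : C} (x : (normHom V A').obj (op A))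
    (x' : (normHom V A'').obj (op A')) (y : (normHom V B').obj (op B))
    (y' : (normHom V B'').obj (op B')) :
    seqMap V (normComp V x x') (normComp V y y') = seqMap V x y ≫ seqMap V x' y' := by
  refine NModule.hom_ext ?_
  simp only [seqMap, Functor.whiskerLeft_comp]
  rw [NModule.res_map, klLift_comp, klLift_comp, convMap_comp]
  rfl

variable (V) in
/-- The sequential splits of the Kleisli category. -/
def seqK : Split (Kl V) :=
  Split.mk (fun A B => (seqObj V A.of B.of).toPsh) (fun x y => seqMap V x y)
    (fun _ _ => seqMap_id _ _) (fun x x' y y' => seqMap_comp x x' y y')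

variable (V) in
lemma seqK_map {A A' B B' : Kl V} (x : A ⟶ A') (y : B ⟶ B') :
    ((seqK V).map x).app B ≫ ((seqK V).obj A').map y = seqMap V x y := by
  change seqMap V x ((normId V B.of).app (op B.of) (𝟙 B.of)) ≫
    seqMap V ((normId V A'.of).app (op A'.of) (𝟙 A'.of)) y = _
  rw [← seqMap_comp]
  exact congrArg₂ (fun (s : A ⟶ A') (t : B ⟶ B') => seqMap V s t) (Category.comp_id x)
    (Category.id_comp y)

variable (V) in
/-- The inclusion of generators. -/
def seqGen (A B : C) : (V.seq.tensor.obj A).obj B ⟶ normSeq V A B :=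
  (convYoIso V.seq.tensor A B).inv ≫ convMap V.seq.tensor (nUnit V (yo A)) (nUnit V (yo B))

lemma seqGen_natural {A A' B B' : C} (f : A ⟶ A') (g : B ⟶ B') :
    (V.seq.tensor.map f).app B ≫ (V.seq.tensor.obj A').map g ≫ seqGen V A' B' =
      seqGen V A B ≫ convMap V.seq.tensor (klLift ((normId V A').app (op A) f))
        (klLift ((normId V B').app (op B) g)) := by
  have h : (V.seq.tensor.map f).app B ≫ (V.seq.tensor.obj A').map g ≫
      (convYoIso V.seq.tensor A' B').inv = (convYoIso V.seq.tensor A B).inv ≫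
        convMap V.seq.tensor (yoneda.map f) (yoneda.map g) := by
    refine (ins_din V.seq.tensor (F := yo A') (G := yo B') f g (𝟙 A') (𝟙 B')).trans ?_
    change _ = ins _ _ _ ≫ _
    rw [ins_convMap]
    simp
  simp only [seqGen, Category.assoc]
  rw [reassoc_of% h, ← convMap_comp, nUnit_natural, nUnit_natural, klLift_normId, klLift_normId,
    convMap_comp]

variable (V) in
/-- The canonical map from the sequential splits of `V` to those of the Kleisli category. -/
def seqEta : SplitMap (klFunctor V) V.seq.tensor (seqK V) where
  app A B := seqGen V A B ≫ (seqObj V A B).res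
  natural {A A' B B'} f g := by
    refine Eq.trans ?_ (congrArg (fun t => (seqGen V A B ≫ (seqObj V A B).res) ≫
      Functor.whiskerLeft (klFunctor V).op t)
        (seqK_map V ((klFunctor V).map f) ((klFunctor V).map g)).symm)
    exact congrArg (· ≫ (seqObj V A' B').res) (seqGen_natural f g)

lemma convMap_seqGen {A B : C} {F G : Psh C} (x : normHom V A ⟶ F) (y : normHom V B ⟶ G) :
    seqGen V A B ≫ convMap V.seq.tensor x y = ins V.seq.tensor
      (x.app (op A) ((normId V A).app (op A) (𝟙 A)))
      (y.app (op B) ((normId V B).app (op B) (𝟙 B))) := by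
  rw [normId_eq, normId_eq]
  rfl

/-- Sequential counterpart of `convOver_homRes`. No product of scalars appears: after Yoneda
reduction the comparison is the identity on elements of `(N ⊗ A) ◁ (N ⊗ B)`. -/
lemma convOver_seq_homRes (A B : C) :
    convOver (seqEta V) (homRes V A) (homRes V B) ≫
        Functor.whiskerLeft (klFunctor V).op
          (convYo (seqK V) ((klFunctor V).obj A) ((klFunctor V).obj B)) =
      (seqObj V A B).res := by
  ext X Y x y : 1
  refine .trans ?_ ((congrArg (fun t => (seqGen V X Y ≫ (seqObj V X Y).res) ≫
    Functor.whiskerLeft (klFunctor V).op t) (seqK_map V (Kl.hom x) (Kl.hom y))).trans ?_)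
  · rfl
  · have h := convMap_seqGen (klLift x) (klLift y)
    rw [klLift_app_normId, klLift_app_normId] at h
    exact congrArg (· ≫ (seqObj V A B).res) h

lemma nLinear_of_jointlySurjective {M M' : Psh C} {a : conv V.par.tensor V.seq.unit M ⟶ M}
    {a' : conv V.par.tensor V.seq.unit M' ⟶ M'} {b : M ⟶ M'}
    {p : ∀ S : Psh C, (S ⟶ M) → Prop} (hp : JointlySurjective p)
    (h : ∀ S (f : S ⟶ M), p S f → ∃ c, NLinear V c a f ∧ NLinear V c a' (f ≫ b)) :
    NLinear V a a' b := by
  refine ((jointlySurjective_id _).conv hp).hom_ext ?_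
  rintro _ _ ⟨_, f, ⟨⟩, hf⟩
  obtain ⟨c, h1, h2⟩ := h _ f hf
  unfold NLinear at h1 h2
  rw [← Category.assoc, ← h1, Category.assoc, h2, ← Category.assoc, ← convMap_comp,
    Category.id_comp]

lemma NLinear.of_comp_iso {M : Psh C} {Z Z' : Psh (Kl V)}
    {a : conv V.par.tensor V.seq.unit M ⟶ M} {b : M ⟶ (klFunctor V).op ⋙ Z} (e : Z ≅ Z')
    (h : NLinear V a (resAct Z') (b ≫ Functor.whiskerLeft (klFunctor V).op e.hom)) :
    NLinear V a (resAct Z) b := by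
  have h' := h.comp (whiskerLeft_linear e.inv)
  rwa [Category.assoc, ← Functor.whiskerLeft_comp, e.hom_inv_id, Functor.whiskerLeft_id',
    Category.comp_id] at h'

lemma nLinear_convOver_homRes (A B : C) :
    NLinear V (seqAct (nAct V (yo A)) (nAct V (yo B))) (resAct _)
      (convOver (seqEta V) (homRes V A) (homRes V B)) := by
  refine NLinear.of_comp_iso
    (convYoIso (seqK V) ((klFunctor V).obj A) ((klFunctor V).obj B)) ?_
  have h := (seqObj V A B).res_linear
  rw [← convOver_seq_homRes] at h
  exact h

/-- The comparison between sequential convolutions. -/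
abbrev seqQ (F G : Psh (Kl V)) : conv V.seq.tensor ((klFunctor V).op ⋙ F) ((klFunctor V).op ⋙ G) ⟶
    (klFunctor V).op ⋙ conv (seqK V) F G :=
  convOver (seqEta V) (𝟙 ((klFunctor V).op ⋙ F)) (𝟙 ((klFunctor V).op ⋙ G))

lemma convMap_seqQ {F G : Psh (Kl V)} {H K : Psh C} (f : H ⟶ (klFunctor V).op ⋙ F)
    (g : K ⟶ (klFunctor V).op ⋙ G) :
    convMap V.seq.tensor f g ≫ seqQ F G = convOver (seqEta V) f g := by
  rw [seqQ, convMap_convOver, Category.comp_id, Category.comp_id]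

/-- As for `parQ`, covering by free modules on representables reduces the claim to the case where
`seqQ` becomes `NModule.res`. -/
lemma nLinear_seqQ (F G : Psh (Kl V)) :
    NLinear V (seqAct (resAct F) (resAct G)) (resAct (conv (seqK V) F G)) (seqQ F G) := by
  refine nLinear_of_jointlySurjective ((jointlySurjective_isResElt F).conv
    (jointlySurjective_isResElt G)) ?_
  rintro _ _ ⟨_, _, ⟨x⟩, ⟨y⟩⟩
  refine ⟨_, (resElt_linear x).seq (resElt_linear y), ?_⟩
  rw [convMap_seqQ, resElt, resElt, ← convOver_convMap]
  exact (nLinear_convOver_homRes _ _).comp (whiskerLeft_linear _)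

lemma seqMap_desc {F G Z : Psh (Kl V)}
    {b : conv V.seq.tensor ((klFunctor V).op ⋙ F) ((klFunctor V).op ⋙ G) ⟶ (klFunctor V).op ⋙ Z}
    (hb : NLinear V (seqAct (resAct F) (resAct G)) (resAct Z) b) {A A' B B' : C}
    (x : (normHom V A').obj (op A)) (y : (normHom V B').obj (op B))
    (f : ((klFunctor V).op ⋙ F).obj (op A')) (g : ((klFunctor V).op ⋙ G).obj (op B')) :
    seqMap V x y ≫ (seqObj V A' B').desc (convMap V.seq.tensor (resElt f) (resElt g) ≫ b)
        (((resElt_linear f).seq (resElt_linear g)).comp hb) =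
      (seqObj V A B).desc (convMap V.seq.tensor (resElt ((resElt f).app (op A) x))
        (resElt ((resElt g).app (op B) y)) ≫ b)
        (((resElt_linear _).seq (resElt_linear _)).comp hb) := by
  refine NModule.hom_ext ?_
  rw [seqMap, NModule.map_desc, NModule.res_desc, NModule.res_desc, ← klLift_resElt,
    ← klLift_resElt, convMap_comp, Category.assoc]

/-- A linear map is a morphism out of the sequential convolution on the Kleisli category. -/
def seqDesc {F G Z : Psh (Kl V)}
    (b : conv V.seq.tensor ((klFunctor V).op ⋙ F) ((klFunctor V).op ⋙ G) ⟶ (klFunctor V).op ⋙ Z)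
    (hb : NLinear V (seqAct (resAct F) (resAct G)) (resAct Z) b) : conv (seqK V) F G ⟶ Z :=
  convDesc (fun X Y f g => (seqObj V X.of Y.of).desc (convMap V.seq.tensor
      (resElt (F := F) (B := X.of) f) (resElt (F := G) (B := Y.of) g) ≫ b)
        (((resElt_linear (F := F) (A := X.of) f).seq
          (resElt_linear (F := G) (A := Y.of) g)).comp hb)) (by
    intro X X' Y Y' x y f g
    refine (Category.assoc _ _ _).symm.trans ((congrArg (fun t : (seqObj V X.of Y.of).toPsh ⟶
      (seqObj V X'.of Y'.of).toPsh => t ≫ (seqObj V X'.of Y'.of).desc (convMap V.seq.tensor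
      (resElt (F := F) (B := X'.of) f) (resElt (F := G) (B := Y'.of) g) ≫ b)
        (((resElt_linear (F := F) (A := X'.of) f).seq
          (resElt_linear (F := G) (A := Y'.of) g)).comp hb)) (seqK_map V x y)).trans ?_)
    exact seqMap_desc hb (A := X.of) (A' := X'.of) (B := Y.of) (B' := Y'.of) x y f g)

lemma seqQ_seqDesc {F G Z : Psh (Kl V)}
    (b : conv V.seq.tensor ((klFunctor V).op ⋙ F) ((klFunctor V).op ⋙ G) ⟶ (klFunctor V).op ⋙ Z)
    (hb : NLinear V (seqAct (resAct F) (resAct G)) (resAct Z) b) :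
    seqQ F G ≫ Functor.whiskerLeft (klFunctor V).op (seqDesc b hb) = b := by
  ext X Y x y : 1
  have h := convMap_seqGen (resElt x) (resElt y)
  have e : ∀ {F : Psh (Kl V)} {A : C} (x : ((klFunctor V).op ⋙ F).obj (op A)),
      (resElt x).app (op A) ((normId V A).app (op A) (𝟙 A)) = x := fun {F A} x => by
    have h := congrArg (fun k => k.app (op A) (𝟙 A)) (nUnit_resElt x)
    rw [normId_eq]
    exact h.trans (elt_app_id x)
  rw [e, e] at h
  exact congrArg (· ≫ b) h

/-- Pointwise surjectivity. -/
def Covers {G : Psh C} {F : Psh (Kl V)} (g : G ⟶ (klFunctor V).op ⋙ F) : Prop :=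
  ∀ (A : Kl V) (z : F.obj (op A)), ∃ y : G.obj (op A.of), g.app (op A.of) y = z

lemma Covers.generates {G : Psh C} {F : Psh (Kl V)} {g : G ⟶ (klFunctor V).op ⋙ F}
    (hg : Covers g) : Generates g := by
  intro A z
  obtain ⟨y, rfl⟩ := hg A z
  exact ⟨A.of, 𝟙 A, y, F.map_id_apply (op A) _⟩

lemma covers_id (F : Psh (Kl V)) : Covers (𝟙 ((klFunctor V).op ⋙ F)) := fun _ z => ⟨z, rfl⟩

/-- A sequential split of `Kl V` is a split of `V` together with a Kleisli morphism on each side,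
and dinaturality absorbs these morphisms into `x` and `y`. So surjectivity holds elementwise, with
no residual scalar in front; parallel convolution only preserves generation. -/
lemma Covers.seq {G H : Psh C} {F K : Psh (Kl V)} {g : G ⟶ (klFunctor V).op ⋙ F}
    {h : H ⟶ (klFunctor V).op ⋙ K} (hg : Covers g) (hh : Covers h) :
    Covers (convOver (seqEta V) g h) := by
  intro A e
  induction e using conv_ind with | h X Y t x y =>
  change (conv V.seq.tensor (normHom V X.of) (normHom V Y.of)).obj (op A.of) at t
  induction t using conv_ind with | h X' Y' s m m' =>
  -- The elements to be lifted are `x` and `y` already restricted along the scalars `m` and `m'` of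
  -- the split.
  obtain ⟨x', hx⟩ := hg ⟨X'⟩ (F.map (X := op X) (Y := op ⟨X'⟩)
    (Quiver.Hom.op (V := Kl V) (X := ⟨X'⟩) (Y := X) m) x)
  obtain ⟨y', hy⟩ := hh ⟨Y'⟩ (K.map (X := op Y) (Y := op ⟨Y'⟩)
    (Quiver.Hom.op (V := Kl V) (X := ⟨Y'⟩) (Y := Y) m') y)
  refine ⟨cmk s x' y', ?_⟩
  have h1 := convMap_seqGen (klLift m) (klLift m')
  rw [klLift_app_normId, klLift_app_normId] at h1
  have h2 := cmk_din (P := seqK V) (F := F) (G := K) (A := op A)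
    (X := ⟨X'⟩) (X' := X) (Y := ⟨Y'⟩) (Y' := Y) m m' ((seqGen V X' Y').app (op A.of) s) x y
  refine ((congrArg₂ (fun x y => (cmk ((seqGen V X' Y').app (op A.of) s :
    (((seqK V).obj ⟨X'⟩).obj ⟨Y'⟩).obj (op A)) x y : (conv (seqK V) F K).obj (op A)))
      hx hy).trans h2.symm).trans ?_
  refine congrArg (fun t => (cmk t x y : (conv (seqK V) F K).obj (op A))) ?_
  exact (congrArg (fun k => k.app (op A) ((seqGen V X' Y').app (op A.of) s))
    (seqK_map V (A := ⟨X'⟩) (A' := X) (B := ⟨Y'⟩) (B' := Y) m m')).trans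
      (congrArg (fun k => k.app (op A.of) s) h1)

end SequentialSplit

/-! ### Sequential associator and unitors on the Kleisli category, and their coherence. -/

section SequentialStructure

variable {C : Type u} [SmallCategory C] {V : SymProduoidalCat C}

lemma whisker_hom_ext {F G : Psh (Kl V)} {s t : F ⟶ G}
    (h : Functor.whiskerLeft (klFunctor V).op s = Functor.whiskerLeft (klFunctor V).op t) :
    s = t :=
  (generates_id F).hom_ext (by rw [Category.id_comp, Category.id_comp, h])

lemma resElt_comp_linear {F Z : Psh (Kl V)} {b : (klFunctor V).op ⋙ F ⟶ (klFunctor V).op ⋙ Z}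
    (hb : NLinear V (resAct F) (resAct Z) b) {A : C}
    (z : ((klFunctor V).op ⋙ F).obj (op A)) : resElt z ≫ b = resElt (b.app (op A) z) := by
  rw [← resAct_elt]
  exact (resModule F).nLift_elt_linear hb z

/-- A linear map between restrictions, as a morphism of presheaves. -/
def linDesc {F Z : Psh (Kl V)} (b : (klFunctor V).op ⋙ F ⟶ (klFunctor V).op ⋙ Z)
    (hb : NLinear V (resAct F) (resAct Z) b) : F ⟶ Z where
  app A := ↾fun z => b.app (op A.unop.of) z
  naturality := by
    rintro ⟨A⟩ ⟨B⟩ ⟨x⟩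
    ext z
    exact congrArg (fun k => k.app (op B.of) x) (resElt_comp_linear hb (A := A.of) z)

lemma whisker_linDesc {F Z : Psh (Kl V)} (b : (klFunctor V).op ⋙ F ⟶ (klFunctor V).op ⋙ Z)
    (hb : NLinear V (resAct F) (resAct Z) b) :
    Functor.whiskerLeft (klFunctor V).op (linDesc b hb) = b := rfl

/-- A linear isomorphism between restrictions, as an isomorphism of presheaves. -/
@[simps hom] def linIso {F G : Psh (Kl V)} (b : (klFunctor V).op ⋙ F ⟶ (klFunctor V).op ⋙ G)
    (hb : NLinear V (resAct F) (resAct G) b)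
    (c : (klFunctor V).op ⋙ G ⟶ (klFunctor V).op ⋙ F) (h : b ≫ c = 𝟙 _) (h' : c ≫ b = 𝟙 _) :
    F ≅ G where
  hom := linDesc b hb
  inv := linDesc c (hb.inv h h')
  hom_inv_id := whisker_hom_ext (by
    rw [Functor.whiskerLeft_comp, whisker_linDesc, whisker_linDesc, h, Functor.whiskerLeft_id'])
  inv_hom_id := whisker_hom_ext (by
    rw [Functor.whiskerLeft_comp, whisker_linDesc, whisker_linDesc, h', Functor.whiskerLeft_id'])

lemma Covers.eq_of_comp {G : Psh C} {F : Psh (Kl V)} {g : G ⟶ (klFunctor V).op ⋙ F}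
    (hg : Covers g) {Z : Psh C} {s t : (klFunctor V).op ⋙ F ⟶ Z} (h : g ≫ s = g ≫ t) : s = t := by
  refine psh_hom_ext fun A z => ?_
  obtain ⟨y, rfl⟩ := hg ⟨A.unop⟩ z
  exact congrArg (fun k => k.app A y) h

lemma covers_seqQ (F G : Psh (Kl V)) : Covers (seqQ F G) := (covers_id F).seq (covers_id G)

/-- The inverse of `seqQ`. -/
def seqQInv (F G : Psh (Kl V)) : (klFunctor V).op ⋙ conv (seqK V) F G ⟶
    conv V.seq.tensor ((klFunctor V).op ⋙ F) ((klFunctor V).op ⋙ G) :=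
  Functor.whiskerLeft (klFunctor V).op (seqDesc (seqModule (resModule F) (resModule G)).res
    (seqModule (resModule F) (resModule G)).res_linear) ≫
      (seqModule (resModule F) (resModule G)).resInv

/-- Sequential convolution on `Kl V` has as underlying presheaf the sequential convolution of the
restrictions. Hence the sequential structure of `V` can be conjugated by `seqQ`, with only linearity
left to check. -/
lemma seqQ_seqQInv (F G : Psh (Kl V)) : seqQ F G ≫ seqQInv F G = 𝟙 _ := by
  rw [seqQInv, ← Category.assoc, seqQ_seqDesc]
  rfl

lemma seqQInv_seqQ (F G : Psh (Kl V)) : seqQInv F G ≫ seqQ F G = 𝟙 _ :=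
  (covers_seqQ F G).eq_of_comp (by rw [← Category.assoc, seqQ_seqQInv]; simp)

lemma nLinear_seqQInv (F G : Psh (Kl V)) :
    NLinear V (resAct (conv (seqK V) F G)) (seqAct (resAct F) (resAct G)) (seqQInv F G) :=
  (nLinear_seqQ F G).inv (seqQ_seqQInv F G) (seqQInv_seqQ F G)

lemma convOver_seqQInv {F G : Psh (Kl V)} {H K : Psh C} (f : H ⟶ (klFunctor V).op ⋙ F)
    (g : K ⟶ (klFunctor V).op ⋙ G) :
    convOver (seqEta V) f g ≫ seqQInv F G = convMap V.seq.tensor f g := by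
  rw [← convMap_seqQ, Category.assoc, seqQ_seqQInv, Category.comp_id]

variable (V) in
/-- The map underlying the sequential associator. -/
def seqAssocMap (F G H : Psh (Kl V)) :
    (klFunctor V).op ⋙ conv (seqK V) (conv (seqK V) F G) H ⟶
      (klFunctor V).op ⋙ conv (seqK V) F (conv (seqK V) G H) :=
  seqQInv _ _ ≫ convMap V.seq.tensor (seqQInv F G) (𝟙 _) ≫ V.seq.assocExt _ _ _ ≫
    convMap V.seq.tensor (𝟙 _) (seqQ G H) ≫ seqQ _ _

variable (V) in
/-- The map underlying the inverse sequential associator. -/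
def seqAssocInvMap (F G H : Psh (Kl V)) :
    (klFunctor V).op ⋙ conv (seqK V) F (conv (seqK V) G H) ⟶
      (klFunctor V).op ⋙ conv (seqK V) (conv (seqK V) F G) H :=
  seqQInv _ _ ≫ convMap V.seq.tensor (𝟙 _) (seqQInv G H) ≫ V.seq.assocInvExt _ _ _ ≫
    convMap V.seq.tensor (seqQ F G) (𝟙 _) ≫ seqQ _ _

lemma convMap_inv_left (P : Split C) {F F' G : Psh C} {f : F ⟶ F'} {g : F' ⟶ F} (h : f ≫ g = 𝟙 _) :
    convMap P f (𝟙 G) ≫ convMap P g (𝟙 G) = 𝟙 _ := by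
  rw [← convMap_comp, h, Category.id_comp, convMap_id]

lemma convMap_inv_right (P : Split C) {F F' G : Psh C} {f : F ⟶ F'} {g : F' ⟶ F} (h : f ≫ g = 𝟙 _) :
    convMap P (𝟙 G) f ≫ convMap P (𝟙 G) g = 𝟙 _ := by
  rw [← convMap_comp, h, Category.id_comp, convMap_id]

lemma seqAssocMap_inv (F G H : Psh (Kl V)) : seqAssocMap V F G H ≫ seqAssocInvMap V F G H = 𝟙 _ := by
  simp only [seqAssocMap, seqAssocInvMap, Category.assoc]
  rw [reassoc_of% (seqQ_seqQInv F (conv (seqK V) G H)),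
    reassoc_of% (convMap_inv_right V.seq.tensor (G := (klFunctor V).op ⋙ F) (seqQ_seqQInv G H)),
    ← V.seq.assocIso_hom, ← V.seq.assocIso_inv, Iso.hom_inv_id_assoc,
    reassoc_of% (convMap_inv_left V.seq.tensor (G := (klFunctor V).op ⋙ H) (seqQInv_seqQ F G)),
    seqQInv_seqQ]

lemma seqAssocInvMap_inv (F G H : Psh (Kl V)) :
    seqAssocInvMap V F G H ≫ seqAssocMap V F G H = 𝟙 _ := by
  simp only [seqAssocMap, seqAssocInvMap, Category.assoc]
  rw [reassoc_of% (seqQ_seqQInv (conv (seqK V) F G) H),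
    reassoc_of% (convMap_inv_left V.seq.tensor (G := (klFunctor V).op ⋙ H) (seqQ_seqQInv F G)),
    ← V.seq.assocIso_hom, ← V.seq.assocIso_inv, Iso.inv_hom_id_assoc,
    reassoc_of% (convMap_inv_right V.seq.tensor (G := (klFunctor V).op ⋙ F) (seqQInv_seqQ G H)),
    seqQInv_seqQ]

lemma nLinear_seqAssocMap (F G H : Psh (Kl V)) :
    NLinear V (resAct _) (resAct _) (seqAssocMap V F G H) :=
  (nLinear_seqQInv _ _).comp (((nLinear_seqQInv F G).seq (nLinear_id _)).comp
    ((nLinear_seqAssoc _ _ _).comp (((nLinear_id _).seq (nLinear_seqQ G H)).comp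
      (nLinear_seqQ _ _))))

variable (V) in
/-- The sequential associator. -/
def seqAssocK (F G H : Psh (Kl V)) :
    conv (seqK V) (conv (seqK V) F G) H ≅ conv (seqK V) F (conv (seqK V) G H) :=
  linIso (seqAssocMap V F G H) (nLinear_seqAssocMap F G H)
    (seqAssocInvMap V F G H) (seqAssocMap_inv F G H) (seqAssocInvMap_inv F G H)

lemma convOver_seqAssocK {F G H : Psh (Kl V)} {F' G' H' : Psh C} (f : F' ⟶ (klFunctor V).op ⋙ F)
    (g : G' ⟶ (klFunctor V).op ⋙ G) (h : H' ⟶ (klFunctor V).op ⋙ H) :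
    convOver (seqEta V) (convOver (seqEta V) f g) h ≫
        Functor.whiskerLeft (klFunctor V).op (seqAssocK V F G H).hom =
      V.seq.assocExt _ _ _ ≫ convOver (seqEta V) f (convOver (seqEta V) g h) := by
  rw [seqAssocK, linIso_hom, whisker_linDesc, seqAssocMap, ← Category.assoc,
    convOver_seqQInv, ← Category.assoc, ← convMap_comp, convOver_seqQInv, Category.comp_id,
    ← Category.assoc, V.seq.assocExt_natural, Category.assoc, ← Category.assoc (convMap _ _ _),
    ← convMap_comp, convMap_seqQ, convMap_seqQ, Category.comp_id]

lemma seqAssocK_natural {F F' G G' H H' : Psh (Kl V)} (f : F ⟶ F') (g : G ⟶ G') (h : H ⟶ H') :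
    convMap (seqK V) (convMap (seqK V) f g) h ≫ (seqAssocK V F' G' H').hom =
      (seqAssocK V F G H).hom ≫ convMap (seqK V) f (convMap (seqK V) g h) := by
  refine (((covers_id F).seq (covers_id G)).seq (covers_id H)).generates.hom_ext ?_
  rw [Functor.whiskerLeft_comp, Functor.whiskerLeft_comp, ← Category.assoc, ← Category.assoc,
    convOver_seqAssocK, convOver_convMap, convOver_convMap, convOver_seqAssocK, Category.assoc,
    convOver_convMap, convOver_convMap]

lemma seqUnitEta_inv : seqUnitEta V ≫ seqUnitEtaInv V = 𝟙 _ := rfl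

lemma seqUnitEtaInv_eta : seqUnitEtaInv V ≫ seqUnitEta V = 𝟙 _ := rfl

lemma covers_seqUnitEta : Covers (seqUnitEta V) := fun _ z => ⟨z, rfl⟩

variable (V) in
/-- The map underlying the sequential left unitor. -/
def seqLeftMap (F : Psh (Kl V)) :
    (klFunctor V).op ⋙ conv (seqK V) (unitK V) F ⟶ (klFunctor V).op ⋙ F :=
  seqQInv _ _ ≫ convMap V.seq.tensor (seqUnitEtaInv V) (𝟙 _) ≫ V.seq.leftExt _

variable (V) in
/-- The map underlying the sequential right unitor. -/
def seqRightMap (F : Psh (Kl V)) :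
    (klFunctor V).op ⋙ conv (seqK V) F (unitK V) ⟶ (klFunctor V).op ⋙ F :=
  seqQInv _ _ ≫ convMap V.seq.tensor (𝟙 _) (seqUnitEtaInv V) ≫ V.seq.rightExt _

lemma nLinear_seqLeftMap (F : Psh (Kl V)) : NLinear V (resAct _) (resAct _) (seqLeftMap V F) :=
  (nLinear_seqQInv _ _).comp ((seqUnitEtaInv_linear.seq (nLinear_id _)).comp (nLinear_seqLeft _))

lemma nLinear_seqRightMap (F : Psh (Kl V)) : NLinear V (resAct _) (resAct _) (seqRightMap V F) :=
  (nLinear_seqQInv _ _).comp (((nLinear_id _).seq seqUnitEtaInv_linear).comp (nLinear_seqRight _))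

variable (V) in
/-- The sequential left unitor. -/
def seqLeftK (F : Psh (Kl V)) : conv (seqK V) (unitK V) F ≅ F :=
  linIso (seqLeftMap V F) (nLinear_seqLeftMap F)
    (V.seq.leftInvExt _ ≫ convMap V.seq.tensor (seqUnitEta V) (𝟙 _) ≫ seqQ _ _) (by
      rw [seqLeftMap, ← V.seq.leftIso_hom, ← V.seq.leftIso_inv]
      simp only [Category.assoc, Iso.hom_inv_id_assoc]
      rw [reassoc_of% (convMap_inv_left V.seq.tensor (G := (klFunctor V).op ⋙ F)
        (seqUnitEtaInv_eta (V := V))), seqQInv_seqQ]) (by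
      rw [seqLeftMap]
      simp only [Category.assoc]
      rw [reassoc_of% (seqQ_seqQInv (unitK V) F), reassoc_of% (convMap_inv_left V.seq.tensor
        (G := (klFunctor V).op ⋙ F) (seqUnitEta_inv (V := V)))]
      exact (V.seq.leftIso _).inv_hom_id)

variable (V) in
/-- The sequential right unitor. -/
def seqRightK (F : Psh (Kl V)) : conv (seqK V) F (unitK V) ≅ F :=
  linIso (seqRightMap V F) (nLinear_seqRightMap F)
    (V.seq.rightInvExt _ ≫ convMap V.seq.tensor (𝟙 _) (seqUnitEta V) ≫ seqQ _ _) (by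
      rw [seqRightMap, ← V.seq.rightIso_hom, ← V.seq.rightIso_inv]
      simp only [Category.assoc, Iso.hom_inv_id_assoc]
      rw [reassoc_of% (convMap_inv_right V.seq.tensor (G := (klFunctor V).op ⋙ F)
        (seqUnitEtaInv_eta (V := V))), seqQInv_seqQ]) (by
      rw [seqRightMap]
      simp only [Category.assoc]
      rw [reassoc_of% (seqQ_seqQInv F (unitK V)), reassoc_of% (convMap_inv_right V.seq.tensor
        (G := (klFunctor V).op ⋙ F) (seqUnitEta_inv (V := V)))]
      exact (V.seq.rightIso _).inv_hom_id)

lemma convOver_seqLeftK {F : Psh (Kl V)} {F' : Psh C} (f : F' ⟶ (klFunctor V).op ⋙ F) :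
    convOver (seqEta V) (seqUnitEta V) f ≫
      Functor.whiskerLeft (klFunctor V).op (seqLeftK V F).hom = V.seq.leftExt _ ≫ f := by
  rw [seqLeftK, linIso_hom, whisker_linDesc, seqLeftMap, ← Category.assoc,
    convOver_seqQInv, ← Category.assoc, ← convMap_comp, seqUnitEta_inv, Category.comp_id,
    V.seq.leftExt_natural]

lemma convOver_seqRightK {F : Psh (Kl V)} {F' : Psh C} (f : F' ⟶ (klFunctor V).op ⋙ F) :
    convOver (seqEta V) f (seqUnitEta V) ≫
      Functor.whiskerLeft (klFunctor V).op (seqRightK V F).hom = V.seq.rightExt _ ≫ f := by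
  rw [seqRightK, linIso_hom, whisker_linDesc, seqRightMap, ← Category.assoc,
    convOver_seqQInv, ← Category.assoc, ← convMap_comp, seqUnitEta_inv, Category.comp_id,
    V.seq.rightExt_natural]

lemma seqLeftK_natural {F F' : Psh (Kl V)} (f : F ⟶ F') :
    convMap (seqK V) (𝟙 (unitK V)) f ≫ (seqLeftK V F').hom = (seqLeftK V F).hom ≫ f := by
  refine (covers_seqUnitEta.seq (covers_id F)).generates.hom_ext ?_
  rw [Functor.whiskerLeft_comp, Functor.whiskerLeft_comp, ← Category.assoc, ← Category.assoc,
    convOver_seqLeftK, convOver_convMap, Functor.whiskerLeft_id', Category.comp_id,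
    convOver_seqLeftK, Category.assoc]

lemma seqRightK_natural {F F' : Psh (Kl V)} (f : F ⟶ F') :
    convMap (seqK V) f (𝟙 (unitK V)) ≫ (seqRightK V F').hom = (seqRightK V F).hom ≫ f := by
  refine ((covers_id F).seq covers_seqUnitEta).generates.hom_ext ?_
  rw [Functor.whiskerLeft_comp, Functor.whiskerLeft_comp, ← Category.assoc, ← Category.assoc,
    convOver_seqRightK, convOver_convMap, Functor.whiskerLeft_id', Category.comp_id,
    convOver_seqRightK, Category.assoc]

variable (V) in
/-- The sequential promonoidal data of the Kleisli category. -/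
def seqDataK : PromonoidalData (Kl V) where
  tensor := seqK V
  unit := unitK V
  assoc A B D := seqAssocK V (yo A) (yo B) (yo D)
  assoc_natural f g h := seqAssocK_natural (yoneda.map f) (yoneda.map g) (yoneda.map h)
  leftUnitor A := seqLeftK V (yo A)
  leftUnitor_natural f := seqLeftK_natural (yoneda.map f)
  rightUnitor A := seqRightK V (yo A)
  rightUnitor_natural f := seqRightK_natural (yoneda.map f)

variable (V)

lemma seqEta_preservesAssoc :
    PreservesAssoc (M := V.seq.toPromonoidalData) (M' := seqDataK V) (seqEta V) := by
  intro A B K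
  rw [← V.seq.assocExt_yo]
  exact convOver_seqAssocK _ _ _

lemma seqEta_preservesLeft :
    PreservesLeft (M := V.seq.toPromonoidalData) (M' := seqDataK V) (seqEta V)
      (seqUnitEta V) := by
  intro A
  rw [← V.seq.leftExt_yo]
  exact convOver_seqLeftK _

lemma seqEta_preservesRight :
    PreservesRight (M := V.seq.toPromonoidalData) (M' := seqDataK V) (seqEta V)
      (seqUnitEta V) := by
  intro A
  rw [← V.seq.rightExt_yo]
  exact convOver_seqRightK _

lemma seqDataK_pentagon (A B D E : Psh (Kl V)) :
    (seqDataK V).assocExt (conv (seqK V) A B) D E ≫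
        (seqDataK V).assocExt A B (conv (seqK V) D E) =
      convMap (seqK V) ((seqDataK V).assocExt A B D) (𝟙 E) ≫
        (seqDataK V).assocExt A (conv (seqK V) B D) E ≫
          convMap (seqK V) (𝟙 A) ((seqDataK V).assocExt B D E) := by
  have hs := seqEta_preservesAssoc V
  have s := fun F : Psh (Kl V) => whiskerSq_id (𝟙 ((klFunctor V).op ⋙ F))
  exact ((((covers_id A).seq (covers_id B)).seq (covers_id D)).seq (covers_id E)).generates.eq_of_sq
    (V.seq.pentagonExt _ _ _ _)
    (whiskerSq_comp (hs.sq _ _ _) (hs.sq _ _ _))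
    (whiskerSq_comp (sqOver _ (hs.sq _ _ _) (s E)) (whiskerSq_comp (hs.sq _ _ _)
      (sqOver _ (s A) (hs.sq _ _ _))))

lemma seqDataK_triangle (A B : Psh (Kl V)) :
    (seqDataK V).assocExt A (unitK V) B ≫ convMap (seqK V) (𝟙 A) ((seqDataK V).leftExt B) =
      convMap (seqK V) ((seqDataK V).rightExt A) (𝟙 B) := by
  have s := fun F : Psh (Kl V) => whiskerSq_id (𝟙 ((klFunctor V).op ⋙ F))
  exact (((covers_id A).seq covers_seqUnitEta).seq (covers_id B)).generates.eq_of_sq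
    (V.seq.triangleExt _ _)
    (whiskerSq_comp ((seqEta_preservesAssoc V).sq _ _ _)
      (sqOver _ (s A) ((seqEta_preservesLeft V).sq _)))
    (sqOver _ ((seqEta_preservesRight V).sq _) (s B))

/-- The sequential promonoidal structure of the Kleisli category. -/
def seqPK : Promonoidal (Kl V) where
  toPromonoidalData := seqDataK V
  pentagon A B D E := by
    rw [← PromonoidalData.assocExt_yo, ← PromonoidalData.assocExt_yo]
    exact seqDataK_pentagon V (yo A) (yo B) (yo D) (yo E)
  triangle A B := by
    rw [← PromonoidalData.leftExt_yo, ← PromonoidalData.rightExt_yo]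
    exact seqDataK_triangle V (yo A) (yo B)

end SequentialStructure

/-! ### The laxators of the Kleisli category and the duoidal coherence equations. -/

section Laxators

variable {C : Type u} [SmallCategory C] {V : SymProduoidalCat C}

section

variable {M₁ M₂ M₃ L₁ L₂ L₃ : Psh C} {a₁ : conv V.par.tensor V.seq.unit M₁ ⟶ M₁}
  {a₂ : conv V.par.tensor V.seq.unit M₂ ⟶ M₂} {a₃ : conv V.par.tensor V.seq.unit M₃ ⟶ M₃}
  {c₁ : conv V.par.tensor V.seq.unit L₁ ⟶ L₁} {c₂ : conv V.par.tensor V.seq.unit L₂ ⟶ L₂}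
  {c₃ : conv V.par.tensor V.seq.unit L₃ ⟶ L₃}
  {b : conv V.par.tensor M₁ M₂ ⟶ M₃} {d : conv V.par.tensor L₁ L₂ ⟶ L₃}

/-- The duplicated scalar is carried through `ψ₂` by its associativity for `⊗`; each copy is then
extracted by linearity of `b` or `d`. -/
lemma psi2_left (h : NBilinear V a₁ a₂ a₃ b) (k : NBilinear V c₁ c₂ c₃ d) :
    convMap V.par.tensor (seqAct a₁ c₁) (𝟙 (conv V.seq.tensor M₂ L₂)) ≫
        V.psi2Ext _ _ _ _ ≫ convMap V.seq.tensor b d =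
      V.par.assocExt _ _ _ ≫ convMap V.par.tensor (𝟙 V.seq.unit)
        (V.psi2Ext _ _ _ _ ≫ convMap V.seq.tensor b d) ≫ seqAct a₃ c₃ := by
  have e1 : convMap V.par.tensor (seqAct a₁ c₁) (𝟙 (conv V.seq.tensor M₂ L₂)) =
      convMap V.par.tensor (convMap V.par.tensor (seqDelta V) (𝟙 _)) (𝟙 _) ≫
        convMap V.par.tensor (V.psi2Ext _ _ _ _) (𝟙 _) ≫
          convMap V.par.tensor (convMap V.seq.tensor a₁ c₁) (𝟙 _) := by
    simp only [seqAct, ← convMap_comp, Category.comp_id]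
  have e2 : convMap V.par.tensor (𝟙 V.seq.unit)
      (V.psi2Ext M₁ L₁ M₂ L₂ ≫ convMap V.seq.tensor b d) ≫ seqAct a₃ c₃ =
      convMap V.par.tensor (seqDelta V) (𝟙 _) ≫ convMap V.par.tensor (𝟙 _)
        (V.psi2Ext M₁ L₁ M₂ L₂) ≫ V.psi2Ext _ _ _ _ ≫ convMap V.seq.tensor
          (convMap V.par.tensor (𝟙 _) b) (convMap V.par.tensor (𝟙 _) d) ≫
            convMap V.seq.tensor a₃ c₃ := by
    rw [seqAct, ← reassoc_of% (psi2Ext_natural_right (V := V) (F := V.seq.unit)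
      (G := V.seq.unit) b d)]
    simp only [← Category.assoc, ← convMap_comp, Category.comp_id, Category.id_comp]
  rw [e1, e2, Category.assoc, Category.assoc, reassoc_of% (psi2Ext_natural_left (V := V)
    (H := M₂) (K := L₂) a₁ c₁), ← convMap_comp, h.left, k.left, convMap_comp, convMap_comp,
    ← reassoc_of% (V.psi2_par_assocExt V.seq.unit V.seq.unit M₁ L₁ M₂ L₂),
    reassoc_of% (V.par.assocExt_natural (seqDelta V) (𝟙 (conv V.seq.tensor M₁ L₁))
      (𝟙 (conv V.seq.tensor M₂ L₂))), convMap_id]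

/-- Compatibility of `ψ₂` with `σ` identifies the braided map with the same construction applied to
the braidings of `b` and `d`, so `psi2_left` covers both variables. -/
lemma nBilinear_psi2 (h : NBilinear V a₁ a₂ a₃ b) (k : NBilinear V c₁ c₂ c₃ d) :
    NBilinear V (seqAct a₁ c₁) (seqAct a₂ c₂) (seqAct a₃ c₃)
      (V.psi2Ext _ _ _ _ ≫ convMap V.seq.tensor b d) := by
  refine nBilinear_of_left (psi2_left h k) ?_
  rw [reassoc_of% (V.psi2_symExt M₂ L₂ M₁ L₁), ← convMap_comp]
  exact psi2_left h.braid k.braid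

end

variable (V)

/-- The map underlying the laxator `ψ₂`. -/
def psi2Map (F G H K : Psh (Kl V)) :
    conv V.par.tensor ((klFunctor V).op ⋙ conv (seqK V) F G)
      ((klFunctor V).op ⋙ conv (seqK V) H K) ⟶
        (klFunctor V).op ⋙ conv (seqK V) (conv (parK V) F H) (conv (parK V) G K) :=
  convMap V.par.tensor (seqQInv F G) (seqQInv H K) ≫
    (V.psi2Ext _ _ _ _ ≫ convMap V.seq.tensor (parQ F H) (parQ G K)) ≫ seqQ _ _

lemma nBilinear_psi2Map (F G H K : Psh (Kl V)) :
    NBilinear V (resAct _) (resAct _) (resAct _) (psi2Map V F G H K) :=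
  ((nBilinear_psi2 (nBilinear_parQ F H) (nBilinear_parQ G K)).comp (nLinear_seqQ _ _)).precomp
    (nLinear_seqQInv F G) (nLinear_seqQInv H K)

/-- The laxator `ψ₂` of the Kleisli category. -/
def psi2K (F G H K : Psh (Kl V)) :
    conv (parK V) (conv (seqK V) F G) (conv (seqK V) H K) ⟶
      conv (seqK V) (conv (parK V) F H) (conv (parK V) G K) :=
  parDesc (psi2Map V F G H K) (nBilinear_psi2Map V F G H K)

variable {V} in
lemma convOver_psi2K {F G H K : Psh (Kl V)} {F' G' H' K' : Psh C}
    (f : F' ⟶ (klFunctor V).op ⋙ F) (g : G' ⟶ (klFunctor V).op ⋙ G)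
    (h : H' ⟶ (klFunctor V).op ⋙ H) (k : K' ⟶ (klFunctor V).op ⋙ K) :
    convOver (parEta V) (convOver (seqEta V) f g) (convOver (seqEta V) h k) ≫
        Functor.whiskerLeft (klFunctor V).op (psi2K V F G H K) =
      V.psi2Ext _ _ _ _ ≫ convOver (seqEta V) (convOver (parEta V) f h)
        (convOver (parEta V) g k) := by
  rw [psi2K, convOver_parDesc, psi2Map, ← Category.assoc, ← convMap_comp, convOver_seqQInv,
    convOver_seqQInv, Category.assoc, reassoc_of% (psi2Ext_natural (V := V) f g h k),
    ← Category.assoc (convMap _ _ _), ← convMap_comp, convMap_parQ, convMap_parQ, convMap_seqQ]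

variable {V} in
lemma psi2K_natural {F G H K F' G' H' K' : Psh (Kl V)} (f : F ⟶ F') (g : G ⟶ G') (h : H ⟶ H')
    (k : K ⟶ K') :
    convMap (parK V) (convMap (seqK V) f g) (convMap (seqK V) h k) ≫ psi2K V F' G' H' K' =
      psi2K V F G H K ≫ convMap (seqK V) (convMap (parK V) f h) (convMap (parK V) g k) := by
  refine (((covers_id F).seq (covers_id G)).generates.par
    ((covers_id H).seq (covers_id K)).generates).hom_ext ?_
  rw [Functor.whiskerLeft_comp, Functor.whiskerLeft_comp, ← Category.assoc, ← Category.assoc,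
    convOver_psi2K]
  simp only [convOver_convMap]
  rw [convOver_psi2K]
  simp only [Category.assoc, convOver_convMap]

/-- The laxator `ψ₀` of the Kleisli category. -/
def psi0K : unitK V ⟶ conv (seqK V) (unitK V) (unitK V) :=
  (unitModule V).desc (seqDelta V ≫ convMap V.seq.tensor (seqUnitEta V) (seqUnitEta V) ≫
    seqQ _ _) (nLinear_seqDelta.comp (((unitModule V).res_linear.seq
      (unitModule V).res_linear).comp (nLinear_seqQ _ _)))

lemma sq_psi0K : CommSq V.psi0 (parUnitEta V)
    (convOver (seqEta V) (parUnitEta V) (parUnitEta V))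
    (Functor.whiskerLeft (klFunctor V).op (psi0K V)) := by
  refine ⟨?_⟩
  have h : seqUnitEta V ≫ Functor.whiskerLeft (klFunctor V).op (psi0K V) =
    seqDelta V ≫ convMap V.seq.tensor (seqUnitEta V) (seqUnitEta V) ≫ seqQ _ _ := rfl
  rw [parUnitEta, Category.assoc, h, reassoc_of% (phi0_seqDelta V), convMap_seqQ,
    convMap_convOver]

lemma seqUnitEta_phi2 : convOver (parEta V) (seqUnitEta V) (seqUnitEta V) ≫
    Functor.whiskerLeft (klFunctor V).op (klLeft V (unitK V)) = V.phi2 ≫ seqUnitEta V := by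
  rw [seqUnitEta_klLeft]
  exact (unitModule V).res_linear.symm

lemma sq_phi2K : CommSq V.phi2 (convOver (parEta V) (seqUnitEta V) (seqUnitEta V))
    (seqUnitEta V) (Functor.whiskerLeft (klFunctor V).op (klLeft V (unitK V))) :=
  ⟨(seqUnitEta_phi2 V).symm⟩

lemma sq_phi0K : CommSq V.phi0 (parUnitEta V) (seqUnitEta V)
    (Functor.whiskerLeft (klFunctor V).op (𝟙 (unitK V))) := ⟨rfl⟩

/-- The produoidal data of the Kleisli category. -/
def duoDataK : DuoData (Kl V) where
  par := parPK V
  seq := seqPK V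
  psi2 X Y Z W := psi2K V (yo X) (yo Y) (yo Z) (yo W)
  psi2_natural f g h k :=
    psi2K_natural (yoneda.map f) (yoneda.map g) (yoneda.map h) (yoneda.map k)
  psi0 := psi0K V
  phi2 := klLeft V (unitK V)
  -- Both units of the Kleisli category are the presheaf `N`, so normality holds strictly.
  phi0 := 𝟙 (unitK V)

lemma preservesPsi2_eta :
    PreservesPsi2 (V := V.toDuoData) (W := duoDataK V) (parEta V) (seqEta V) := by
  intro A B K L
  rw [← V.psi2Ext_yo]
  exact convOver_psi2K _ _ _ _

section Coherence

variable (A B D E F G : Psh (Kl V))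

/-- This and the following axioms are pasted from the squares over the structure maps of `V`. For
`◁` the left side covers elementwise; it generates again after a parallel convolution. Unit slots
use `parUnitEta` or `seqUnitEta` according to the unit of `V` that occurs in the axiom. -/
lemma psi2K_par_assoc :
    (parDataK V).assocExt (conv (seqK V) A B) (conv (seqK V) D E) (conv (seqK V) F G) ≫
      convMap (parK V) (𝟙 _) ((duoDataK V).psi2Ext D E F G) ≫
        (duoDataK V).psi2Ext A B (conv (parK V) D F) (conv (parK V) E G) =
    convMap (parK V) ((duoDataK V).psi2Ext A B D E) (𝟙 _) ≫
      (duoDataK V).psi2Ext (conv (parK V) A D) (conv (parK V) B E) F G ≫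
        convMap (seqK V) ((parDataK V).assocExt A D F) ((parDataK V).assocExt B E G) := by
  have hp := preservesPsi2_eta V
  have ha := parEta_preservesAssoc V
  have c := covers_id (V := V)
  exact ((((c A).seq (c B)).generates.par ((c D).seq (c E)).generates).par
    ((c F).seq (c G)).generates).eq_of_sq (V.psi2_par_assocExt _ _ _ _ _ _)
    (whiskerSq_comp (ha.sq _ _ _) (whiskerSq_comp (sqOver _ (whiskerSq_id _) (hp.sq _ _ _ _))
      (hp.sq _ _ _ _)))
    (whiskerSq_comp (sqOver _ (hp.sq _ _ _ _) (whiskerSq_id _)) (whiskerSq_comp (hp.sq _ _ _ _)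
      (sqOver _ (ha.sq _ _ _) (ha.sq _ _ _))))

lemma psi2K_seq_assoc :
    convMap (parK V) ((seqDataK V).assocExt A B D) ((seqDataK V).assocExt E F G) ≫
      (duoDataK V).psi2Ext A (conv (seqK V) B D) E (conv (seqK V) F G) ≫
        convMap (seqK V) (𝟙 _) ((duoDataK V).psi2Ext B D F G) =
    (duoDataK V).psi2Ext (conv (seqK V) A B) D (conv (seqK V) E F) G ≫
      convMap (seqK V) ((duoDataK V).psi2Ext A B E F) (𝟙 _) ≫
        (seqDataK V).assocExt (conv (parK V) A E) (conv (parK V) B F) (conv (parK V) D G) := by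
  have hp := preservesPsi2_eta V
  have ha := seqEta_preservesAssoc V
  have c := covers_id (V := V)
  exact ((((c A).seq (c B)).seq (c D)).generates.par
    (((c E).seq (c F)).seq (c G)).generates).eq_of_sq (V.psi2_seq_assocExt _ _ _ _ _ _)
    (whiskerSq_comp (sqOver _ (ha.sq _ _ _) (ha.sq _ _ _)) (whiskerSq_comp (hp.sq _ _ _ _)
      (sqOver _ (whiskerSq_id _) (hp.sq _ _ _ _))))
    (whiskerSq_comp (hp.sq _ _ _ _) (whiskerSq_comp (sqOver _ (hp.sq _ _ _ _) (whiskerSq_id _))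
      (ha.sq _ _ _)))

lemma psi2K_par_left :
    convMap (parK V) (psi0K V) (𝟙 (conv (seqK V) A B)) ≫
      (duoDataK V).psi2Ext (unitK V) (unitK V) A B ≫
        convMap (seqK V) ((parDataK V).leftExt A) ((parDataK V).leftExt B) =
    (parDataK V).leftExt (conv (seqK V) A B) := by
  have hl := parEta_preservesLeft V
  exact (generates_parUnitEta.par ((covers_id A).seq (covers_id B)).generates).eq_of_sq
    (V.psi2_par_leftExt _ _)
    (whiskerSq_comp (sqOver _ (sq_psi0K V) (whiskerSq_id _)) (whiskerSq_comp
      ((preservesPsi2_eta V).sq _ _ _ _) (sqOver _ (hl.sq _) (hl.sq _))))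
    (hl.sq _)

lemma psi2K_par_right :
    convMap (parK V) (𝟙 (conv (seqK V) A B)) (psi0K V) ≫
      (duoDataK V).psi2Ext A B (unitK V) (unitK V) ≫
        convMap (seqK V) ((parDataK V).rightExt A) ((parDataK V).rightExt B) =
    (parDataK V).rightExt (conv (seqK V) A B) := by
  have hl := parEta_preservesRight V
  exact (((covers_id A).seq (covers_id B)).generates.par generates_parUnitEta).eq_of_sq
    (V.psi2_par_rightExt _ _)
    (whiskerSq_comp (sqOver _ (whiskerSq_id _) (sq_psi0K V)) (whiskerSq_comp
      ((preservesPsi2_eta V).sq _ _ _ _) (sqOver _ (hl.sq _) (hl.sq _))))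
    (hl.sq _)

lemma psi2K_seq_left :
    (duoDataK V).psi2Ext (unitK V) A (unitK V) B ≫
      convMap (seqK V) (klLeft V (unitK V)) (𝟙 (conv (parK V) A B)) ≫
        (seqDataK V).leftExt (conv (parK V) A B) =
    convMap (parK V) ((seqDataK V).leftExt A) ((seqDataK V).leftExt B) := by
  have hl := seqEta_preservesLeft V
  have c := covers_seqUnitEta (V := V)
  exact ((c.seq (covers_id A)).generates.par (c.seq (covers_id B)).generates).eq_of_sq
    (V.psi2_seq_leftExt _ _)
    (whiskerSq_comp ((preservesPsi2_eta V).sq _ _ _ _) (whiskerSq_comp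
      (sqOver _ (sq_phi2K V) (whiskerSq_id _)) (hl.sq _)))
    (sqOver _ (hl.sq _) (hl.sq _))

lemma psi2K_seq_right :
    (duoDataK V).psi2Ext A (unitK V) B (unitK V) ≫
      convMap (seqK V) (𝟙 (conv (parK V) A B)) (klLeft V (unitK V)) ≫
        (seqDataK V).rightExt (conv (parK V) A B) =
    convMap (parK V) ((seqDataK V).rightExt A) ((seqDataK V).rightExt B) := by
  have hl := seqEta_preservesRight V
  have c := covers_seqUnitEta (V := V)
  exact (((covers_id A).seq c).generates.par ((covers_id B).seq c).generates).eq_of_sq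
    (V.psi2_seq_rightExt _ _)
    (whiskerSq_comp ((preservesPsi2_eta V).sq _ _ _ _) (whiskerSq_comp
      (sqOver _ (whiskerSq_id _) (sq_phi2K V)) (hl.sq _)))
    (sqOver _ (hl.sq _) (hl.sq _))

lemma phi2K_assoc :
    (parDataK V).assocExt (unitK V) (unitK V) (unitK V) ≫
        convMap (parK V) (𝟙 (unitK V)) (klLeft V (unitK V)) ≫ klLeft V (unitK V) =
      convMap (parK V) (klLeft V (unitK V)) (𝟙 (unitK V)) ≫ klLeft V (unitK V) := by
  have c := (covers_seqUnitEta (V := V)).generates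
  exact ((c.par c).par c).eq_of_sq V.phi2_assoc
    (whiskerSq_comp ((parEta_preservesAssoc V).sq _ _ _)
      (whiskerSq_comp (sqOver _ (whiskerSq_id _) (sq_phi2K V)) (sq_phi2K V)))
    (whiskerSq_comp (sqOver _ (sq_phi2K V) (whiskerSq_id _)) (sq_phi2K V))

lemma psi0K_coassoc :
    psi0K V ≫ convMap (seqK V) (psi0K V) (𝟙 (unitK V)) ≫
        (seqDataK V).assocExt (unitK V) (unitK V) (unitK V) =
      psi0K V ≫ convMap (seqK V) (𝟙 (unitK V)) (psi0K V) :=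
  generates_parUnitEta.eq_of_sq V.psi0_coassoc
    (whiskerSq_comp (sq_psi0K V) (whiskerSq_comp (sqOver _ (sq_psi0K V) (whiskerSq_id _))
      ((seqEta_preservesAssoc V).sq _ _ _)))
    (whiskerSq_comp (sq_psi0K V) (sqOver _ (whiskerSq_id _) (sq_psi0K V)))

lemma phi2K_right :
    convMap (parK V) (𝟙 (unitK V)) (𝟙 (unitK V)) ≫ klLeft V (unitK V) =
      (parDataK V).rightExt (unitK V) :=
  (covers_seqUnitEta.generates.par generates_parUnitEta).eq_of_sq V.phi2_right
    (whiskerSq_comp (sqOver _ (whiskerSq_id _) (sq_phi0K V)) (sq_phi2K V))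
    ((parEta_preservesRight V).sq _)

lemma phi2K_left :
    convMap (parK V) (𝟙 (unitK V)) (𝟙 (unitK V)) ≫ klLeft V (unitK V) =
      (parDataK V).leftExt (unitK V) :=
  (generates_parUnitEta.par covers_seqUnitEta.generates).eq_of_sq V.phi2_left
    (whiskerSq_comp (sqOver _ (sq_phi0K V) (whiskerSq_id _)) (sq_phi2K V))
    ((parEta_preservesLeft V).sq _)

lemma psi0K_right :
    psi0K V ≫ convMap (seqK V) (𝟙 (unitK V)) (𝟙 (unitK V)) ≫ (seqDataK V).rightExt (unitK V) =
      𝟙 (unitK V) :=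
  generates_parUnitEta.eq_of_sq V.psi0_right
    (whiskerSq_comp (sq_psi0K V) (whiskerSq_comp (sqOver _ (whiskerSq_id _) (sq_phi0K V))
      ((seqEta_preservesRight V).sq _)))
    (whiskerSq_id _)

lemma psi0K_left :
    psi0K V ≫ convMap (seqK V) (𝟙 (unitK V)) (𝟙 (unitK V)) ≫ (seqDataK V).leftExt (unitK V) =
      𝟙 (unitK V) :=
  generates_parUnitEta.eq_of_sq V.psi0_left
    (whiskerSq_comp (sq_psi0K V) (whiskerSq_comp (sqOver _ (sq_phi0K V) (whiskerSq_id _))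
      ((seqEta_preservesLeft V).sq _)))
    (whiskerSq_id _)

lemma psi2K_sym :
    (klSym V).ext (conv (seqK V) A B) (conv (seqK V) D E) ≫ (duoDataK V).psi2Ext D E A B =
      (duoDataK V).psi2Ext A B D E ≫
        convMap (seqK V) ((klSym V).ext A D) ((klSym V).ext B E) := by
  have hp := preservesPsi2_eta V
  have hs := parEta_preservesSym (V := V)
  have c := covers_id (V := V)
  exact (((c A).seq (c B)).generates.par ((c D).seq (c E)).generates).eq_of_sq
    (V.psi2_symExt _ _ _ _)
    (whiskerSq_comp (hs.sq _ _) (hp.sq _ _ _ _))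
    (whiskerSq_comp (hp.sq _ _ _ _) (sqOver _ (hs.sq _ _) (hs.sq _ _)))

lemma phi2K_sym :
    (klSym V).ext (unitK V) (unitK V) ≫ klLeft V (unitK V) = klLeft V (unitK V) := by
  have c := (covers_seqUnitEta (V := V)).generates
  exact (c.par c).eq_of_sq V.phi2_sym
    (whiskerSq_comp ((parEta_preservesSym (V := V)).sq _ _) (sq_phi2K V)) (sq_phi2K V)

end Coherence

/-- The symmetric normalization, as a symmetric produoidal structure on the Kleisli category of the
promonad `V(•; N ⊗ •)`. -/
def symK : SymProduoidalCat (Kl V) where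
  toDuoData := duoDataK V
  psi2_par_assoc A B D E F G := by
    simp only [← PromonoidalData.assocExt_yo, ← DuoData.psi2Ext_yo]
    exact psi2K_par_assoc V (yo A) (yo B) (yo D) (yo E) (yo F) (yo G)
  psi2_seq_assoc A B D E F G := by
    simp only [← PromonoidalData.assocExt_yo, ← DuoData.psi2Ext_yo]
    exact psi2K_seq_assoc V (yo A) (yo B) (yo D) (yo E) (yo F) (yo G)
  psi2_par_left A B := by
    simp only [← PromonoidalData.leftExt_yo]
    exact psi2K_par_left V (yo A) (yo B)
  psi2_par_right A B := by
    simp only [← PromonoidalData.rightExt_yo]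
    exact psi2K_par_right V (yo A) (yo B)
  psi2_seq_left A B := by
    simp only [← PromonoidalData.leftExt_yo]
    exact psi2K_seq_left V (yo A) (yo B)
  psi2_seq_right A B := by
    simp only [← PromonoidalData.rightExt_yo]
    exact psi2K_seq_right V (yo A) (yo B)
  phi2_assoc := phi2K_assoc V
  psi0_coassoc := psi0K_coassoc V
  phi2_right := phi2K_right V
  phi2_left := phi2K_left V
  psi0_right := psi0K_right V
  psi0_left := psi0K_left V
  sym := klSym V
  hexagon A B D := by
    simp only [← PromonoidalData.assocExt_yo]
    exact parDataK_hexagon V A B D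
  psi2_sym X Y Z W := by
    simp only [← DuoData.psi2Ext_yo]
    exact psi2K_sym V (yo X) (yo Y) (yo Z) (yo W)
  phi2_sym := phi2K_sym V

end Laxators

/-! ### The normalization and its unit `η`. -/

section Unit

/-- The symmetric normalization of a symmetric produoidal category. -/
def normalization (V : SymProduo.{u}) : SymProduo.{u} where
  carrier := Kl V.str
  str := symK V.str

lemma isNormal_normalization (V : SymProduo.{u}) : isNormal (normalization V) :=
  inferInstanceAs (IsIso (𝟙 (unitK V.str)))

/-- The canonical symmetric produoidal functor to the symmetric normalization. -/
def normEta (V : SymProduo.{u}) : V ⟶ normalization V :=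
  { functor := klFunctor V.str
    par :=
      { split := parEta V.str
        unit := parUnitEta V.str
        map_assoc := parEta_preservesAssoc V.str
        map_left := parEta_preservesLeft V.str
        map_right := parEta_preservesRight V.str }
    seq :=
      { split := seqEta V.str
        unit := seqUnitEta V.str
        map_assoc := seqEta_preservesAssoc V.str
        map_left := seqEta_preservesLeft V.str
        map_right := seqEta_preservesRight V.str }
    map_psi2 := preservesPsi2_eta V.str
    map_psi0 := (sq_psi0K V.str).w.symm
    map_phi2 := (sq_phi2K V.str).w.symm
    map_phi0 := rfl
    map_sym := parEta_preservesSym }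

end Unit

/-! ### Modules obtained by restriction along a functor to a normal category. -/

section Comparison

variable {V W : SymProduo.{u}} (hW : isNormal W) (F : V ⟶ W)

lemma cmpUnit_phi0 :
    cmpUnit hW F ≫ Functor.whiskerLeft F.functor.op W.str.phi0 = F.seq.unit := by
  haveI : IsIso W.str.phi0 := hW
  have h : Functor.whiskerLeft F.functor.op (inv W.str.phi0) ≫
      Functor.whiskerLeft F.functor.op W.str.phi0 = 𝟙 _ := by
    rw [← Functor.whiskerLeft_comp, IsIso.inv_hom_id, Functor.whiskerLeft_id']
  exact (congrArg (fun t => F.seq.unit ≫ t) h).trans (Category.comp_id _)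

/-- Identities about `cmpUnit` are tested after the invertible `φ₀` of `W`, where `cmpUnit` becomes
the given `F_N`. -/
lemma whisker_phi0_cancel (hW : isNormal W) (F : V ⟶ W) {G : Psh V.carrier} {s t : G ⟶ F.functor.op ⋙ W.str.par.unit}
    (h : s ≫ Functor.whiskerLeft F.functor.op W.str.phi0 =
      t ≫ Functor.whiskerLeft F.functor.op W.str.phi0) : s = t := by
  haveI : IsIso W.str.phi0 := hW
  have h2 := h =≫ Functor.whiskerLeft F.functor.op (inv W.str.phi0)
  simpa only [Category.assoc, ← Functor.whiskerLeft_comp, IsIso.hom_inv_id,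
    Functor.whiskerLeft_id', Category.comp_id] using h2

lemma phi0_cmpUnit : V.str.phi0 ≫ cmpUnit hW F = F.par.unit :=
  whisker_phi0_cancel hW F (by rw [Category.assoc, cmpUnit_phi0, F.map_phi0])

lemma phi0_phi0_phi2 (W : SymProduo.{u}) :
    convMap W.str.par.tensor W.str.phi0 W.str.phi0 ≫ W.str.phi2 =
      W.str.par.rightExt _ ≫ W.str.phi0 := by
  rw [← W.str.par.rightExt_natural, ← W.str.phi2_right, ← Category.assoc, ← convMap_comp,
    Category.comp_id, Category.id_comp]

/-- Multiplicativity of `cmpUnit`: with `phi0_cmpUnit` it makes `cmpUnit` a monoid map from `N` to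
the restriction of `I`. After `φ₀` it is preservation of `φ₂` by `F`. -/
lemma phi2_cmpUnit : V.str.phi2 ≫ cmpUnit hW F =
    convOver F.par.split (cmpUnit hW F) (cmpUnit hW F) ≫
      Functor.whiskerLeft F.functor.op (W.str.par.rightExt _) :=
  whisker_phi0_cancel hW F (by
    rw [Category.assoc, Category.assoc, cmpUnit_phi0, ← F.map_phi2, ← Functor.whiskerLeft_comp,
      ← phi0_phi0_phi2, Functor.whiskerLeft_comp, ← Category.assoc, convOver_convMap,
      cmpUnit_phi0])

lemma cmp_eq {G : Psh V.carrier} {G' : Psh W.carrier} (a : G ⟶ F.functor.op ⋙ G') :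
    cmp hW F a = nLift V.str (cmp hW F (𝟙 (F.functor.op ⋙ G'))) a := by
  rw [nLift, cmp, cmp, ← Category.assoc, convMap_convOver, Category.comp_id, Category.id_comp]

lemma cmp_whisker {G : Psh V.carrier} {G' G'' : Psh W.carrier} (a : G ⟶ F.functor.op ⋙ G')
    (t : G' ⟶ G'') : cmp hW F (a ≫ Functor.whiskerLeft F.functor.op t) =
      cmp hW F a ≫ Functor.whiskerLeft F.functor.op t := by
  rw [cmp, cmp, Category.assoc, ← Functor.whiskerLeft_comp, ← W.str.par.leftExt_natural,
    Functor.whiskerLeft_comp, ← Category.assoc (convOver _ _ _), convOver_convMap,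
    Functor.whiskerLeft_id', Category.comp_id]

/-- The action of `N` on the restriction of a presheaf along a functor to a normal symmetric
produoidal category. -/
noncomputable abbrev cmpAct (G' : Psh W.carrier) :
    conv V.str.par.tensor V.str.seq.unit (F.functor.op ⋙ G') ⟶ F.functor.op ⋙ G' :=
  cmp hW F (𝟙 (F.functor.op ⋙ G'))

lemma cmp_phi0 {G : Psh V.carrier} {G' : Psh W.carrier} (a : G ⟶ F.functor.op ⋙ G') :
    convMap V.str.par.tensor V.str.phi0 (𝟙 _) ≫ cmp hW F a = V.str.par.leftExt _ ≫ a := by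
  have h := (PreservesLeft.sq (M := V.str.par.toPromonoidalData) F.par.map_left a).w
  rw [cmp, ← Category.assoc, convMap_convOver, phi0_cmpUnit, Category.id_comp, h]

lemma associator_leftUnitor {D : Type*} [Category D] [MonoidalCategory D] (F G : D) :
    (MonoidalCategory.associator (MonoidalCategory.tensorUnit D) F G).hom ≫
        (MonoidalCategory.leftUnitor (MonoidalCategory.tensorObj F G)).hom =
      MonoidalCategory.tensorHom (MonoidalCategory.leftUnitor F).hom (𝟙 G) := by
  simp

lemma triangle_leftExt (M : Promonoidal W.carrier) (F G : Psh W.carrier) :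
    M.assocExt M.unit F G ≫ M.leftExt _ = convMap M.tensor (M.leftExt F) (𝟙 G) := by
  letI := M.monoidalCategory
  exact associator_leftUnitor F G

/-- The canonical action of `I` on `G'` in `W`, restricted along the monoid map `cmpUnit`.
Associativity combines preservation of associators by `F` with the triangle in `W`. -/
lemma nAction_cmpAct (G' : Psh W.carrier) : NAction V.str (cmpAct hW F G') := by
  refine .of_left ?_ ?_
  · have h := (PreservesAssoc.sq (M := V.str.par.toPromonoidalData) F.par.map_assoc (cmpUnit hW F)
      (cmpUnit hW F) (𝟙 (F.functor.op ⋙ G'))).w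
    have e := cmp_eq hW F (cmpAct hW F G')
    rw [nLift] at e
    rw [← e, cmpAct, cmp, cmp]
    have e1 : convOver F.par.split (cmpUnit hW F) (convOver F.par.split (cmpUnit hW F)
        (𝟙 (F.functor.op ⋙ G')) ≫ Functor.whiskerLeft F.functor.op (W.str.par.leftExt G')) =
        convOver F.par.split (cmpUnit hW F) (convOver F.par.split (cmpUnit hW F)
        (𝟙 (F.functor.op ⋙ G'))) ≫ Functor.whiskerLeft F.functor.op
          (convMap W.str.par.tensor (𝟙 _) (W.str.par.leftExt G')) := by
      rw [convOver_convMap, Functor.whiskerLeft_id', Category.comp_id]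
    have e2 : convOver F.par.split (convOver F.par.split (cmpUnit hW F) (cmpUnit hW F))
        (𝟙 (F.functor.op ⋙ G')) ≫ Functor.whiskerLeft F.functor.op
          (convMap W.str.par.tensor (W.str.par.rightExt _) (𝟙 G')) =
        convMap V.str.par.tensor V.str.phi2 (𝟙 _) ≫
          convOver F.par.split (cmpUnit hW F) (𝟙 (F.functor.op ⋙ G')) := by
      rw [convOver_convMap, ← phi2_cmpUnit, convMap_convOver, Functor.whiskerLeft_id']
    rw [e1, Category.assoc, reassoc_of% h, ← Functor.whiskerLeft_comp, ← Functor.whiskerLeft_comp,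
      reassoc_of% (W.str.par.triangleExt W.str.par.unit G'), Functor.whiskerLeft_comp,
      reassoc_of% e2]
  · rw [cmp_phi0, Category.comp_id]

lemma whisker_cmpAct {G' G'' : Psh W.carrier} (t : G' ⟶ G'') :
    NLinear V.str (cmpAct hW F G') (cmpAct hW F G'') (Functor.whiskerLeft F.functor.op t) := by
  unfold NLinear
  rw [cmpAct, ← cmp_whisker, Category.id_comp, cmp_eq, nLift]

lemma cmpAct_par_left (G H : Psh W.carrier) :
    convMap V.str.par.tensor (cmpAct hW F G) (𝟙 _) ≫
        convOver F.par.split (𝟙 (F.functor.op ⋙ G)) (𝟙 (F.functor.op ⋙ H)) =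
      V.str.par.assocExt _ _ _ ≫ convMap V.str.par.tensor (𝟙 _)
        (convOver F.par.split (𝟙 (F.functor.op ⋙ G)) (𝟙 (F.functor.op ⋙ H))) ≫
          cmpAct hW F _ := by
  have h := (PreservesAssoc.sq (M := V.str.par.toPromonoidalData) F.par.map_assoc (cmpUnit hW F)
      (𝟙 (F.functor.op ⋙ G)) (𝟙 (F.functor.op ⋙ H))).w
  have e := cmp_eq hW F (convOver F.par.split (𝟙 (F.functor.op ⋙ G)) (𝟙 (F.functor.op ⋙ H)))
  rw [nLift] at e
  rw [← e, cmp, reassoc_of% h, ← Functor.whiskerLeft_comp]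
  have t := triangle_leftExt W.str.par G H
  refine Eq.trans ?_ (congrArg (fun k => convOver F.par.split (convOver F.par.split (cmpUnit hW F)
    (𝟙 (F.functor.op ⋙ G))) (𝟙 (F.functor.op ⋙ H)) ≫
      Functor.whiskerLeft F.functor.op k) t).symm
  rw [convOver_convMap, convMap_convOver, cmpAct, cmp, Functor.whiskerLeft_id', Category.comp_id]

/-- On the left, a scalar is moved out by preservation of associators and then removed by the unitor
of `W`. The right follows because `F` preserves the symmetry. -/
lemma nBilinear_cmpAct (G H : Psh W.carrier) :
    NBilinear V.str (cmpAct hW F G) (cmpAct hW F H) (cmpAct hW F _)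
      (convOver F.par.split (𝟙 (F.functor.op ⋙ G)) (𝟙 (F.functor.op ⋙ H))) := by
  refine nBilinear_of_left (cmpAct_par_left hW F G H) ?_
  have hs : PreservesSym V.str.sym W.str.sym F.par.split := F.map_sym
  have h := (hs.sq (𝟙 (F.functor.op ⋙ H)) (𝟙 (F.functor.op ⋙ G))).w
  have h2 := cmpAct_par_left hW F H G =≫ Functor.whiskerLeft F.functor.op (W.str.sym.ext H G)
  have h3 := whisker_cmpAct hW F (W.str.sym.ext H G)
  unfold NLinear at h3
  rw [h]
  simp only [Category.assoc] at h2
  rw [h2, h3, ← Category.assoc (convMap _ _ _) (convMap _ _ _), ← convMap_comp, Category.id_comp]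

/-- `F` preserves the sequential left unitors, hence the comultiplication of `N`; in `W` that
comultiplication corresponds under the isomorphism `φ₀` to `ψ₀`, by `phi0_seqDelta`. -/
lemma seqDelta_cmpUnit : seqDelta V.str ≫ convOver F.seq.split (cmpUnit hW F) (cmpUnit hW F) =
    cmpUnit hW F ≫ Functor.whiskerLeft F.functor.op W.str.psi0 := by
  haveI : IsIso W.str.phi0 := hW
  have h := (PreservesLeft.sq (M := V.str.seq.toPromonoidalData) F.seq.map_left F.seq.unit).w
  have h1 : seqDelta V.str ≫ convOver F.seq.split F.seq.unit F.seq.unit =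
      F.seq.unit ≫ Functor.whiskerLeft F.functor.op (seqDelta W.str) := by
    have h2 := seqDelta V.str ≫= (h =≫ Functor.whiskerLeft F.functor.op (seqDelta W.str))
    rw [Category.assoc, Category.assoc, ← Functor.whiskerLeft_comp, leftExt_seqDelta,
      Functor.whiskerLeft_id', Category.comp_id, reassoc_of% (seqDelta_leftExt V.str)] at h2
    exact h2.symm
  have h3 : (seqDelta V.str ≫ convOver F.seq.split (cmpUnit hW F) (cmpUnit hW F)) ≫
      Functor.whiskerLeft F.functor.op (convMap W.str.seq.tensor W.str.phi0 W.str.phi0) =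
      (cmpUnit hW F ≫ Functor.whiskerLeft F.functor.op W.str.psi0) ≫
      Functor.whiskerLeft F.functor.op (convMap W.str.seq.tensor W.str.phi0 W.str.phi0) := by
    rw [Category.assoc, Category.assoc, convOver_convMap, cmpUnit_phi0, h1,
      ← Functor.whiskerLeft_comp, ← phi0_seqDelta, Functor.whiskerLeft_comp, ← Category.assoc,
      cmpUnit_phi0]
  have h4 := h3 =≫ Functor.whiskerLeft F.functor.op
    (convMap W.str.seq.tensor (inv W.str.phi0) (inv W.str.phi0))
  simpa only [Category.assoc, ← Functor.whiskerLeft_comp, ← convMap_comp, IsIso.hom_inv_id,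
    convMap_id, Functor.whiskerLeft_id', Category.comp_id] using h4

/-- The duplicated scalar becomes `ψ₀` by `seqDelta_cmpUnit`, `F` carries `ψ₂` to `ψ₂`, and the unit
axiom of `ψ₂` in `W` collapses the result to the left unitor. -/
lemma nLinear_cmpAct (G H : Psh W.carrier) :
    NLinear V.str (seqAct (cmpAct hW F G) (cmpAct hW F H)) (cmpAct hW F _)
      (convOver F.seq.split (𝟙 (F.functor.op ⋙ G)) (𝟙 (F.functor.op ⋙ H))) := by
  have hp : PreservesPsi2 (V := V.str.toDuoData) (W := W.str.toDuoData) F.par.split F.seq.split :=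
    F.map_psi2
  have h := (hp.sq (cmpUnit hW F) (cmpUnit hW F) (𝟙 (F.functor.op ⋙ G))
    (𝟙 (F.functor.op ⋙ H))).w
  have e := cmp_eq hW F (convOver F.seq.split (𝟙 (F.functor.op ⋙ G)) (𝟙 (F.functor.op ⋙ H)))
  rw [nLift] at e
  unfold NLinear
  rw [← e, seqAct, Category.assoc, Category.assoc, convMap_convOver, cmpAct, cmpAct, cmp, cmp,
    Category.comp_id, Category.comp_id, ← convOver_convMap, reassoc_of% h, ← Category.assoc,
    convMap_convOver, seqDelta_cmpUnit, Category.id_comp, cmp, ← W.str.psi2_par_leftExt,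
    Functor.whiskerLeft_comp, Functor.whiskerLeft_comp,
    ← Category.assoc (convOver F.par.split (cmpUnit hW F) _), convOver_convMap,
    Functor.whiskerLeft_id', Category.comp_id]

lemma convYo_split {C D : Type u} [SmallCategory C] [SmallCategory D] {J : C ⥤ D} {P : Split C}
    {Q : Split D} (s : SplitMap J P Q) (A B : C) :
    convOver s (yonedaMap J A) (yonedaMap J B) ≫ Functor.whiskerLeft J.op
      (convYo Q (J.obj A) (J.obj B)) = convYo P A B ≫ s.app A B := by
  ext X Y f g : 1
  exact (s.natural f g).symm.trans (Category.assoc _ _ _).symm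

/-- Linear extension of `F_⊗` is compatible with products because `F_⊗` is bilinear. Naturality of
the lifted parallel splits in Kleisli morphisms depends on this. -/
lemma parMul_cmpPar (A B : V.carrier) :
    parMul V.str A B ≫ cmpPar hW F A B =
      convOver F.par.split (cmpHom hW F A) (cmpHom hW F B) ≫ Functor.whiskerLeft F.functor.op
        (convYo W.str.par.tensor (F.functor.obj A) (F.functor.obj B)) := by
  have h := (nBilinear_cmpAct hW F (yo (F.functor.obj A)) (yo (F.functor.obj B))).convMap_nLift
    (nAction_cmpAct hW F _) (yonedaMap F.functor A) (yonedaMap F.functor B)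
  rw [← cmp_eq, ← cmp_eq, ← cmp_eq, convMap_convOver, convMap_convOver, Category.comp_id,
    Category.comp_id, Category.comp_id, Category.comp_id] at h
  rw [cmpHom, cmpHom, h, Category.assoc, ← cmp_whisker, convYo_split, cmpPar, parMul,
    Category.assoc, cmp_eq, cmp_eq hW F (_ ≫ _), convMap_nLift]

lemma normId_cmpHom (B : V.carrier) :
    normId V.str B ≫ cmpHom hW F B = yonedaMap F.functor B := by
  rw [normId_eq, cmpHom, cmp_eq, nUnit_nLift (nAction_cmpAct hW F _)]

/-- Two successive linear extensions collapse to one by `nLift_nLift`. Read at an element, this says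
that `cmpHom` turns Kleisli composition into composition in `W`. -/
lemma elt_cmpHom {A B : V.carrier} (x : (normHom V.str B).obj (op A)) :
    klLift x ≫ cmpHom hW F B = cmpHom hW F A ≫ Functor.whiskerLeft F.functor.op
      (yoneda.map (X := F.functor.obj A) (Y := F.functor.obj B)
        ((cmpHom hW F B).app (op A) x)) := by
  rw [klLift, cmpHom, cmp_eq, nLift_nLift (nAction_cmpAct hW F _), ← cmp_eq, elt_over, ← cmp_eq,
    cmp_whisker, ← elt_id]
  rfl

lemma cmpHom_normComp {A B D : V.carrier} (x : (normHom V.str B).obj (op A))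
    (y : (normHom V.str D).obj (op B)) :
    (cmpHom hW F D).app (op A) (normComp V.str x y) =
      ((cmpHom hW F B).app (op A) x : F.functor.obj A ⟶ F.functor.obj B) ≫
        ((cmpHom hW F D).app (op B) y : F.functor.obj B ⟶ F.functor.obj D) :=
  congrArg (fun k => k.app (op A) x) (elt_cmpHom hW F y)

end Comparison

/-! ### The functor induced on the Kleisli category and its components. -/

section Lift

variable {V W : SymProduo.{u}} (hW : isNormal W) (F : V ⟶ W)

/-- The functor from the Kleisli category induced by a symmetric produoidal functor. -/
noncomputable def liftFunctor : Kl V.str ⥤ W.carrier where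
  obj A := F.functor.obj A.of
  map {A B} x := (cmpHom hW F B.of).app (op A.of) x
  map_id A := by
    have h := congrArg (fun k => k.app (op A.of) (𝟙 A.of)) (normId_cmpHom hW F A.of)
    exact h.trans (F.functor.map_id A.of)
  map_comp x y := cmpHom_normComp hW F x y

lemma liftFunctor_map_klFunctor {A B : V.carrier} (f : A ⟶ B) :
    (liftFunctor hW F).map ((klFunctor V.str).map f) = F.functor.map f :=
  congrArg (fun k => k.app (op A) f) (normId_cmpHom hW F B)

/-- Restriction along `F` is restriction along the Kleisli category. -/
noncomputable def toRes (Z : Psh W.carrier) :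
    F.functor.op ⋙ Z ⟶ (klFunctor V.str).op ⋙ (liftFunctor hW F).op ⋙ Z where
  app A := ↾fun z => z
  naturality A B f := by
    ext z
    exact congrArg (fun k => Z.map k.op z) (liftFunctor_map_klFunctor hW F f.unop).symm

lemma toRes_natural {Z Z' : Psh W.carrier} (t : Z ⟶ Z') :
    toRes hW F Z ≫ Functor.whiskerLeft (klFunctor V.str).op
        (Functor.whiskerLeft (liftFunctor hW F).op t) =
      Functor.whiskerLeft F.functor.op t ≫ toRes hW F Z' := rfl

lemma elt_cmpAct {Z : Psh W.carrier} {A : V.carrier} (z : (F.functor.op ⋙ Z).obj (op A)) :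
    convMap V.str.par.tensor (𝟙 _) (elt z) ≫ cmpAct hW F Z = cmpHom hW F A ≫
      Functor.whiskerLeft F.functor.op (elt (F := Z) (A := F.functor.obj A) z) := by
  have h : nLift V.str (cmpAct hW F Z) (elt z) = _ := (cmp_eq hW F (elt z)).symm
  have e := elt_over (𝟙 (F.functor.op ⋙ Z)) z
  rw [Category.comp_id] at e
  rw [e, cmp_whisker] at h
  rw [← e] at h
  exact h

lemma toRes_linear (Z : Psh W.carrier) :
    NLinear V.str (cmpAct hW F Z) (resAct ((liftFunctor hW F).op ⋙ Z)) (toRes hW F Z) := by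
  refine conv_right_elt_ext fun A z => ?_
  have h1 := elt_cmpAct hW F z =≫ toRes hW F Z
  have h2 := resAct_elt (F := (liftFunctor hW F).op ⋙ Z) (B := A) z
  have h3 : elt z ≫ toRes hW F Z = elt (F := (klFunctor V.str).op ⋙ (liftFunctor hW F).op ⋙ Z) z :=
    elt_comp z (toRes hW F Z)
  rw [← Category.assoc, h1, ← Category.assoc, ← convMap_comp, Category.comp_id, h3, h2]
  rfl

/-- `f` followed by `a`, with `a` defined on the Kleisli category, is `f'`. -/
def Factors {X : Psh V.carrier} {Y : Psh (Kl V.str)} {Z : Psh W.carrier}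
    (f : X ⟶ (klFunctor V.str).op ⋙ Y) (a : Y ⟶ (liftFunctor hW F).op ⋙ Z)
    (f' : X ⟶ F.functor.op ⋙ Z) : Prop :=
  f ≫ Functor.whiskerLeft (klFunctor V.str).op a = f' ≫ toRes hW F Z

variable {hW F}

section

variable {X : Psh V.carrier} {Y : Psh (Kl V.str)} {Z : Psh W.carrier}
    {f : X ⟶ (klFunctor V.str).op ⋙ Y} {a b : Y ⟶ (liftFunctor hW F).op ⋙ Z}
    {f' : X ⟶ F.functor.op ⋙ Z}

lemma Factors.whisker (h : Factors hW F f a f') {Z' : Psh W.carrier} (t : Z ⟶ Z') :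
    Factors hW F f (a ≫ Functor.whiskerLeft (liftFunctor hW F).op t)
      (f' ≫ Functor.whiskerLeft F.functor.op t) := by
  unfold Factors at *
  rw [Functor.whiskerLeft_comp, reassoc_of% h, toRes_natural, Category.assoc]

lemma Factors.precomp (h : Factors hW F f a f') {X' : Psh V.carrier} (g : X' ⟶ X) :
    Factors hW F (g ≫ f) a (g ≫ f') := by
  unfold Factors at *
  rw [Category.assoc, h, Category.assoc]

lemma Factors.move {Y' : Psh (Kl V.str)} {g : X ⟶ (klFunctor V.str).op ⋙ Y'} {s : Y' ⟶ Y}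
    (hg : g ≫ Functor.whiskerLeft (klFunctor V.str).op s = f) (h : Factors hW F f a f') :
    Factors hW F g (s ≫ a) f' := by
  unfold Factors at *
  rw [Functor.whiskerLeft_comp, ← Category.assoc, hg, h]

/-- Each axiom for the lift is proved by exhibiting both sides as factorizations of the same map
along a generating one. -/
lemma Factors.unique (hf : Generates f) (ha : Factors hW F f a f') (hb : Factors hW F f b f') :
    a = b :=
  hf.hom_ext (ha.trans hb.symm)

/-- Factorizations of nested convolutions are assembled from those of the splits and of the slots;
no element of a coend on `Kl V` has to be inspected later. -/
lemma Factors.conv {P : Split V.carrier} {PK : Split (Kl V.str)} {Q : Split W.carrier}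
    {r : SplitMap (klFunctor V.str) P PK} {t : SplitMap (liftFunctor hW F) PK Q}
    {s : SplitMap F.functor P Q}
    (hs : ∀ A B, Factors hW F (r.app A B)
      (Z := (Q.obj (F.functor.obj A)).obj (F.functor.obj B)) (t.app _ _) (s.app A B))
    {X' : Psh V.carrier} {Y' : Psh (Kl V.str)} {Z' : Psh W.carrier}
    {g : X' ⟶ (klFunctor V.str).op ⋙ Y'} {c : Y' ⟶ (liftFunctor hW F).op ⋙ Z'}
    {g' : X' ⟶ F.functor.op ⋙ Z'} (hf : Factors hW F f a f') (hg : Factors hW F g c g') :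
    Factors hW F (convOver r f g) (convOver t a c) (convOver s f' g') := by
  refine psh_hom_ext fun A e => ?_
  induction e using conv_ind with | h X Y p x y =>
  have h1 := congrArg (fun k => k.app A p) (hs X Y)
  have h2 := congrArg (fun k => k.app (op X) x) hf
  have h3 := congrArg (fun k => k.app (op Y) y) hg
  change (cmk ((t.app _ _).app _ ((r.app X Y).app A p)) (a.app _ (f.app _ x))
    (c.app _ (g.app _ y)) : (Produoidal.conv Q Z Z').obj (op (F.functor.obj A.unop))) =
    cmk ((s.app X Y).app A p) (f'.app _ x) (g'.app _ y)
  refine (congrArg (fun w => (cmk w _ _ : (Produoidal.conv Q Z Z').obj _)) h1).trans ?_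
  exact congrArg₂ (fun u v => (cmk _ u v : (Produoidal.conv Q Z Z').obj _)) h2 h3

end

variable (hW F)

lemma factors_homRes (A : V.carrier) :
    Factors hW F (Z := yo (F.functor.obj A)) (homRes V.str A)
      (yonedaMap (liftFunctor hW F) ((klFunctor V.str).obj A))
      (cmpHom hW F A) := rfl

lemma nLift_toRes {X : Psh V.carrier} {Z : Psh W.carrier} (a : X ⟶ F.functor.op ⋙ Z) :
    nLift V.str (resAct _) (a ≫ toRes hW F Z) = cmp hW F a ≫ toRes hW F Z := by
  rw [cmp_eq, nLift_comp _ (toRes_linear hW F Z)]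

lemma ins_cmpHom_convYo {P : Split V.carrier} {Q : Split W.carrier} (s : SplitMap F.functor P Q)
    {A A' B B' : V.carrier} (x : (normHom V.str A').obj (op A)) (y : (normHom V.str B').obj (op B)) :
    ins P x y ≫ convOver s (cmpHom hW F A') (cmpHom hW F B') ≫
        Functor.whiskerLeft F.functor.op (convYo Q (F.functor.obj A') (F.functor.obj B')) =
      s.app A B ≫ Functor.whiskerLeft F.functor.op
        ((Q.map (X := F.functor.obj A) (Y := F.functor.obj A') ((cmpHom hW F A').app (op A) x)).app
          (F.functor.obj B) ≫ (Q.obj (F.functor.obj A')).map (X := F.functor.obj B)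
            (Y := F.functor.obj B') ((cmpHom hW F B').app (op B) y)) := rfl

/-- The parallel splits of the induced functor. -/
noncomputable def liftParApp (A B : V.carrier) : klFree V.str ((V.str.par.tensor.obj A).obj B) ⟶
    (liftFunctor hW F).op ⋙ (W.str.par.tensor.obj (F.functor.obj A)).obj (F.functor.obj B) :=
  freeDesc (F.par.split.app A B ≫ toRes hW F _)

lemma factors_liftParApp (A B : V.carrier) :
    Factors hW F (klGen V.str _) (liftParApp hW F A B) (F.par.split.app A B) :=
  klGen_freeDesc _

/-- On generators the left side is the linear extension of `F_⊗` evaluated at the product of the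
scalars in `x` and `y`, which `parMul_cmpPar` computes in `W`. -/
lemma parMap_liftParApp {A A' B B' : V.carrier} (x : (normHom V.str A').obj (op A))
    (y : (normHom V.str B').obj (op B)) :
    klExt V.str (ins V.str.par.tensor x y ≫ parMul V.str A' B') ≫ liftParApp hW F A' B' =
      liftParApp hW F A B ≫ Functor.whiskerLeft (liftFunctor hW F).op
        ((W.str.par.tensor.map (X := F.functor.obj A) (Y := F.functor.obj A')
          ((cmpHom hW F A').app (op A) x)).app (F.functor.obj B) ≫
            (W.str.par.tensor.obj (F.functor.obj A')).map (X := F.functor.obj B)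
            (Y := F.functor.obj B') ((cmpHom hW F B').app (op B) y)) := by
  have h1 := (factors_liftParApp hW F A B).whisker
    ((W.str.par.tensor.map (X := F.functor.obj A) (Y := F.functor.obj A')
          ((cmpHom hW F A').app (op A) x)).app (F.functor.obj B) ≫
            (W.str.par.tensor.obj (F.functor.obj A')).map (X := F.functor.obj B)
            (Y := F.functor.obj B') ((cmpHom hW F B').app (op B) y))
  refine Factors.unique (generates_klGen _) ?_ h1
  rw [← ins_cmpHom_convYo hW F F.par.split x y, ← parMul_cmpPar]
  unfold Factors
  rw [liftParApp, klExt_freeDesc, klGen_freeDesc, nLift_toRes, Category.assoc, Category.assoc,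
    Category.assoc]
  rfl

/-- The parallel splits of the induced functor. -/
noncomputable def liftPar : SplitMap (liftFunctor hW F) (parK V.str) W.str.par.tensor where
  app A B := liftParApp hW F A.of B.of
  natural {A A' B B'} x y := by
    refine (Category.assoc _ _ _).symm.trans ((congrArg (fun t : klFree V.str
      ((V.str.par.tensor.obj A.of).obj B.of) ⟶ klFree V.str
      ((V.str.par.tensor.obj A'.of).obj B'.of) => t ≫ liftParApp hW F A'.of B'.of)
      (parK_map V.str x y)).trans ?_)
    exact parMap_liftParApp hW F (A := A.of) (A' := A'.of) (B := B.of) (B' := B'.of) x y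

lemma cmpHom_linear (A : V.carrier) :
    NLinear V.str (nAct V.str (yo A)) (cmpAct hW F _) (cmpHom hW F A) := by
  rw [cmpHom, cmp_eq]
  exact nLift_linear (nAction_cmpAct hW F _) _

lemma cmpSeq_linear (A B : V.carrier) :
    NLinear V.str (seqObj V.str A B).act (cmpAct hW F _) (cmpSeq hW F A B) := by
  have h := (((cmpHom_linear hW F A).seq (cmpHom_linear hW F B)).comp
    (nLinear_cmpAct hW F _ _)).comp
      (whisker_cmpAct hW F (convYo W.str.seq.tensor (F.functor.obj A) (F.functor.obj B)))
  rw [convMap_convOver, Category.comp_id, Category.comp_id] at h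
  exact h

/-- The sequential splits of the induced functor. -/
noncomputable def liftSeqApp (A B : V.carrier) : (seqObj V.str A B).toPsh ⟶
    (liftFunctor hW F).op ⋙ (W.str.seq.tensor.obj (F.functor.obj A)).obj (F.functor.obj B) :=
  (seqObj V.str A B).desc (cmpSeq hW F A B ≫ toRes hW F _)
    ((cmpSeq_linear hW F A B).comp (toRes_linear hW F _))

lemma factors_liftSeqApp (A B : V.carrier) :
    Factors hW F (seqObj V.str A B).res (liftSeqApp hW F A B) (cmpSeq hW F A B) := rfl

/-- Generators carry unit scalars, which `cmpHom` sends to plain morphisms; Yoneda reduction on both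
sides then leaves `F_◁`. -/
lemma seqGen_cmpSeq (A B : V.carrier) :
    seqGen V.str A B ≫ cmpSeq hW F A B = F.seq.split.app A B := by
  rw [cmpSeq, seqGen, Category.assoc, ← Category.assoc (convMap _ _ _), convMap_convOver,
    ← normId_eq, ← normId_eq, normId_cmpHom, normId_cmpHom, convYo_split]
  exact (convYoIso V.str.seq.tensor A B).inv_hom_id_assoc _

lemma convYo_natural {C : Type u} [SmallCategory C] (Q : Split C) {A A' B B' : C} (f : A ⟶ A')
    (g : B ⟶ B') : convMap Q (yoneda.map f) (yoneda.map g) ≫ convYo Q A' B' =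
      convYo Q A B ≫ (Q.map f).app B ≫ (Q.obj A').map g := by
  ext X Y x y : 1
  rw [← Category.assoc, ins_convMap, ← Category.assoc, ins_convYo, ins_convYo]
  simp

lemma seqMap_liftSeqApp {A A' B B' : V.carrier} (x : (normHom V.str A').obj (op A))
    (y : (normHom V.str B').obj (op B)) :
    seqMap V.str x y ≫ liftSeqApp hW F A' B' =
      liftSeqApp hW F A B ≫ Functor.whiskerLeft (liftFunctor hW F).op
        ((W.str.seq.tensor.map (X := F.functor.obj A) (Y := F.functor.obj A')
          ((cmpHom hW F A').app (op A) x)).app (F.functor.obj B) ≫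
            (W.str.seq.tensor.obj (F.functor.obj A')).map (X := F.functor.obj B)
            (Y := F.functor.obj B') ((cmpHom hW F B').app (op B) y)) := by
  have h1 := (factors_liftSeqApp hW F A B).whisker
    ((W.str.seq.tensor.map (X := F.functor.obj A) (Y := F.functor.obj A')
          ((cmpHom hW F A').app (op A) x)).app (F.functor.obj B) ≫
            (W.str.seq.tensor.obj (F.functor.obj A')).map (X := F.functor.obj B)
            (Y := F.functor.obj B') ((cmpHom hW F B').app (op B) y))
  refine NModule.hom_ext (Eq.trans ?_ h1.symm)
  have h2 : convMap V.str.seq.tensor (klLift x) (klLift y) ≫ cmpSeq hW F A' B' =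
      cmpSeq hW F A B ≫ Functor.whiskerLeft F.functor.op
        ((W.str.seq.tensor.map (X := F.functor.obj A) (Y := F.functor.obj A')
          ((cmpHom hW F A').app (op A) x)).app (F.functor.obj B) ≫
            (W.str.seq.tensor.obj (F.functor.obj A')).map (X := F.functor.obj B)
            (Y := F.functor.obj B') ((cmpHom hW F B').app (op B) y)) := by
    rw [cmpSeq, cmpSeq, Category.assoc, ← Functor.whiskerLeft_comp, ← convYo_natural,
      Functor.whiskerLeft_comp, ← Category.assoc, convMap_convOver, ← Category.assoc,
      convOver_convMap, elt_cmpHom, elt_cmpHom]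
  rw [← h2]
  rfl

/-- The sequential splits of the induced functor. -/
noncomputable def liftSeq : SplitMap (liftFunctor hW F) (seqK V.str) W.str.seq.tensor where
  app A B := liftSeqApp hW F A.of B.of
  natural {A A' B B'} x y := by
    refine (Category.assoc _ _ _).symm.trans ((congrArg (fun t : (seqObj V.str A.of B.of).toPsh ⟶
      (seqObj V.str A'.of B'.of).toPsh => t ≫ liftSeqApp hW F A'.of B'.of)
      (seqK_map V.str x y)).trans ?_)
    exact seqMap_liftSeqApp hW F (A := A.of) (A' := A'.of) (B := B.of) (B' := B'.of) x y

lemma factors_liftPar (A B : V.carrier) :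
    Factors hW F (Z := (W.str.par.tensor.obj (F.functor.obj A)).obj (F.functor.obj B))
      ((parEta V.str).app A B) ((liftPar hW F).app _ _) (F.par.split.app A B) :=
  factors_liftParApp hW F A B

lemma factors_liftSeq (A B : V.carrier) :
    Factors hW F (Z := (W.str.seq.tensor.obj (F.functor.obj A)).obj (F.functor.obj B))
      ((seqEta V.str).app A B) ((liftSeq hW F).app _ _) (F.seq.split.app A B) := by
  have h := (factors_liftSeqApp hW F A B).precomp (seqGen V.str A B)
  rw [seqGen_cmpSeq] at h
  exact h

lemma par_leftExt_unit {C : Type u} [SmallCategory C] (M : Promonoidal C) :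
    M.leftExt M.unit = M.rightExt M.unit := by
  letI := M.monoidalCategory
  exact MonoidalCategory.unitors_equal (C := Psh C)

lemma cmpUnit_linear : NLinear V.str V.str.phi2 (cmpAct hW F _) (cmpUnit hW F) := by
  unfold NLinear
  rw [phi2_cmpUnit, ← nLift, ← cmp_eq, cmp, par_leftExt_unit]

/-- The parallel unit of the induced functor. -/
noncomputable def liftUnit : unitK V.str ⟶ (liftFunctor hW F).op ⋙ W.str.par.unit :=
  (unitModule V.str).desc (cmpUnit hW F ≫ toRes hW F _)
    ((cmpUnit_linear hW F).comp (toRes_linear hW F _))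

lemma factors_liftUnit : Factors hW F (seqUnitEta V.str) (liftUnit hW F) (cmpUnit hW F) := rfl

lemma factors_liftUnit_par :
    Factors hW F (parUnitEta V.str) (liftUnit hW F) F.par.unit := by
  have h := (factors_liftUnit hW F).precomp V.str.phi0
  rw [phi0_cmpUnit] at h
  exact h

/-- The sequential unit of the induced functor. -/
noncomputable def liftSeqUnit : unitK V.str ⟶ (liftFunctor hW F).op ⋙ W.str.seq.unit :=
  liftUnit hW F ≫ Functor.whiskerLeft (liftFunctor hW F).op W.str.phi0

lemma factors_liftSeqUnit :
    Factors hW F (seqUnitEta V.str) (liftSeqUnit hW F) F.seq.unit := by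
  have h := (factors_liftUnit hW F).whisker W.str.phi0
  rw [cmpUnit_phi0] at h
  exact h

end Lift

/-! ### The induced functor is symmetric produoidal. -/

section LiftCoherence

lemma covers_homRes {C : Type u} [SmallCategory C] {V : SymProduoidalCat C} (A : C) :
    Covers (homRes V A) := fun _ z => ⟨z, rfl⟩

variable {V W : SymProduo.{u}} {hW : isNormal W} {F : V ⟶ W}

section

variable {M : PromonoidalData V.carrier} {MK : PromonoidalData (Kl V.str)}
  {M' : PromonoidalData W.carrier} {r : SplitMap (klFunctor V.str) M.tensor MK.tensor}
  {t : SplitMap (liftFunctor hW F) MK.tensor M'.tensor}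
  {s : SplitMap F.functor M.tensor M'.tensor}

/-- Preservation by `η` and by `F` shows that both sides factor the same map along the convolution
of the `homRes`, which generates; `Factors.unique` then identifies them. -/
lemma PreservesAssoc.of_factors
    (h : ∀ A B, Factors hW F (r.app A B)
      (Z := (M'.tensor.obj (F.functor.obj A)).obj (F.functor.obj B)) (t.app _ _) (s.app A B))
    (hr : PreservesAssoc r) (hs : PreservesAssoc s)
    (hg : ∀ A B D : V.carrier, Generates (convOver r (convOver r (homRes V.str A)
      (homRes V.str B)) (homRes V.str D))) : PreservesAssoc t := by
  intro ⟨A⟩ ⟨B⟩ ⟨D⟩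
  have fA := factors_homRes hW F A
  have fB := factors_homRes hW F B
  have fD := factors_homRes hW F D
  have hl := (Factors.conv h (Factors.conv h fA fB) fD).whisker
    (M'.assocExt (yo (F.functor.obj A)) (yo (F.functor.obj B)) (yo (F.functor.obj D)))
  have hr' := Factors.move (hr.sq (homRes V.str A) (homRes V.str B) (homRes V.str D)).w.symm
    ((Factors.conv h fA (Factors.conv h fB fD)).precomp _)
  rw [(hs.sq _ _ _).w] at hr'
  have e := Factors.unique (hg A B D) hl hr'
  rw [M'.assocExt_yo, MK.assocExt_yo] at e
  exact e

lemma PreservesLeft.of_factors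
    (h : ∀ A B, Factors hW F (r.app A B)
      (Z := (M'.tensor.obj (F.functor.obj A)).obj (F.functor.obj B)) (t.app _ _) (s.app A B))
    {i : M.unit ⟶ (klFunctor V.str).op ⋙ MK.unit}
    {j : MK.unit ⟶ (liftFunctor hW F).op ⋙ M'.unit} {k : M.unit ⟶ F.functor.op ⋙ M'.unit}
    (hi : Factors hW F i j k) (hr : PreservesLeft r i) (hs : PreservesLeft s k)
    (hg : ∀ A : V.carrier, Generates (convOver r i (homRes V.str A))) : PreservesLeft t j := by
  intro ⟨A⟩
  have fA := factors_homRes hW F A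
  have hl := (Factors.conv h hi fA).whisker (M'.leftExt (yo (F.functor.obj A)))
  have hr' := Factors.move (hr.sq (homRes V.str A)).w.symm (fA.precomp _)
  rw [(hs.sq _).w] at hr'
  have e := Factors.unique (hg A) hl hr'
  rw [M'.leftExt_yo, MK.leftExt_yo] at e
  exact e

lemma PreservesRight.of_factors
    (h : ∀ A B, Factors hW F (r.app A B)
      (Z := (M'.tensor.obj (F.functor.obj A)).obj (F.functor.obj B)) (t.app _ _) (s.app A B))
    {i : M.unit ⟶ (klFunctor V.str).op ⋙ MK.unit}
    {j : MK.unit ⟶ (liftFunctor hW F).op ⋙ M'.unit} {k : M.unit ⟶ F.functor.op ⋙ M'.unit}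
    (hi : Factors hW F i j k) (hr : PreservesRight r i) (hs : PreservesRight s k)
    (hg : ∀ A : V.carrier, Generates (convOver r (homRes V.str A) i)) : PreservesRight t j := by
  intro ⟨A⟩
  have fA := factors_homRes hW F A
  have hl := (Factors.conv h fA hi).whisker (M'.rightExt (yo (F.functor.obj A)))
  have hr' := Factors.move (hr.sq (homRes V.str A)).w.symm (fA.precomp _)
  rw [(hs.sq _).w] at hr'
  have e := Factors.unique (hg A) hl hr'
  rw [M'.rightExt_yo, MK.rightExt_yo] at e
  exact e

end

variable (hW F)

/-- The factorization of a symmetric produoidal functor to a normal symmetric produoidal category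
through the symmetric normalization. -/
noncomputable def lift : normalization V ⟶ W :=
  { functor := liftFunctor hW F
    par :=
      { split := liftPar hW F
        unit := liftUnit hW F
        map_assoc := PreservesAssoc.of_factors (M := V.str.par.toPromonoidalData)
          (MK := parDataK V.str) (M' := W.str.par.toPromonoidalData) (factors_liftPar hW F)
          (parEta_preservesAssoc V.str) F.par.map_assoc fun A B D =>
            ((covers_homRes A).generates.par (covers_homRes B).generates).par
              (covers_homRes D).generates
        map_left := PreservesLeft.of_factors (M := V.str.par.toPromonoidalData)
          (MK := parDataK V.str) (M' := W.str.par.toPromonoidalData) (factors_liftPar hW F)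
          (factors_liftUnit_par hW F) (parEta_preservesLeft V.str) F.par.map_left fun A =>
            generates_parUnitEta.par (covers_homRes A).generates
        map_right := PreservesRight.of_factors (M := V.str.par.toPromonoidalData)
          (MK := parDataK V.str) (M' := W.str.par.toPromonoidalData) (factors_liftPar hW F)
          (factors_liftUnit_par hW F) (parEta_preservesRight V.str) F.par.map_right fun A =>
            (covers_homRes A).generates.par generates_parUnitEta }
    seq :=
      { split := liftSeq hW F
        unit := liftSeqUnit hW F
        map_assoc := PreservesAssoc.of_factors (M := V.str.seq.toPromonoidalData)
          (MK := seqDataK V.str) (M' := W.str.seq.toPromonoidalData) (factors_liftSeq hW F)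
          (seqEta_preservesAssoc V.str) F.seq.map_assoc fun A B D =>
            (((covers_homRes A).seq (covers_homRes B)).seq (covers_homRes D)).generates
        map_left := PreservesLeft.of_factors (M := V.str.seq.toPromonoidalData)
          (MK := seqDataK V.str) (M' := W.str.seq.toPromonoidalData) (factors_liftSeq hW F)
          (factors_liftSeqUnit hW F) (seqEta_preservesLeft V.str) F.seq.map_left fun A =>
            (covers_seqUnitEta.seq (covers_homRes A)).generates
        map_right := PreservesRight.of_factors (M := V.str.seq.toPromonoidalData)
          (MK := seqDataK V.str) (M' := W.str.seq.toPromonoidalData) (factors_liftSeq hW F)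
          (factors_liftSeqUnit hW F) (seqEta_preservesRight V.str) F.seq.map_right fun A =>
            ((covers_homRes A).seq covers_seqUnitEta).generates }
    map_psi2 := by
      intro ⟨A⟩ ⟨B⟩ ⟨K⟩ ⟨L⟩
      have hp : PreservesPsi2 (V := V.str.toDuoData) (W := W.str.toDuoData) F.par.split
        F.seq.split := F.map_psi2
      have fA := factors_homRes hW F A
      have fB := factors_homRes hW F B
      have fK := factors_homRes hW F K
      have fL := factors_homRes hW F L
      have hl := (Factors.conv (factors_liftPar hW F) (Factors.conv (factors_liftSeq hW F) fA fB)
        (Factors.conv (factors_liftSeq hW F) fK fL)).whisker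
        (W.str.psi2Ext (yo (F.functor.obj A)) (yo (F.functor.obj B)) (yo (F.functor.obj K))
          (yo (F.functor.obj L)))
      have hr := Factors.move ((preservesPsi2_eta V.str).sq (homRes V.str A) (homRes V.str B)
        (homRes V.str K) (homRes V.str L)).w.symm ((Factors.conv (factors_liftSeq hW F)
          (Factors.conv (factors_liftPar hW F) fA fK)
          (Factors.conv (factors_liftPar hW F) fB fL)).precomp _)
      rw [(hp.sq _ _ _ _).w] at hr
      have e := Factors.unique (((covers_homRes A).seq (covers_homRes B)).generates.par
        ((covers_homRes K).seq (covers_homRes L)).generates) hl hr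
      rw [W.str.psi2Ext_yo] at e
      refine e.trans (congrArg (· ≫ _) ?_)
      exact (symK V.str).psi2Ext_yo ⟨A⟩ ⟨B⟩ ⟨K⟩ ⟨L⟩
    map_psi0 := by
      have hl := (factors_liftUnit_par hW F).whisker W.str.psi0
      have hr := Factors.move (sq_psi0K V.str).w.symm ((Factors.conv (factors_liftSeq hW F)
        (factors_liftUnit_par hW F) (factors_liftUnit_par hW F)).precomp _)
      rw [← F.map_psi0] at hr
      exact Factors.unique generates_parUnitEta hl hr
    map_phi2 := by
      have hl := (Factors.conv (factors_liftPar hW F)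
        (factors_liftSeqUnit hW F) (factors_liftSeqUnit hW F)).whisker W.str.phi2
      have hr := Factors.move (sq_phi2K V.str).w.symm ((factors_liftSeqUnit hW F).precomp _)
      rw [← F.map_phi2] at hr
      exact Factors.unique (covers_seqUnitEta.generates.par covers_seqUnitEta.generates) hl hr
    -- The sequential unit component was defined as the parallel one followed by `φ₀` of `W`, and
    -- `φ₀` of the normalization is the identity.
    map_phi0 := rfl
    map_sym := by
      intro ⟨A⟩ ⟨B⟩
      have hl := (factors_liftPar hW F A B).whisker
        (W.str.sym.app (F.functor.obj A) (F.functor.obj B))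
      have hr := Factors.move (parEta_preservesSym A B)
        ((factors_liftPar hW F B A).precomp (V.str.sym.app A B))
      rw [← F.map_sym] at hr
      exact Factors.unique (generates_klGen _) hl hr }

end LiftCoherence

/-- The components of two functors live over different underlying functors, hence the heterogeneous
equalities. In the applications objects agree definitionally, so ordinary equalities of elements
suffice. -/
lemma SymProduoidalFunctor.hext {C D : Type u} [SmallCategory C] [SmallCategory D]
    {V : SymProduoidalCat C} {W : SymProduoidalCat D} {G H : SymProduoidalFunctor V W}
    (hobj : ∀ A, G.functor.obj A = H.functor.obj A)
    (hmap : ∀ (A B : C) (f : A ⟶ B), HEq (G.functor.map f) (H.functor.map f))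
    (hpar : ∀ (A B : C) X z, HEq ((G.par.split.app A B).app X z) ((H.par.split.app A B).app X z))
    (hparUnit : ∀ X z, HEq (G.par.unit.app X z) (H.par.unit.app X z))
    (hseq : ∀ (A B : C) X z, HEq ((G.seq.split.app A B).app X z) ((H.seq.split.app A B).app X z))
    (hseqUnit : ∀ X z, HEq (G.seq.unit.app X z) (H.seq.unit.app X z)) : G = H := by
  obtain ⟨G, ⟨⟨s, _⟩, i, _, _, _⟩, ⟨⟨t, _⟩, n, _, _, _⟩, _, _, _, _, _⟩ := G
  obtain ⟨H, ⟨⟨s', _⟩, i', _, _, _⟩, ⟨⟨t', _⟩, n', _, _, _⟩, _, _, _, _, _⟩ := H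
  obtain rfl : G = H := Functor.hext hobj hmap
  obtain rfl : s = s' := by
    funext A B
    exact psh_hom_ext fun X z => eq_of_heq (hpar A B X z)
  obtain rfl : t = t' := by
    funext A B
    exact psh_hom_ext fun X z => eq_of_heq (hseq A B X z)
  obtain rfl : i = i' := psh_hom_ext fun X z => eq_of_heq (hparUnit X z)
  obtain rfl : n = n' := psh_hom_ext fun X z => eq_of_heq (hseqUnit X z)
  rfl

/-! ### Uniqueness of the factorization and the explicit form of the normalization. -/

section Universal

variable {V W : SymProduo.{u}} (hW : isNormal W)

lemma Factors.apply {F : V ⟶ W} {X : Psh V.carrier} {Y : Psh (Kl V.str)} {Z : Psh W.carrier}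
    {f : X ⟶ (klFunctor V.str).op ⋙ Y} {a : Y ⟶ (liftFunctor hW F).op ⋙ Z}
    {f' : X ⟶ F.functor.op ⋙ Z} (h : Factors hW F f a f') (A : V.carrier) (x : X.obj (op A)) :
    a.app (op ((klFunctor V.str).obj A)) (f.app (op A) x) = f'.app (op A) x :=
  congrArg (fun k => k.app (op A) x) h

lemma normEta_lift (F : V ⟶ W) : normEta V ≫ lift hW F = F :=
  SymProduoidalFunctor.hext (fun _ => rfl)
    (fun _ _ f => heq_of_eq (liftFunctor_map_klFunctor hW F f))
    (fun A B X z => heq_of_eq ((factors_liftPar hW F A B).apply hW X.unop z))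
    (fun X z => heq_of_eq ((factors_liftUnit_par hW F).apply hW X.unop z))
    (fun A B X z => heq_of_eq ((factors_liftSeq hW F A B).apply hW X.unop z))
    (fun X z => heq_of_eq ((factors_liftSeqUnit hW F).apply hW X.unop z))

lemma parDataK_leftExt {C : Type u} [SmallCategory C] {V : SymProduoidalCat C} (Z : Psh (Kl V)) :
    (parDataK V).leftExt Z = klLeft V Z := by
  refine (generates_parUnitEta.par (generates_id Z)).hom_ext ?_
  rw [parUnitEta_klLeft]
  exact ((parEta_preservesLeft V).sq (𝟙 ((klFunctor V).op ⋙ Z))).w.symm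

lemma cmp_app (F : V ⟶ W) {G : Psh V.carrier} {G' : Psh W.carrier} (a : G ⟶ F.functor.op ⋙ G')
    (A : V.carrier) (x : (conv V.str.par.tensor V.str.seq.unit G).obj (op A)) :
    (cmp hW F a).app (op A) x = (W.str.par.leftExt G').app (op (F.functor.obj A))
      ((convOver F.par.split (cmpUnit hW F) a).app (op A) x) := rfl

lemma cmpSeq_app (F : V ⟶ W) (A B D : V.carrier) (x : (normSeq V.str B D).obj (op A)) :
    (cmpSeq hW F B D).app (op A) x =
      (convYo W.str.seq.tensor (F.functor.obj B) (F.functor.obj D)).app (op (F.functor.obj A))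
        ((convOver F.seq.split (cmpHom hW F B) (cmpHom hW F D)).app (op A) x) := rfl

variable (H : normalization V ⟶ W)

/-- Since `φ₀` of the normalization is the identity, preservation of `φ₀` by `H` makes its
sequential unit the parallel one followed by `φ₀` of `W`; cancelling `φ₀` leaves the parallel one.
-/
lemma cmpUnit_comp_app (A : V.carrier) (z : V.str.seq.unit.obj (op A)) :
    (cmpUnit hW (normEta V ≫ H)).app (op A) z =
      H.par.unit.app (op ((klFunctor V.str).obj A)) z := by
  let u : V.str.seq.unit ⟶ (normEta V ≫ H).functor.op ⋙ W.str.par.unit :=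
    seqUnitEta V.str ≫ Functor.whiskerLeft (klFunctor V.str).op H.par.unit
  have h : cmpUnit hW (normEta V ≫ H) = u := by
    refine whisker_phi0_cancel hW (normEta V ≫ H) ?_
    rw [cmpUnit_phi0]
    refine psh_hom_ext fun X z => ?_
    exact (congrArg (fun k => k.app (op ((klFunctor V.str).obj X.unop)) z) H.map_phi0).symm
  rw [h]
  rfl

/-- The heart of uniqueness. Because `H` preserves left unitors, the linear extension formed in `W`
is the image under `H` of the one formed in the Kleisli category, so the comparison maps of `η ≫ H`
reproduce `H`. -/
lemma cmp_comp_app {G : Psh V.carrier} {Y : Psh (Kl V.str)} {Z : Psh W.carrier}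
    {a : G ⟶ (klFunctor V.str).op ⋙ Y} {b : Y ⟶ H.functor.op ⋙ Z}
    {c : G ⟶ (normEta V ≫ H).functor.op ⋙ Z}
    (hc : ∀ X x, c.app X x = b.app ((klFunctor V.str).op.obj X) (a.app X x)) (A : V.carrier)
    (x : (conv V.str.par.tensor V.str.seq.unit G).obj (op A)) :
    (cmp hW (normEta V ≫ H) c).app (op A) x =
      b.app (op ((klFunctor V.str).obj A)) ((nLift V.str (resAct Y) a).app (op A) x) := by
  have h1 := convOver_comp_apply (parEta V.str) H.par.split (a := seqUnitEta V.str) (b := a)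
    (a' := H.par.unit) (b' := b) (a'' := cmpUnit hW (normEta V ≫ H)) (b'' := c)
    (fun X z => cmpUnit_comp_app hW H X.unop z) hc (op A) x
  have h2 := congrArg (fun k => k.app (op ((klFunctor V.str).obj A))
    ((convOver (parEta V.str) (seqUnitEta V.str) a).app (op A) x))
    (PreservesLeft.sq (M := parDataK V.str) H.par.map_left b).w
  rw [parDataK_leftExt] at h2
  have h3 := congrArg (fun k => k.app (op A) x) (seqUnitEta_klLeft a)
  have h4 := (cmp_app hW (normEta V ≫ H) c A x).trans (congrArg (fun w =>
    (W.str.par.leftExt Z).app (op ((normEta V ≫ H).functor.obj A)) w) h1)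
  refine h4.trans ?_
  refine h2.symm.trans ?_
  exact congrArg (fun w => b.app (op ((klFunctor V.str).obj A)) w) h3

lemma cmpHom_comp_app {A B : V.carrier} (x : (normHom V.str B).obj (op A)) :
    (cmpHom hW (normEta V ≫ H) B).app (op A) x =
      H.functor.map (Kl.hom x) := by
  have h := cmp_comp_app hW H (a := yonedaMap (klFunctor V.str) B)
    (b := yonedaMap H.functor ((klFunctor V.str).obj B))
    (c := yonedaMap (normEta V ≫ H).functor B) (fun _ _ => rfl) A x
  have e : nLift V.str (resAct _) (yonedaMap (klFunctor V.str) B) = homRes V.str B := by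
    rw [yonedaMap_eq]
    exact (nLift_klGen (nUnit V.str (yo B))).trans (congrArg (· ≫ freeRes V.str (yo B))
      (nLift_nUnit V.str (yo B)))
  rw [e] at h
  exact h

lemma nLift_resAct_klGen {C : Type u} [SmallCategory C] {V : SymProduoidalCat C} (G : Psh C) :
    nLift V (resAct _) (klGen V G) = freeRes V G := by
  rw [klGen, nLift_klGen, nLift_nUnit, Category.id_comp]

lemma cmpPar_comp_app {A B D : V.carrier} (x : (normPar V.str B D).obj (op A)) :
    (cmpPar hW (normEta V ≫ H) B D).app (op A) x =
      (H.par.split.app ((klFunctor V.str).obj B) ((klFunctor V.str).obj D)).app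
        (op ((klFunctor V.str).obj A)) x := by
  have h := cmp_comp_app hW H (a := klGen V.str ((V.str.par.tensor.obj B).obj D))
    (Y := klFree V.str ((V.str.par.tensor.obj B).obj D))
    (b := H.par.split.app ((klFunctor V.str).obj B) ((klFunctor V.str).obj D))
    (c := (normEta V ≫ H).par.split.app B D) (fun _ _ => rfl) A x
  rw [nLift_resAct_klGen] at h
  exact h

/-- Both slots are values of `H` on Kleisli morphisms, so naturality of the sequential splits of `H`
moves Yoneda reduction inside `H`, where the convolution of the `homRes` reduces to the identity on
elements. -/
lemma cmpSeq_comp_app {A B D : V.carrier} (x : (normSeq V.str B D).obj (op A)) :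
    (cmpSeq hW (normEta V ≫ H) B D).app (op A) x =
      (H.seq.split.app ((klFunctor V.str).obj B) ((klFunctor V.str).obj D)).app
        (op ((klFunctor V.str).obj A)) x := by
  have h1 := convOver_comp_apply (seqEta V.str) H.seq.split (a := homRes V.str B)
    (b := homRes V.str D) (a' := yonedaMap H.functor ((klFunctor V.str).obj B))
    (b' := yonedaMap H.functor ((klFunctor V.str).obj D))
    (a'' := cmpHom hW (normEta V ≫ H) B) (b'' := cmpHom hW (normEta V ≫ H) D)
    (fun _ z => cmpHom_comp_app hW H z) (fun _ z => cmpHom_comp_app hW H z) (op A) x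
  have h2 := congrArg (fun k => k.app (op ((klFunctor V.str).obj A))
    ((convOver (seqEta V.str) (homRes V.str B) (homRes V.str D)).app (op A) x))
    (convYo_split H.seq.split ((klFunctor V.str).obj B) ((klFunctor V.str).obj D))
  have h3 := congrArg (fun k => k.app (op A) x) (convOver_seq_homRes (V := V.str) B D)
  have h4 := (cmpSeq_app hW (normEta V ≫ H) A B D x).trans (congrArg (fun w =>
    (convYo W.str.seq.tensor ((normEta V ≫ H).functor.obj B)
      ((normEta V ≫ H).functor.obj D)).app (op ((normEta V ≫ H).functor.obj A)) w) h1)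
  refine h4.trans ?_
  refine h2.trans ?_
  exact congrArg (fun w => (H.seq.split.app ((klFunctor V.str).obj B)
    ((klFunctor V.str).obj D)).app (op ((klFunctor V.str).obj A)) w) h3

/-- Each component of the lift is a comparison map of `η ≫ H`, hence the corresponding component of
`H`; for the sequential unit, preservation of `φ₀` by `H` is used once more. -/
lemma lift_normEta : lift hW (normEta V ≫ H) = H :=
  SymProduoidalFunctor.hext (fun _ => rfl)
    (fun A B f => heq_of_eq (cmpHom_comp_app hW H (A := A.of) (B := B.of) f))
    (fun A B X z => heq_of_eq ((congrArg (fun k => k.app (op X.unop.of) z)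
      (nLift_toRes hW (normEta V ≫ H) ((normEta V ≫ H).par.split.app A.of B.of))).trans
        (cmpPar_comp_app hW H (A := X.unop.of) (B := A.of) (D := B.of) z)))
    (fun X z => heq_of_eq (cmpUnit_comp_app hW H X.unop.of z))
    (fun A B X z => heq_of_eq (cmpSeq_comp_app hW H (A := X.unop.of) (B := A.of) (D := B.of) z))
    (fun X z => heq_of_eq ((congrArg (fun w => W.str.phi0.app (op (H.functor.obj X.unop)) w)
      (cmpUnit_comp_app hW H X.unop.of z)).trans
        (congrArg (fun k => k.app X z) H.map_phi0)))

/-- Written with a trailing identity so that the computation of comparison maps of `η ≫ H` applies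
with `H = 𝟙`. They become identities on elements, whose inverses are the maps `resInv`. -/
lemma isSymNormalization_normEta_id (hV : isNormal (normalization V)) :
    IsSymNormalization hV (normEta V ≫ 𝟙 (normalization V)) where
  obj_bijective := ⟨fun _ _ h => congrArg Kl.of h, fun A => ⟨A.of, rfl⟩⟩
  isIso_hom B := by
    have h : cmpHom hV (normEta V ≫ 𝟙 (normalization V)) B = homRes V.str B :=
      psh_hom_ext fun ⟨X⟩ z =>
        Eq.trans (cmpHom_comp_app hV (𝟙 (normalization V)) (A := X) z) rfl
    rw [h]
    exact ⟨(freeModule V.str (yo B)).resInv, rfl, rfl⟩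
  hom_id {A B} f := congrArg (fun k => k.app (op A) f)
    (normId_cmpHom hV (normEta V ≫ 𝟙 (normalization V)) B)
  hom_comp x y := cmpHom_normComp hV (normEta V ≫ 𝟙 (normalization V)) x y
  isIso_par A B := by
    have h : cmpPar hV (normEta V ≫ 𝟙 (normalization V)) A B = freeRes V.str _ :=
      psh_hom_ext fun ⟨X⟩ z =>
        Eq.trans (cmpPar_comp_app hV (𝟙 (normalization V)) (A := X) z) rfl
    rw [h]
    exact ⟨freeResInv V.str _, rfl, rfl⟩
  par_sym A B := by
    have h (A B : V.carrier) : cmpPar hV (normEta V ≫ 𝟙 (normalization V)) A B = freeRes V.str _ :=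
      psh_hom_ext fun ⟨X⟩ z =>
        Eq.trans (cmpPar_comp_app hV (𝟙 (normalization V)) (A := X) z) rfl
    rw [h, h]
    exact freeRes_klMap (V.str.sym.app A B)
  isIso_seq A B := by
    have h : cmpSeq hV (normEta V ≫ 𝟙 (normalization V)) A B = (seqObj V.str A B).res :=
      psh_hom_ext fun ⟨X⟩ z =>
        Eq.trans (cmpSeq_comp_app hV (𝟙 (normalization V)) (A := X) z) rfl
    rw [h]
    exact ⟨(seqObj V.str A B).resInv, rfl, rfl⟩
  isIso_par_unit := by
    have h : cmpUnit hV (normEta V ≫ 𝟙 (normalization V)) = seqUnitEta V.str :=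
      psh_hom_ext fun ⟨X⟩ z =>
        Eq.trans (cmpUnit_comp_app hV (𝟙 (normalization V)) X z) rfl
    rw [h]
    exact ⟨seqUnitEtaInv V.str, rfl, rfl⟩
  isIso_seq_unit := ⟨seqUnitEtaInv V.str, rfl, rfl⟩

lemma isSymNormalization_normEta (hV : isNormal (normalization V)) :
    IsSymNormalization hV (normEta V) := by
  have h := isSymNormalization_normEta_id hV
  rwa [Category.comp_id] at h

end Universal

/-! ### The adjunction and the main theorem. -/

/-- The symmetric normalization, as a normal symmetric produoidal category. -/
def normalObj (V : SymProduo.{u}) : NSymProduo.{u} := ⟨normalization V, isNormal_normalization V⟩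

/-- Symmetric produoidal functors out of the symmetric normalization. -/
noncomputable def normEquiv (V : SymProduo.{u}) (W : NSymProduo.{u}) :
    (normalObj V ⟶ W) ≃ (V ⟶ inclusion.obj W) where
  toFun G := normEta V ≫ inclusion.map G
  invFun F := ObjectProperty.homMk (X := normalObj V) (Y := W) (lift W.property F)
  left_inv G := by
    obtain ⟨G⟩ := G
    exact congrArg _ (lift_normEta W.property G)
  right_inv F := normEta_lift W.property F

lemma normEquiv_comp (V : SymProduo.{u}) (W W' : NSymProduo.{u}) (g : W ⟶ W')
    (h : normalObj V ⟶ W) :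
    normEquiv V W' (h ≫ g) = normEquiv V W h ≫ inclusion.map g := rfl

/-- Symmetric normalization, as a functor. -/
noncomputable def normFunctor : SymProduo.{u} ⥤ NSymProduo.{u} :=
  Adjunction.leftAdjointOfEquiv normEquiv normEquiv_comp

/-- Symmetric normalization is left adjoint to the inclusion. -/
noncomputable def normAdj : normFunctor.{u} ⊣ inclusion.{u} :=
  Adjunction.adjunctionOfEquivLeft normEquiv normEquiv_comp

end Produoidal

theorem mainTheorem10 :
    ∃ (N : Produoidal.SymProduo.{u} ⥤ Produoidal.NSymProduo.{u})
      (adj : N ⊣ Produoidal.inclusion.{u}),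
      ∀ V : Produoidal.SymProduo.{u},
        Produoidal.IsSymNormalization (N.obj V).property (adj.unit.app V) ∧
        ∀ (W : Produoidal.NSymProduo.{u}) (F : V ⟶ W.obj),
          ∃! G : N.obj V ⟶ W, adj.unit.app V ≫ Produoidal.inclusion.map G = F :=
  ⟨Produoidal.normFunctor, Produoidal.normAdj, fun V =>
    -- The unit of the adjunction is the image of the identity under `normEquiv`, which is `normEta
    -- V` by definition; bijectivity of `normEquiv` is the unique factorization.
    ⟨Produoidal.isSymNormalization_normEta _, fun W F =>
      (Produoidal.normEquiv V W).bijective.existsUnique F⟩⟩
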